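/- Conventions. Manifolds are smooth, finite-dimensional, Hausdorff and second countable; submanifolds are embedded (not necessarily closed) and without boundary. Let $(P,\Omega)$ be a symplectic manifold of dimension $d$. For a function $F$, smooth on an open subset of $P$, let $X_F$ be its Hamiltonian vector field, $\Omega(X_F,\cdot)=dF$, and $\{F,G\}=\Omega(X_F,X_G)$. For a subspace $A\subseteq T_xP$ let $A^\Omega=\{v\in T_xP:\Omega(v,w)=0\ \forall w\in A\}$. Given a subset $N\subseteq P$ and an open set $U\subseteq P$, second class equations of $N$ on $U$ are functions $\chi_1,\dots,\chi_{2s}\in C^\infty(U)$ with $N\cap U=\{y\in U:\chi_1(y)=\dots=\chi_{2s}(y)=0\}$ and $\det(\{\chi_i,\chi_j\}(y))\ne0$ for all $y\in U$ (so that the $d\chi_i$ are linearly independent on $U$). With $(c^{ij})$ the inverse of the matrix $(\{\chi_i,\chi_j\})$, the Dirac bracket of $F,G\in C^\infty(U)$ is $$\{F,G\}_{(\chi)}=\{F,G\}-\sum_{i,j}\{F,\chi_i\}\,c^{ij}\,\{\chi_j,G\}.$$ For a Poisson bracket $B$ on $C^\infty(U)$, the Hamiltonian vector field of $F$ is the field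 $X$ with $X(G)=B(G,F)$ for all $G\in C^\infty(U)$, and the symplectic leaf through $x\in U$ is the set of points of $U$ that can be joined to $x$ by finitely many successive integral curves in $U$ of Hamiltonian vector fields of functions in $C^\infty(U)$. Theorem. Let $S\subseteq P$ be a nonempty submanifold of dimension $k$, let $\omega$ be the pullback of $\Omega$ to $S$, and assume that $\ker\omega_x=T_xS\cap(T_xS)^\Omega$ has the same dimension $l$ for all $x\in S$. Let $V$ be a smooth vector subbundle of $TP|S$ such that $V_x\oplus\ker\omega_x=(T_xS)^\Omega$ for all $x\in S$. Then $d=k+l+2s$ for an integer $s\ge 0$, and the following hold. (1) There is a symplectic submanifold $S^V$ of $P$ containing $S$, of dimension $\dim S+\dim\ker\omega=k+l$, such that $T_xS^V=V_x^\Omega$ for all $x\in S$ (a second class submanifold; $V^\Omega$ is the second class subbundle tangent to it). Moreover, every submanifold $S^V$ as in (1) has the following properties. (2) Every $x\in S^V$ has an open neighborhood $U$ in $P$, with $S^V\cap U$ connected, on which $S^V$ has second class equations $\chi_1,\dots,\chi_{2s}$. (3) Every $x\in S$ has an open neighborhood $U$ in $P$ with second class equations $\chi_1,\dots,\chi_{2s}$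 of $S^V$ on $U$ and functions $\psi_1,\dots,\psi_l\in C^\infty(U)$ such that $S\cap U=\{y\in U:\chi_i(y)=0,\ \psi_j(y)=0\ \text{for all } i,j\}$, the differentials $d\chi_1,\dots,d\chi_{2s},d\psi_1,\dots,d\psi_l$ are linearly independent at every point of $U$, and the $\psi_j$ are first class constraints: $X_{\psi_j}(y)\in T_yS$ for all $y\in S\cap U$. (4) For every open set $U\subseteq P$ and all second class equations $\chi_1,\dots,\chi_{2s}$ of $S^V$ on $U$, the Dirac bracket $\{\,,\}_{(\chi)}$ is a Poisson bracket on $C^\infty(U)$; in particular it satisfies the Jacobi identity on $U$. For $x\in S^V\cap U$ its symplectic leaf through $x$ is the connected component of $S^V\cap U$ that contains $x$ (so $S^V\cap U$ is a symplectic leaf if it is connected and nonempty), and its leafwise symplectic form is the pullback of $\Omega$: for $F,G\in C^\infty(U)$ one has $\{F,G\}_{(\chi)}(x)=\Omega(u,v)$, where $u,v\in T_xS^V$ are the values at $x$ of the Hamiltonian vector fields of $F|S^V$ and $G|S^V$ with respect to the pullback of $\Omega$ to $S^V$. -/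

import Mathlib

open scoped Manifold ContDiff
open Set

noncomputable section

namespace SecondClass

variable {d : ℕ} {P : Type*} [TopologicalSpace P] [ChartedSpace (EuclideanSpace ℝ (Fin d)) P]

/-- Pullback of a `2`-form on the `d`-manifold `P` to the Euclidean space along the inverse of the
preferred chart at `x₀`; it is meaningful on the target of that chart. -/
def chartForm (η : ∀ x : P, TangentSpace (𝓡 d) x [⋀^Fin 2]→L[ℝ] ℝ) (x₀ : P)
    (y : EuclideanSpace ℝ (Fin d)) : EuclideanSpace ℝ (Fin d) [⋀^Fin 2]→L[ℝ] ℝ :=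
  (η ((extChartAt (𝓡 d) x₀).symm y)).compContinuousLinearMap
    (mfderiv 𝓘(ℝ, EuclideanSpace ℝ (Fin d)) (𝓡 d) (extChartAt (𝓡 d) x₀).symm y)

variable (d P) in
/-- A symplectic form: a smooth, closed, nondegenerate `2`-form. Smoothness and closedness are
expressed in the charts covering `P`. -/
structure SymplecticForm where
  form : ∀ x : P, TangentSpace (𝓡 d) x [⋀^Fin 2]→L[ℝ] ℝ
  smooth : ∀ x₀ : P, ContDiffOn ℝ ∞ (chartForm form x₀) (extChartAt (𝓡 d) x₀).target
  closed : ∀ x₀ : P, ∀ y ∈ (extChartAt (𝓡 d) x₀).target, extDeriv (chartForm form x₀) y = 0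
  nondegenerate : ∀ (x : P) (v : TangentSpace (𝓡 d) x), (∀ w, form x ![v, w] = 0) → v = 0

/-- The real functions that are smooth on the open set `U`, i.e. the elements of `C^∞(U)`; their
values outside `U` are irrelevant. -/
def SmoothOn (d : ℕ) {P : Type*} [TopologicalSpace P]
    [ChartedSpace (EuclideanSpace ℝ (Fin d)) P] (U : Set P) (F : P → ℝ) : Prop :=
  ContMDiffOn (𝓡 d) 𝓘(ℝ, ℝ) ∞ F U

/-- The differential of a function at a point. -/
def differential (d : ℕ) {P : Type*} [TopologicalSpace P]
    [ChartedSpace (EuclideanSpace ℝ (Fin d)) P] (F : P → ℝ) (x : P) :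
    TangentSpace (𝓡 d) x →L[ℝ] ℝ :=
  mfderiv (𝓡 d) 𝓘(ℝ, ℝ) F x

/-! ### Submanifolds -/

/-- `S` is an embedded (not necessarily closed) submanifold of `P` of dimension `k`, without
boundary: around each of its points there is a chart of the smooth structure of `P` in which `S` is
a `k`-dimensional linear slice. -/
def IsSubmanifold (d : ℕ) {P : Type*} [TopologicalSpace P]
    [ChartedSpace (EuclideanSpace ℝ (Fin d)) P] (S : Set P) (k : ℕ) : Prop :=
  ∀ x ∈ S, ∃ e ∈ IsManifold.maximalAtlas (𝓡 d) ∞ P, x ∈ e.source ∧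
    ∃ W : Submodule ℝ (EuclideanSpace ℝ (Fin d)), Module.finrank ℝ W = k ∧
      ∀ y ∈ e.source, y ∈ S ↔ e y ∈ W

/-- The tangent space `T_x S ⊆ T_x P` of an embedded submanifold `S` at `x ∈ S`: the vectors
annihilated by the differentials of all smooth functions, defined near `x`, that vanish on `S`. -/
def tangentAt (S : Set P) (x : P) : Submodule ℝ (TangentSpace (𝓡 d) x) where
  carrier := {v | ∀ (U : Set P) (f : P → ℝ), IsOpen U → x ∈ U → SmoothOn d U f →
    (∀ y ∈ S ∩ U, f y = 0) → differential d f x v = 0}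
  add_mem' := by
    intro a b ha hb U f hU hx hf h0
    rw [map_add, ha U f hU hx hf h0, hb U f hU hx hf h0, add_zero]
  zero_mem' := by
    intro U f _ _ _ _
    exact map_zero _
  smul_mem' := by
    intro c a ha U f hU hx hf h0
    rw [map_smul, ha U f hU hx hf h0, smul_zero]

/-- `V` is a smooth vector subbundle of `TP|S`: locally along `S` it has a frame consisting of
restrictions to `S` of smooth vector fields of `P`. Only the fibers `V x` with `x ∈ S` matter. -/
def IsSubbundleAlong [IsManifold (𝓡 d) ∞ P] (S : Set P) (V : ∀ x : P, Submodule ℝ (TangentSpace (𝓡 d) x)) : Prop :=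
  ∀ x ∈ S, ∃ U : Set P, IsOpen U ∧ x ∈ U ∧
    ∃ (m : ℕ) (X : Fin m → ∀ y : P, TangentSpace (𝓡 d) y),
      (∀ i, ContMDiffOn (𝓡 d) (𝓡 d).tangent ∞
        (fun y => (⟨y, X i y⟩ : TangentBundle (𝓡 d) P)) U) ∧
      ∀ y ∈ S ∩ U, LinearIndependent ℝ (fun i => X i y) ∧
        V y = Submodule.span ℝ (Set.range fun i => X i y)

/-! ### Symplectic linear algebra in the tangent spaces -/

namespace SymplecticForm

variable (Ω : SymplecticForm d P)

/-- The symplectic orthogonal `A^Ω` of a subspace `A ⊆ T_x P`. -/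
def orth {x : P} (A : Submodule ℝ (TangentSpace (𝓡 d) x)) :
    Submodule ℝ (TangentSpace (𝓡 d) x) where
  carrier := {v | ∀ w ∈ A, Ω.form x ![v, w] = 0}
  add_mem' := by
    intro a b ha hb w hw
    have h := (Ω.form x).toMultilinearMap.cons_add ![w] a b
    change Ω.form x ![a + b, w] = Ω.form x ![a, w] + Ω.form x ![b, w] at h
    rw [h, ha w hw, hb w hw, add_zero]
  zero_mem' := by
    intro w _
    exact (Ω.form x).map_coord_zero 0 rfl
  smul_mem' := by
    intro c a ha w hw
    have h := (Ω.form x).toMultilinearMap.cons_smul ![w] c a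
    change Ω.form x ![c • a, w] = c • Ω.form x ![a, w] at h
    rw [h, ha w hw, smul_zero]

/-- The kernel of the restriction of `Ω` to a subspace `A ⊆ T_x P`: the vectors `v ∈ A` with
`Ω (v, w) = 0` for all `w ∈ A`. For `A = T_x S` it is the kernel at `x` of the pullback of `Ω`
to `S`. -/
def ker {x : P} (A : Submodule ℝ (TangentSpace (𝓡 d) x)) :
    Submodule ℝ (TangentSpace (𝓡 d) x) :=
  A ⊓ Ω.orth A

theorem exists_sharp (x : P) (α : TangentSpace (𝓡 d) x →L[ℝ] ℝ) :
    ∃ v : TangentSpace (𝓡 d) x, ∀ w, Ω.form x ![v, w] = α w := by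
  let E := EuclideanSpace ℝ (Fin d)
  let η : E [⋀^Fin 2]→L[ℝ] ℝ := Ω.form x
  have hup : ∀ v a : E, Function.update ![v, 0] (1 : Fin 2) a = ![v, a] := by
    intro v a
    funext i
    fin_cases i <;> simp
  let L : E →ₗ[ℝ] (E →ₗ[ℝ] ℝ) := LinearMap.mk₂ ℝ (fun v w => η ![v, w])
    (fun a b w => η.toMultilinearMap.cons_add ![w] a b)
    (fun c a w => η.toMultilinearMap.cons_smul ![w] c a)
    (fun v a b => by
      have h := η.toMultilinearMap.map_update_add ![v, 0] 1 a b
      rw [hup, hup, hup] at h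
      exact h)
    (fun c v a => by
      have h := η.toMultilinearMap.map_update_smul ![v, 0] 1 c a
      rw [hup, hup] at h
      exact h)
  have hinj : Function.Injective L := by
    rw [← LinearMap.ker_eq_bot, LinearMap.ker_eq_bot']
    intro v hv
    exact Ω.nondegenerate x v fun w => LinearMap.congr_fun hv w
  have hsurj : Function.Surjective L :=
    (LinearMap.injective_iff_surjective_of_finrank_eq_finrank
      (Subspace.dual_finrank_eq (K := ℝ) (V := E)).symm).1 hinj
  obtain ⟨v, hv⟩ := hsurj (show E →L[ℝ] ℝ from α).toLinearMap
  exact ⟨v, fun w => LinearMap.congr_fun hv w⟩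

/-- The Hamiltonian vector `X_F(x)`, characterized by `Ω (X_F(x), w) = dF(x) w` for all `w`
(it is unique by nondegeneracy). -/
def hamVec (F : P → ℝ) (x : P) : TangentSpace (𝓡 d) x :=
  (Ω.exists_sharp x (differential d F x)).choose

theorem hamVec_spec (F : P → ℝ) (x : P) (w : TangentSpace (𝓡 d) x) :
    Ω.form x ![Ω.hamVec F x, w] = differential d F x w :=
  (Ω.exists_sharp x (differential d F x)).choose_spec w

/-- The Poisson bracket `{F, G} = Ω (X_F, X_G)`. -/
def bracket (F G : P → ℝ) (x : P) : ℝ :=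
  Ω.form x ![Ω.hamVec F x, Ω.hamVec G x]

/-- The matrix `c_ij(x) = {χ_i, χ_j}(x)`. -/
def constraintMatrix {m : ℕ} (χ : Fin m → P → ℝ) (x : P) : Matrix (Fin m) (Fin m) ℝ :=
  Matrix.of fun i j => Ω.bracket (χ i) (χ j) x

/-- The Dirac bracket `{F, G}_(χ) = {F, G} - {F, χ_i} c^ij {χ_j, G}`, with `(c^ij)` the inverse of
the matrix `({χ_i, χ_j})`; it is meaningful where that matrix is invertible. -/
def diracBracket {m : ℕ} (χ : Fin m → P → ℝ) (F G : P → ℝ) (x : P) : ℝ :=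
  Ω.bracket F G x -
    ∑ i, ∑ j, Ω.bracket F (χ i) x * (Ω.constraintMatrix χ x)⁻¹ i j * Ω.bracket (χ j) G x

/-- `N` is a second class submanifold for the subbundle `V` of `TP|S`, of dimension `q`: a
symplectic submanifold of `P` of dimension `q` that contains `S` and is tangent to `V^Ω` along `S`.
(The pullback of `Ω` to `N` is closed, so `N` is symplectic as soon as the pullback is
nondegenerate.) -/
structure IsSecondClassSubmanifold (S : Set P) (V : ∀ x : P, Submodule ℝ (TangentSpace (𝓡 d) x))
    (q : ℕ) (N : Set P) : Prop where
  isSubmanifold : IsSubmanifold d N q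
  symplectic : ∀ x ∈ N, Ω.ker (tangentAt (d := d) N x) = ⊥
  subset : S ⊆ N
  tangent : ∀ x ∈ S, tangentAt N x = Ω.orth (V x)

/-- On the open set `U`, the set `N` is given by the second class constraints
`χ_1 = 0, …, χ_m = 0`, that is, `det {χ_i, χ_j} ≠ 0` on `U`. (The differentials `dχ_i` are then
linearly independent at every point of `U`.) -/
structure IsSecondClassEquations (N U : Set P) {m : ℕ} (χ : Fin m → P → ℝ) : Prop where
  isOpen : IsOpen U
  smooth : ∀ i, SmoothOn d U (χ i)
  eq_zero_locus : N ∩ U = {y ∈ U | ∀ i, χ i y = 0}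
  det_ne_zero : ∀ y ∈ U, (Ω.constraintMatrix χ y).det ≠ 0

/-- `u ∈ T_x N` is the value at `x` of the Hamiltonian vector field of `F|N` on the symplectic
submanifold `N`, carrying the pullback of `Ω`. -/
def IsRestrictedHamVec (N : Set P) (F : P → ℝ) (x : P) (u : TangentSpace (𝓡 d) x) : Prop :=
  u ∈ tangentAt N x ∧ ∀ w ∈ tangentAt N x, Ω.form x ![u, w] = differential d F x w

end SymplecticForm

/-! ### Poisson brackets and their symplectic leaves -/

/-- `B` is a Poisson bracket on `C^∞(U)`: a well defined bilinear antisymmetric operation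
`C^∞(U) × C^∞(U) → C^∞(U)` that satisfies the Leibniz rule and the Jacobi identity. -/
structure IsPoissonBracketOn (d : ℕ) {P : Type*} [TopologicalSpace P]
    [ChartedSpace (EuclideanSpace ℝ (Fin d)) P] (U : Set P)
    (B : (P → ℝ) → (P → ℝ) → P → ℝ) : Prop where
  smooth : ∀ F G, SmoothOn d U F → SmoothOn d U G → SmoothOn d U (B F G)
  congr : ∀ F F' G, SmoothOn d U F → SmoothOn d U F' → SmoothOn d U G →
    EqOn F F' U → EqOn (B F G) (B F' G) U
  add_left : ∀ F F' G, SmoothOn d U F → SmoothOn d U F' → SmoothOn d U G →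
    EqOn (B (F + F') G) (B F G + B F' G) U
  smul_left : ∀ (c : ℝ) (F G), SmoothOn d U F → SmoothOn d U G →
    EqOn (B (c • F) G) (c • B F G) U
  antisymm : ∀ F G, SmoothOn d U F → SmoothOn d U G → EqOn (B F G) (-B G F) U
  leibniz : ∀ F G H, SmoothOn d U F → SmoothOn d U G → SmoothOn d U H →
    EqOn (B (F * G) H) (F * B G H + G * B F H) U
  jacobi : ∀ F G H, SmoothOn d U F → SmoothOn d U G → SmoothOn d U H →
    EqOn (B (B F G) H + B (B H F) G + B (B G H) F) 0 U

/-- `X` is on `U` the Hamiltonian vector field of `F` with respect to the bracket `B`: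
`X(G) = B(G, F)` for all `G ∈ C^∞(U)`. -/
def IsHamiltonianField (U : Set P) (B : (P → ℝ) → (P → ℝ) → P → ℝ) (F : P → ℝ)
    (X : ∀ x : P, TangentSpace (𝓡 d) x) : Prop :=
  ∀ G, SmoothOn d U G → ∀ x ∈ U, differential d G x (X x) = B G F x

/-- Some integral curve in `U` of the Hamiltonian vector field of some function `F ∈ C^∞(U)`
joins `x` to `y`. (Rescaling `F`, the curve may be parametrized by `[0, 1]`.) -/
def HamiltonianStep (d : ℕ) {P : Type*} [TopologicalSpace P]
    [ChartedSpace (EuclideanSpace ℝ (Fin d)) P] (U : Set P)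
    (B : (P → ℝ) → (P → ℝ) → P → ℝ) (x y : P) : Prop :=
  ∃ (F : P → ℝ) (X : ∀ z : P, TangentSpace (𝓡 d) z) (γ : ℝ → P),
    SmoothOn d U F ∧ IsHamiltonianField U B F X ∧ (∀ t ∈ Icc (0 : ℝ) 1, γ t ∈ U) ∧
    IsMIntegralCurveOn (I := 𝓡 d) γ X (Icc 0 1) ∧ γ 0 = x ∧ γ 1 = y

/-- The symplectic leaf through `x` of the Poisson bracket `B` on `C^∞(U)`: the points that are
joined to `x` by a piecewise smooth curve each of whose pieces is an integral curve of a
Hamiltonian vector field. -/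
def symplecticLeaf (d : ℕ) {P : Type*} [TopologicalSpace P]
    [ChartedSpace (EuclideanSpace ℝ (Fin d)) P] (U : Set P)
    (B : (P → ℝ) → (P → ℝ) → P → ℝ) (x : P) : Set P :=
  {y | Relation.ReflTransGen (HamiltonianStep d U B) x y}

end SecondClass

end

open SecondClass

set_option linter.unusedSectionVars false

noncomputable section

namespace SecondClass

section

variable {d : ℕ} {P : Type*} [TopologicalSpace P] [ChartedSpace (EuclideanSpace ℝ (Fin d)) P]

/-! Linear algebra. The radical of Ω on (TS)^Ω is ker ω, so the complement V is symplectic; its rank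
is therefore an even number 2s, and V^Ω is a symplectic complement of V containing TS. Similarly,
where det {χ_i, χ_j} ≠ 0, the tangent space is the direct sum of the span of the X_{χ_i} and of the
common kernel of the dχ_i. The projection Q = Σ X_{χ_i} c^{ij} dχ_j onto the first summand
(`constraintProj`) depends only on that kernel (`constraintProj_congr`).

Existence. In a slice chart, a local frame of V ⊆ (TS)^Ω is realized along S by Hamiltonian vectors
of functions χ_i vanishing on S (`exists_functions_of_frame`), so S^V exists locally as a zero set.
Gluing uses countably many such systems χ_m and cutoffs b_m equal to 1 on open sets O_m that cover
S. The field Σ c^{ij} χ_j X_{χ_i} vanishes on the zero set with linear part Q there (`eulerField`);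
weighted by b_r ∏_{j<r} (1 - b_j), these fields add up to partial sums E that no longer change on
O_m after the index m. With Π_m the composite of the operators 1 - b_j (1 - Q_j), j < m, the
equations on O_m are dχ_m(Π_m E) = 0. On O_m the factor with index m is Q_m itself, so the kernel of
dχ_m ∘ Π_m is contained in the corresponding kernel for every later m'. Where both maps have full
rank the dimensions agree, the kernels coincide, and so do the zero sets (`ker_test_eq`,
`mem_glued_iff`). Along S all Q_m agree, so the new equations have the same differentials as the old
ones (`differential_fn`), and the glued set has tangent space V^Ω there.

First class constraints. Subtracting from functions vanishing on S a combination of the χ_i composes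
their differentials with 1 - Q along S. These then kill V, and they kill ker ω ⊆ TS; so they kill
(TS)^Ω, which means X_ψ ∈ TS (`exists_firstClass_equations`).

Dirac bracket. With Y_F = (1 - Q) X_F one has {G, F}_χ = dG(Y_F) and {F, G}_χ = Ω(Y_F, Y_G). The Y_F
are tangent to all level sets of χ, and evaluating dΩ = 0 on three of them gives the Jacobi identity
(`diracBracket_jacobi`). The χ_i are constant along integral curves, so leaves stay in components.
Conversely, nearby points of S^V are joined by a straight segment in a slice chart, which is made an
integral curve by an explicit Hamiltonian (`exists_hamiltonianStep`). -/

instance finiteDimensional_tangentSpace (x : P) : FiniteDimensional ℝ (TangentSpace (𝓡 d) x) :=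
  inferInstanceAs (FiniteDimensional ℝ (EuclideanSpace ℝ (Fin d)))

theorem finrank_tangentSpace (x : P) : Module.finrank ℝ (TangentSpace (𝓡 d) x) = d :=
  finrank_euclideanSpace_fin (𝕜 := ℝ) (n := d)

/-! ### Calculus of smooth functions on open sets -/

section Calculus

variable {U : Set P} {F G : P → ℝ} {x : P}

theorem SmoothOn.mono {U' : Set P} (hF : SmoothOn d U F) (h : U' ⊆ U) : SmoothOn d U' F :=
  ContMDiffOn.mono hF h

theorem SmoothOn.contMDiffAt (hF : SmoothOn d U F) (hU : IsOpen U) (hx : x ∈ U) :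
    ContMDiffAt (𝓡 d) 𝓘(ℝ, ℝ) ∞ F x :=
  ContMDiffOn.contMDiffAt hF (hU.mem_nhds hx)

theorem SmoothOn.mdifferentiableAt (hF : SmoothOn d U F) (hU : IsOpen U) (hx : x ∈ U) :
    MDifferentiableAt (𝓡 d) 𝓘(ℝ, ℝ) F x :=
  (hF.contMDiffAt hU hx).mdifferentiableAt (by simp)

theorem SmoothOn.continuousOn (hF : SmoothOn d U F) : ContinuousOn F U :=
  ContMDiffOn.continuousOn hF

theorem smoothOn_of_locally (h : ∀ x ∈ U, ∃ U', IsOpen U' ∧ x ∈ U' ∧ SmoothOn d (U ∩ U') F) :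
    SmoothOn d U F :=
  contMDiffOn_of_locally_contMDiffOn h

theorem SmoothOn.congr (hF : SmoothOn d U F) (h : ∀ y ∈ U, G y = F y) : SmoothOn d U G :=
  ContMDiffOn.congr hF h

theorem smoothOn_const (c : ℝ) : SmoothOn d U (fun _ => c) :=
  contMDiffOn_const

theorem SmoothOn.sub (hF : SmoothOn d U F) (hG : SmoothOn d U G) :
    SmoothOn d U (fun y => F y - G y) :=
  ContMDiffOn.sub hF hG

theorem SmoothOn.mul (hF : SmoothOn d U F) (hG : SmoothOn d U G) :
    SmoothOn d U (fun y => F y * G y) :=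
  ContMDiffOn.mul hF hG

theorem SmoothOn.inv (hF : SmoothOn d U F) (h0 : ∀ y ∈ U, F y ≠ 0) :
    SmoothOn d U (fun y => (F y)⁻¹) :=
  ContMDiffOn.inv₀ hF h0

theorem SmoothOn.sum {ι : Type*} {s : Finset ι} {f : ι → P → ℝ}
    (h : ∀ i ∈ s, SmoothOn d U (f i)) : SmoothOn d U (fun y => ∑ i ∈ s, f i y) :=
  contMDiffOn_finsetSum h

theorem SmoothOn.prod {ι : Type*} {s : Finset ι} {f : ι → P → ℝ}
    (h : ∀ i ∈ s, SmoothOn d U (f i)) : SmoothOn d U (fun y => ∏ i ∈ s, f i y) :=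
  contMDiffOn_finsetProd h

theorem SmoothOn.det {n : Type*} [Fintype n] [DecidableEq n] {A : P → Matrix n n ℝ}
    (h : ∀ i j, SmoothOn d U (fun y => A y i j)) : SmoothOn d U (fun y => (A y).det) := by
  simp only [Matrix.det_apply']
  exact SmoothOn.sum fun σ _ => (smoothOn_const _).mul (SmoothOn.prod fun i _ => h _ _)

/-- Cramer's rule: each entry of the inverse is a determinant of known entries divided by the
determinant of the matrix. -/
theorem SmoothOn.matrix_inv {n : Type*} [Fintype n] [DecidableEq n] {A : P → Matrix n n ℝ}
    (h : ∀ i j, SmoothOn d U (fun y => A y i j)) (h0 : ∀ y ∈ U, (A y).det ≠ 0) (i j : n) :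
    SmoothOn d U (fun y => (A y)⁻¹ i j) := by
  simp only [Matrix.inv_def, Matrix.smul_apply, Ring.inverse_eq_inv', smul_eq_mul,
    Matrix.adjugate_apply]
  refine ((SmoothOn.det h).inv h0).mul (SmoothOn.det fun a b => ?_)
  by_cases ha : a = j
  · subst ha; simp only [Matrix.updateRow_self]; exact smoothOn_const _
  · simp only [Matrix.updateRow_ne ha]; exact h a b

theorem SmoothOn.isOpen_ne_zero (hF : SmoothOn d U F) (hU : IsOpen U) :
    IsOpen {y ∈ U | F y ≠ 0} :=
  hF.continuousOn.isOpen_inter_preimage hU isOpen_ne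

theorem differential_congr (h : F =ᶠ[nhds x] G) : differential d F x = differential d G x :=
  h.mfderiv_eq

theorem differential_congr_on (hU : IsOpen U) (hx : x ∈ U) (h : ∀ y ∈ U, F y = G y) :
    differential d F x = differential d G x :=
  differential_congr (Filter.eventuallyEq_of_mem (hU.mem_nhds hx) h)

theorem differential_const (c : ℝ) (v : TangentSpace (𝓡 d) x) :
    differential d (fun _ : P => c) x v = 0 := by
  unfold differential
  rw [mfderiv_const]; rfl

theorem differential_add (hF : MDifferentiableAt (𝓡 d) 𝓘(ℝ, ℝ) F x)
    (hG : MDifferentiableAt (𝓡 d) 𝓘(ℝ, ℝ) G x) (v : TangentSpace (𝓡 d) x) :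
    differential d (fun y => F y + G y) x v = differential d F x v + differential d G x v := by
  unfold differential
  have := (hF.hasMFDerivAt.add hG.hasMFDerivAt).mfderiv
  change mfderiv (𝓡 d) 𝓘(ℝ, ℝ) (F + G) x v = _
  rw [this]; rfl

theorem differential_sub (hF : MDifferentiableAt (𝓡 d) 𝓘(ℝ, ℝ) F x)
    (hG : MDifferentiableAt (𝓡 d) 𝓘(ℝ, ℝ) G x) (v : TangentSpace (𝓡 d) x) :
    differential d (fun y => F y - G y) x v = differential d F x v - differential d G x v := by
  unfold differential
  have := (hF.hasMFDerivAt.sub hG.hasMFDerivAt).mfderiv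
  change mfderiv (𝓡 d) 𝓘(ℝ, ℝ) (F - G) x v = _
  rw [this]; rfl

theorem differential_mul (hF : MDifferentiableAt (𝓡 d) 𝓘(ℝ, ℝ) F x)
    (hG : MDifferentiableAt (𝓡 d) 𝓘(ℝ, ℝ) G x) (v : TangentSpace (𝓡 d) x) :
    differential d (fun y => F y * G y) x v =
      F x * differential d G x v + G x * differential d F x v := by
  unfold differential
  have := (hF.hasMFDerivAt.mul hG.hasMFDerivAt).mfderiv
  change mfderiv (𝓡 d) 𝓘(ℝ, ℝ) (F * G) x v = _
  rw [this]; rfl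

theorem differential_const_mul (hF : MDifferentiableAt (𝓡 d) 𝓘(ℝ, ℝ) F x) (c : ℝ)
    (v : TangentSpace (𝓡 d) x) :
    differential d (fun y => c * F y) x v = c * differential d F x v := by
  rw [differential_mul mdifferentiableAt_const hF, differential_const, mul_zero, add_zero]

theorem differential_sum {ι : Type} {s : Finset ι} {f : ι → P → ℝ}
    (h : ∀ i ∈ s, MDifferentiableAt (𝓡 d) 𝓘(ℝ, ℝ) (f i) x) (v : TangentSpace (𝓡 d) x) :
    differential d (fun y => ∑ i ∈ s, f i y) x v = ∑ i ∈ s, differential d (f i) x v := by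
  unfold differential
  have := (HasMFDerivAt.sum (fun i hi => (h i hi).hasMFDerivAt)).mfderiv
  have h2 : (fun y => ∑ i ∈ s, f i y) = ∑ i ∈ s, f i := by ext y; simp
  rw [h2, this]
  exact sum_apply _ _ _

end Calculus

/-! ### Smooth vector fields as derivations -/

/-- The vector field `X` maps smooth functions on open subsets of `U` to smooth functions. -/
def IsSmoothField (U : Set P) (X : ∀ x : P, TangentSpace (𝓡 d) x) : Prop :=
  ∀ (U' : Set P) (f : P → ℝ), IsOpen U' → U' ⊆ U → SmoothOn d U' f →
    SmoothOn d U' (fun y => differential d f y (X y))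

namespace IsSmoothField

variable {U : Set P} {X Y : ∀ x : P, TangentSpace (𝓡 d) x}

theorem mono {U' : Set P} (hX : IsSmoothField U X) (h : U' ⊆ U) : IsSmoothField U' X :=
  fun W f hW hWU hf => hX W f hW (hWU.trans h) hf

theorem of_isOpen (hU : IsOpen U) (hX : IsSmoothField U X) {f : P → ℝ} (hf : SmoothOn d U f) :
    SmoothOn d U (fun y => differential d f y (X y)) :=
  hX U f hU subset_rfl hf

theorem congr (hX : IsSmoothField U X) (h : ∀ y ∈ U, Y y = X y) : IsSmoothField U Y :=
  fun W f hW hWU hf => (hX W f hW hWU hf).congr fun y hy => by rw [h y (hWU hy)]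

theorem sub (hX : IsSmoothField U X) (hY : IsSmoothField U Y) :
    IsSmoothField U (fun y => X y - Y y) := fun W f hW hWU hf => by
  simp only [map_sub]
  exact (hX W f hW hWU hf).sub (hY W f hW hWU hf)

theorem smul {g : P → ℝ} (hg : SmoothOn d U g) (hX : IsSmoothField U X) :
    IsSmoothField U (fun y => g y • X y) := fun W f hW hWU hf => by
  simp only [map_smul, smul_eq_mul]
  exact (hg.mono hWU).mul (hX W f hW hWU hf)

theorem zero : IsSmoothField U (fun y => (0 : TangentSpace (𝓡 d) y)) := fun W f hW hWU hf => by
  simp only [map_zero]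
  exact smoothOn_const _

theorem sum {ι : Type*} {s : Finset ι} {X : ι → ∀ x : P, TangentSpace (𝓡 d) x}
    (hX : ∀ i ∈ s, IsSmoothField U (X i)) : IsSmoothField U (fun y => ∑ i ∈ s, X i y) :=
  fun W f hW hWU hf => by
    simp only [map_sum]
    exact SmoothOn.sum fun i hi => hX i hi W f hW hWU hf

theorem of_locally (h : ∀ x ∈ U, ∃ U', IsOpen U' ∧ x ∈ U' ∧ IsSmoothField U' X) :
    IsSmoothField U X := fun W f hW hWU hf => smoothOn_of_locally fun x hx => by
  obtain ⟨U', hU', hxU', hX⟩ := h x (hWU hx)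
  exact ⟨U', hU', hxU', hX _ f (hW.inter hU') inter_subset_right (hf.mono inter_subset_left)⟩

/-- The derivative of `f` along `X` is the fibre component of the tangent map of `f` composed with
the section `X`. -/
theorem of_contMDiffOn [IsManifold (𝓡 d) ∞ P]
    (hX : ContMDiffOn (𝓡 d) (𝓡 d).tangent ∞
      (fun y => (⟨y, X y⟩ : TangentBundle (𝓡 d) P)) U) : IsSmoothField U X := by
  intro W f hW hWU hf
  have : IsManifold (𝓡 d) 1 P := IsManifold.of_le (n := ∞) (by simp)
  have h1 : ContMDiffOn (𝓡 d).tangent 𝓘(ℝ, ℝ).tangent ∞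
      (tangentMapWithin (𝓡 d) 𝓘(ℝ, ℝ) f W) (Bundle.TotalSpace.proj ⁻¹' W) :=
    ContMDiffOn.contMDiffOn_tangentMapWithin hf (by simp) hW.uniqueMDiffOn
  have h2 := h1.comp (hX.mono hWU) (fun y hy => hy)
  have h3 := (contMDiff_snd_tangentBundle_modelSpace (n := ∞) ℝ 𝓘(ℝ, ℝ)).comp_contMDiffOn h2
  refine ContMDiffOn.congr h3 fun y hy => ?_
  simp only [Function.comp, tangentMapWithin]
  rw [mfderivWithin_of_isOpen hW hy]
  rfl

end IsSmoothField

/-- `X` vanishes at `x` and has there the linear part `L`. -/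
def HasLinearPart (X : ∀ x : P, TangentSpace (𝓡 d) x) (x : P)
    (L : TangentSpace (𝓡 d) x →ₗ[ℝ] TangentSpace (𝓡 d) x) : Prop :=
  X x = 0 ∧ ∀ (U : Set P) (f : P → ℝ), IsOpen U → x ∈ U → SmoothOn d U f →
    MDifferentiableAt (𝓡 d) 𝓘(ℝ, ℝ) (fun y => differential d f y (X y)) x ∧
    ∀ v, differential d (fun y => differential d f y (X y)) x v = differential d f x (L v)

namespace HasLinearPart

variable {X Y : ∀ x : P, TangentSpace (𝓡 d) x} {x : P}
  {L M : TangentSpace (𝓡 d) x →ₗ[ℝ] TangentSpace (𝓡 d) x}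

theorem zero : HasLinearPart (fun y => (0 : TangentSpace (𝓡 d) y)) x 0 :=
  ⟨rfl, fun U f _ _ _ => by
    simp only [map_zero]
    exact ⟨mdifferentiableAt_const, fun v => by
      rw [differential_const]; exact (map_zero (differential d f x)).symm⟩⟩

theorem add (hX : HasLinearPart X x L) (hY : HasLinearPart Y x M) :
    HasLinearPart (fun y => X y + Y y) x (L + M) := by
  refine ⟨by simp only [hX.1, hY.1, add_zero], fun U f hU hx hf => ?_⟩
  obtain ⟨h1, h2⟩ := hX.2 U f hU hx hf
  obtain ⟨h3, h4⟩ := hY.2 U f hU hx hf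
  simp only [map_add]
  refine ⟨h1.add h3, fun v => ?_⟩
  rw [differential_add h1 h3, h2, h4]
  exact (map_add (differential d f x) _ _).symm

theorem sub (hX : HasLinearPart X x L) (hY : HasLinearPart Y x M) :
    HasLinearPart (fun y => X y - Y y) x (L - M) := by
  refine ⟨by simp only [hX.1, hY.1, sub_zero], fun U f hU hx hf => ?_⟩
  obtain ⟨h1, h2⟩ := hX.2 U f hU hx hf
  obtain ⟨h3, h4⟩ := hY.2 U f hU hx hf
  simp only [map_sub]
  refine ⟨h1.sub h3, fun v => ?_⟩
  rw [differential_sub h1 h3, h2, h4]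
  exact (map_sub (differential d f x) _ _).symm

theorem smul {U : Set P} (hU : IsOpen U) (hx : x ∈ U) {g : P → ℝ} (hg : SmoothOn d U g)
    (hX : HasLinearPart X x L) : HasLinearPart (fun y => g y • X y) x (g x • L) := by
  refine ⟨by simp only [hX.1, smul_zero], fun U f hU' hx' hf => ?_⟩
  obtain ⟨h1, h2⟩ := hX.2 U f hU' hx' hf
  have hg' := hg.mdifferentiableAt hU hx
  simp only [map_smul, smul_eq_mul]
  refine ⟨hg'.mul h1, fun v => ?_⟩
  rw [differential_mul hg' h1, h2, hX.1, map_zero, zero_mul, add_zero]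
  exact (map_smul (differential d f x) _ _).symm

/-- A smooth field multiplied by a function vanishing at `x`. -/
theorem smul_of_eq_zero {U : Set P} (hU : IsOpen U) (hx : x ∈ U) {g : P → ℝ}
    (hg : MDifferentiableAt (𝓡 d) 𝓘(ℝ, ℝ) g x) (h0 : g x = 0) (hX : IsSmoothField U X) :
    HasLinearPart (fun y => g y • X y) x
      ((differential d g x).toLinearMap.smulRight (X x)) := by
  refine ⟨by simp only [h0, zero_smul], fun U' f hU' hx' hf => ?_⟩
  have h1 := (hX (U ∩ U') f (hU.inter hU') inter_subset_left
    (hf.mono inter_subset_right)).mdifferentiableAt (hU.inter hU') ⟨hx, hx'⟩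
  simp only [map_smul, smul_eq_mul]
  refine ⟨hg.mul h1, fun v => ?_⟩
  rw [differential_mul hg h1, h0, zero_mul, zero_add, mul_comm]
  exact (map_smul (differential d f x) _ _).symm

theorem sum {ι : Type*} {s : Finset ι} {X : ι → ∀ x : P, TangentSpace (𝓡 d) x}
    {L : ι → TangentSpace (𝓡 d) x →ₗ[ℝ] TangentSpace (𝓡 d) x}
    (h : ∀ i ∈ s, HasLinearPart (X i) x (L i)) :
    HasLinearPart (fun y => ∑ i ∈ s, X i y) x (∑ i ∈ s, L i) := by
  classical
  induction s using Finset.induction_on with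
  | empty => simpa using HasLinearPart.zero
  | insert a s ha ih =>
    simp only [Finset.sum_insert ha]
    exact (h a (Finset.mem_insert_self _ _)).add
      (ih fun i hi => h i (Finset.mem_insert_of_mem hi))

end HasLinearPart

/-! ### The bilinear form of a symplectic form -/

namespace SymplecticForm

variable (Ω : SymplecticForm d P)

theorem form_add_right (x : P) (v a b : TangentSpace (𝓡 d) x) :
    Ω.form x ![v, a + b] = Ω.form x ![v, a] + Ω.form x ![v, b] := by
  have hup : ∀ a : TangentSpace (𝓡 d) x, Function.update ![v, 0] (1 : Fin 2) a = ![v, a] := by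
    intro a
    funext i
    fin_cases i <;> simp
  have h := (Ω.form x).toMultilinearMap.map_update_add ![v, 0] 1 a b
  rw [hup, hup, hup] at h
  exact h

theorem form_smul_right (x : P) (v : TangentSpace (𝓡 d) x) (c : ℝ) (a : TangentSpace (𝓡 d) x) :
    Ω.form x ![v, c • a] = c * Ω.form x ![v, a] := by
  have hup : ∀ a : TangentSpace (𝓡 d) x, Function.update ![v, 0] (1 : Fin 2) a = ![v, a] := by
    intro a
    funext i
    fin_cases i <;> simp
  have h := (Ω.form x).toMultilinearMap.map_update_smul ![v, 0] 1 c a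
  rw [hup, hup] at h
  exact h

theorem form_add_left (x : P) (a b v : TangentSpace (𝓡 d) x) :
    Ω.form x ![a + b, v] = Ω.form x ![a, v] + Ω.form x ![b, v] :=
  (Ω.form x).toMultilinearMap.cons_add ![v] a b

theorem form_smul_left (x : P) (c : ℝ) (a v : TangentSpace (𝓡 d) x) :
    Ω.form x ![c • a, v] = c * Ω.form x ![a, v] :=
  (Ω.form x).toMultilinearMap.cons_smul ![v] c a

/-- The symplectic form at `x` as a bilinear form. -/
def bil (x : P) : LinearMap.BilinForm ℝ (TangentSpace (𝓡 d) x) :=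
  LinearMap.mk₂ ℝ (fun v w => Ω.form x ![v, w]) (Ω.form_add_left x) (Ω.form_smul_left x)
    (Ω.form_add_right x) (fun c v a => Ω.form_smul_right x v c a)

theorem bil_apply (x : P) (v w : TangentSpace (𝓡 d) x) : Ω.bil x v w = Ω.form x ![v, w] := rfl

theorem bil_isAlt (x : P) : (Ω.bil x).IsAlt := fun v =>
  (Ω.form x).map_eq_zero_of_eq ![v, v] (i := 0) (j := 1) rfl (by decide)

theorem bil_swap (x : P) (v w : TangentSpace (𝓡 d) x) : Ω.bil x v w = - Ω.bil x w v :=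
  by
  rw [← LinearMap.IsAlt.neg (Ω.bil_isAlt x)]

theorem eq_zero_of_bil (x : P) (v : TangentSpace (𝓡 d) x) (h : ∀ w, Ω.bil x v w = 0) : v = 0 :=
  Ω.nondegenerate x v h

theorem bil_nondegenerate (x : P) : (Ω.bil x).Nondegenerate :=
  ⟨fun v h => Ω.eq_zero_of_bil x v h, fun v h => Ω.eq_zero_of_bil x v fun w => by
    rw [bil_swap, h w, neg_zero]⟩

theorem bil_hamVec (F : P → ℝ) (x : P) (w : TangentSpace (𝓡 d) x) :
    Ω.bil x (Ω.hamVec F x) w = differential d F x w :=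
  Ω.hamVec_spec F x w

/-- Frees later arguments from the choice made in `hamVec`: any vector with the defining property is
the chosen one. -/
theorem hamVec_unique {F : P → ℝ} {x : P} {v : TangentSpace (𝓡 d) x}
    (h : ∀ w, Ω.bil x v w = differential d F x w) : v = Ω.hamVec F x := by
  rw [← sub_eq_zero]
  refine Ω.eq_zero_of_bil x _ fun w => ?_
  rw [map_sub, LinearMap.sub_apply, h, bil_hamVec, sub_self]

theorem bracket_eq (F G : P → ℝ) (x : P) :
    Ω.bracket F G x = differential d F x (Ω.hamVec G x) :=
  Ω.hamVec_spec F x _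

theorem mem_orth {x : P} {A : Submodule ℝ (TangentSpace (𝓡 d) x)} {v : TangentSpace (𝓡 d) x} :
    v ∈ Ω.orth A ↔ ∀ w ∈ A, Ω.bil x v w = 0 := Iff.rfl

theorem orth_eq {x : P} (A : Submodule ℝ (TangentSpace (𝓡 d) x)) :
    Ω.orth A = (Ω.bil x).orthogonal A := by
  ext v
  rw [mem_orth, LinearMap.BilinForm.mem_orthogonal_iff]
  refine forall₂_congr fun w _ => ?_
  rw [bil_swap, neg_eq_zero]

theorem orth_orth {x : P} (A : Submodule ℝ (TangentSpace (𝓡 d) x)) : Ω.orth (Ω.orth A) = A := by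
  rw [orth_eq, orth_eq, LinearMap.BilinForm.orthogonal_orthogonal (Ω.bil_nondegenerate x)
    (Ω.bil_isAlt x).isRefl]

theorem finrank_orth {x : P} (A : Submodule ℝ (TangentSpace (𝓡 d) x)) :
    Module.finrank ℝ A + Module.finrank ℝ (Ω.orth A) = d := by
  have h := LinearMap.BilinForm.finrank_orthogonal (Ω.bil_nondegenerate x) A
  have h2 := A.finrank_le
  rw [finrank_tangentSpace] at h h2
  rw [orth_eq]
  omega

theorem mem_orth_span {ι : Type*} {x : P} {f : ι → TangentSpace (𝓡 d) x}
    {v : TangentSpace (𝓡 d) x} :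
    v ∈ Ω.orth (Submodule.span ℝ (range f)) ↔ ∀ i, Ω.bil x v (f i) = 0 := by
  rw [mem_orth]
  refine ⟨fun h i => h _ (Submodule.subset_span ⟨i, rfl⟩), fun h w hw => ?_⟩
  have : Submodule.span ℝ (range f) ≤ LinearMap.ker (Ω.bil x v) := by
    rw [Submodule.span_le]
    rintro _ ⟨i, rfl⟩
    exact h i
  exact this hw

end SymplecticForm

end

section

variable {d : ℕ} {P : Type*} [TopologicalSpace P] [ChartedSpace (EuclideanSpace ℝ (Fin d)) P]

/-! ### Charts of the smooth structure -/

/-- The derivative of a chart. -/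
def chartDeriv (e : OpenPartialHomeomorph P (EuclideanSpace ℝ (Fin d))) (x : P) :
    TangentSpace (𝓡 d) x →L[ℝ] EuclideanSpace ℝ (Fin d) :=
  mfderiv (𝓡 d) (𝓡 d) e x

section Chart

variable {e : OpenPartialHomeomorph P (EuclideanSpace ℝ (Fin d))} {x : P} {U : Set P} {F : P → ℝ}

variable [IsManifold (𝓡 d) ∞ P]

theorem mdifferentiableAt_chart (he : e ∈ IsManifold.maximalAtlas (𝓡 d) ∞ P) (hx : x ∈ e.source) :
    MDifferentiableAt (𝓡 d) (𝓡 d) e x :=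
  (contMDiffAt_of_mem_maximalAtlas he hx).mdifferentiableAt (by simp)

theorem mdifferentiableAt_chart_symm (he : e ∈ IsManifold.maximalAtlas (𝓡 d) ∞ P)
    {z : EuclideanSpace ℝ (Fin d)} (hz : z ∈ e.target) :
    MDifferentiableAt (𝓡 d) (𝓡 d) e.symm z :=
  (contMDiffAt_symm_of_mem_maximalAtlas he hz).mdifferentiableAt (by simp)

theorem chartDeriv_symm (he : e ∈ IsManifold.maximalAtlas (𝓡 d) ∞ P)
    {z : EuclideanSpace ℝ (Fin d)} (hz : z ∈ e.target) (v : EuclideanSpace ℝ (Fin d)) :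
    chartDeriv e (e.symm z) (mfderiv (𝓡 d) (𝓡 d) e.symm z v) = v := by
  have h1 := (mdifferentiableAt_chart he (e.map_target hz)).hasMFDerivAt.comp z
    (mdifferentiableAt_chart_symm he hz).hasMFDerivAt
  have h2 : (e ∘ e.symm) =ᶠ[nhds z] id :=
    Filter.eventuallyEq_of_mem (e.open_target.mem_nhds hz) fun y hy => e.right_inv hy
  have h3 := h1.mfderiv
  rw [h2.mfderiv_eq, mfderiv_id] at h3
  exact (congrArg (fun L : EuclideanSpace ℝ (Fin d) →L[ℝ] EuclideanSpace ℝ (Fin d) => L v) h3).symm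

/-- The derivative of the inverse chart is a right inverse, and source and target have equal
dimension. -/
theorem chartDeriv_injective (he : e ∈ IsManifold.maximalAtlas (𝓡 d) ∞ P) (hx : x ∈ e.source) :
    Function.Injective (chartDeriv e x) := by
  have hsurj : Function.Surjective (chartDeriv e x) := fun v => by
    have := chartDeriv_symm he (e.map_source hx) v
    rw [e.left_inv hx] at this
    exact ⟨_, this⟩
  exact (LinearMap.injective_iff_surjective_of_finrank_eq_finrank
    (f := (chartDeriv e x).toLinearMap)
    (by rw [finrank_tangentSpace, finrank_euclideanSpace_fin])).2 hsurj

/-- The derivative of a chart, as a linear equivalence. -/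
def chartEquiv (he : e ∈ IsManifold.maximalAtlas (𝓡 d) ∞ P) (hx : x ∈ e.source) :
    TangentSpace (𝓡 d) x ≃ₗ[ℝ] EuclideanSpace ℝ (Fin d) :=
  LinearEquiv.ofInjectiveOfFinrankEq (chartDeriv e x).toLinearMap (chartDeriv_injective he hx)
    (by rw [finrank_tangentSpace, finrank_euclideanSpace_fin])

theorem chartEquiv_apply (he : e ∈ IsManifold.maximalAtlas (𝓡 d) ∞ P) (hx : x ∈ e.source)
    (v : TangentSpace (𝓡 d) x) : chartEquiv he hx v = chartDeriv e x v := rfl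

theorem smoothOn_comp_chart (he : e ∈ IsManifold.maximalAtlas (𝓡 d) ∞ P)
    {V : Set (EuclideanSpace ℝ (Fin d))} {f : EuclideanSpace ℝ (Fin d) → ℝ}
    (hf : ContDiffOn ℝ ∞ f V) : SmoothOn d (e.source ∩ e ⁻¹' V) (fun y => f (e y)) :=
  (contMDiffOn_iff_contDiffOn.2 hf).comp
    ((contMDiffOn_of_mem_maximalAtlas he).mono inter_subset_left) fun _ hy => hy.2

theorem differential_comp_chart (he : e ∈ IsManifold.maximalAtlas (𝓡 d) ∞ P) (hx : x ∈ e.source)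
    {f : EuclideanSpace ℝ (Fin d) → ℝ} (hf : DifferentiableAt ℝ f (e x))
    (v : TangentSpace (𝓡 d) x) :
    differential d (fun y => f (e y)) x v = fderiv ℝ f (e x) (chartDeriv e x v) := by
  have h := ((hf.hasFDerivAt.hasMFDerivAt).comp x
    (mdifferentiableAt_chart he hx).hasMFDerivAt).mfderiv
  unfold differential
  change mfderiv (𝓡 d) 𝓘(ℝ, ℝ) (f ∘ e) x v = _
  rw [h]; rfl

theorem contDiffOn_comp_symm (he : e ∈ IsManifold.maximalAtlas (𝓡 d) ∞ P) (hF : SmoothOn d U F) :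
    ContDiffOn ℝ ∞ (fun z => F (e.symm z)) (e.target ∩ e.symm ⁻¹' U) :=
  contMDiffOn_iff_contDiffOn.1 <| ContMDiffOn.comp hF
    ((contMDiffOn_symm_of_mem_maximalAtlas he).mono inter_subset_left) fun _ hz => hz.2

theorem contDiffAt_comp_symm (he : e ∈ IsManifold.maximalAtlas (𝓡 d) ∞ P) (hU : IsOpen U)
    (hF : SmoothOn d U F) {z : EuclideanSpace ℝ (Fin d)} (hz : z ∈ e.target)
    (hzU : e.symm z ∈ U) : ContDiffAt ℝ ∞ (fun z => F (e.symm z)) z :=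
  (contDiffOn_comp_symm he hF).contDiffAt
    ((e.symm.isOpen_inter_preimage hU).mem_nhds ⟨hz, hzU⟩)

theorem differential_eq_fderiv (he : e ∈ IsManifold.maximalAtlas (𝓡 d) ∞ P) (hU : IsOpen U)
    (hF : SmoothOn d U F) (hx : x ∈ e.source) (hxU : x ∈ U) (v : TangentSpace (𝓡 d) x) :
    differential d F x v = fderiv ℝ (fun z => F (e.symm z)) (e x) (chartDeriv e x v) := by
  rw [← differential_comp_chart he hx]
  · refine congrArg (fun L : TangentSpace (𝓡 d) x →L[ℝ] ℝ => L v)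
      (differential_congr_on e.open_source hx fun y hy => ?_)
    rw [e.left_inv hy]
  · exact (contDiffAt_comp_symm he hU hF (e.map_source hx)
      (by rwa [e.left_inv hx])).differentiableAt (by simp)

/-- Linear functions of a chart. -/
theorem smoothOn_chart (he : e ∈ IsManifold.maximalAtlas (𝓡 d) ∞ P)
    (φ : EuclideanSpace ℝ (Fin d) →L[ℝ] ℝ) : SmoothOn d e.source (fun y => φ (e y)) :=
  (smoothOn_comp_chart he (V := univ) φ.contDiff.contDiffOn).mono (by simp)

theorem differential_chart (he : e ∈ IsManifold.maximalAtlas (𝓡 d) ∞ P) (hx : x ∈ e.source)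
    (φ : EuclideanSpace ℝ (Fin d) →L[ℝ] ℝ) (v : TangentSpace (𝓡 d) x) :
    differential d (fun y => φ (e y)) x v = φ (chartDeriv e x v) := by
  rw [differential_comp_chart he hx φ.differentiableAt, φ.fderiv]

/-- A smooth vector field has smooth coordinates in every chart. -/
theorem IsSmoothField.contDiffAt_chart (he : e ∈ IsManifold.maximalAtlas (𝓡 d) ∞ P)
    (hU : IsOpen U) {X : ∀ x : P, TangentSpace (𝓡 d) x} (hX : IsSmoothField U X)
    {z : EuclideanSpace ℝ (Fin d)} (hz : z ∈ e.target) (hzU : e.symm z ∈ U) :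
    ContDiffAt ℝ ∞ (fun z => chartDeriv e (e.symm z) (X (e.symm z))) z := by
  rw [contDiffAt_piLp]
  intro i
  let φ : EuclideanSpace ℝ (Fin d) →L[ℝ] ℝ := EuclideanSpace.proj i
  have h1 := hX (U ∩ e.source) (fun y => φ (e y)) (hU.inter e.open_source) inter_subset_left
    ((smoothOn_chart he φ).mono inter_subset_right)
  refine (contDiffAt_comp_symm he (hU.inter e.open_source) h1 hz
    ⟨hzU, e.map_target hz⟩).congr_of_eventuallyEq
    (Filter.eventuallyEq_of_mem (e.open_target.mem_nhds hz) fun y hy => ?_)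
  exact (differential_chart he (e.map_target hy) φ _).symm

end Chart

/-! ### Smoothness of Hamiltonian vector fields -/

/-- The map sending a vector `v` to the covector `η (v, ·)`. -/
def flat (E : Type*) [NormedAddCommGroup E] [NormedSpace ℝ E] :
    (E [⋀^Fin 2]→L[ℝ] ℝ) →L[ℝ] E →L[ℝ] E →L[ℝ] ℝ :=
  (ContinuousLinearMap.compL ℝ E (E [⋀^Fin 1]→L[ℝ] ℝ) (E →L[ℝ] ℝ)
    ((ContinuousAlternatingMap.ofSubsingletonLIE (𝕜 := ℝ) (E := E) (F := ℝ)
      (0 : Fin 1)).symm.toContinuousLinearEquiv : (E [⋀^Fin 1]→L[ℝ] ℝ) →L[ℝ] (E →L[ℝ] ℝ))).comp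
    (ContinuousAlternatingMap.curryLeftLI (𝕜 := ℝ) (E := E) (F := ℝ) (n := 1)).toContinuousLinearMap

theorem flat_apply {E : Type*} [NormedAddCommGroup E] [NormedSpace ℝ E]
    (η : E [⋀^Fin 2]→L[ℝ] ℝ) (v w : E) : flat E η v w = η ![v, w] := by
  change η (Matrix.vecCons v (fun _ => w)) = _
  congr 1
  funext i
  fin_cases i <;> rfl

theorem contDiff_flat {E : Type*} [NormedAddCommGroup E] [NormedSpace ℝ E] :
    ContDiff ℝ ∞ (flat E) :=
  ContinuousLinearMap.contDiff (𝕜 := ℝ) (E := E [⋀^Fin 2]→L[ℝ] ℝ) (F := E →L[ℝ] E →L[ℝ] ℝ) (flat E)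

namespace SymplecticForm

variable [IsManifold (𝓡 d) ∞ P] (Ω : SymplecticForm d P)

theorem chart_mem (x₀ : P) : chartAt (EuclideanSpace ℝ (Fin d)) x₀ ∈
    IsManifold.maximalAtlas (𝓡 d) ∞ P := IsManifold.chart_mem_maximalAtlas x₀

theorem chartForm_apply (x₀ : P) (z v w : EuclideanSpace ℝ (Fin d)) :
    chartForm Ω.form x₀ z ![v, w] = Ω.bil ((chartAt (EuclideanSpace ℝ (Fin d)) x₀).symm z)
      (mfderiv (𝓡 d) (𝓡 d) (chartAt (EuclideanSpace ℝ (Fin d)) x₀).symm z v)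
      (mfderiv (𝓡 d) (𝓡 d) (chartAt (EuclideanSpace ℝ (Fin d)) x₀).symm z w) := by
  rw [bil_apply]
  change Ω.form _ _ = Ω.form _ _
  congr 1
  funext i
  fin_cases i <;> rfl

theorem chartForm_chartDeriv (x₀ : P) {x : P}
    (hx : x ∈ (chartAt (EuclideanSpace ℝ (Fin d)) x₀).source) (v w : TangentSpace (𝓡 d) x) :
    chartForm Ω.form x₀ (chartAt (EuclideanSpace ℝ (Fin d)) x₀ x)
      ![chartDeriv (chartAt (EuclideanSpace ℝ (Fin d)) x₀) x v,
        chartDeriv (chartAt (EuclideanSpace ℝ (Fin d)) x₀) x w] = Ω.bil x v w := by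
  set e := chartAt (EuclideanSpace ℝ (Fin d)) x₀ with he
  have hz := e.map_source hx
  obtain ⟨z, hz', rfl⟩ : ∃ z ∈ e.target, x = e.symm z := ⟨e x, hz, (e.left_inv hx).symm⟩
  have key : ∀ v : TangentSpace (𝓡 d) (e.symm z),
      mfderiv (𝓡 d) (𝓡 d) e.symm z (chartDeriv e (e.symm z) v) = v := fun v =>
    chartDeriv_injective (chart_mem x₀) hx (chartDeriv_symm (chart_mem x₀) hz' _)
  rw [e.right_inv hz', chartForm_apply, key, key]

theorem chartForm_smoothAt (x₀ : P) {z : EuclideanSpace ℝ (Fin d)}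
    (hz : z ∈ (chartAt (EuclideanSpace ℝ (Fin d)) x₀).target) :
    ContDiffAt ℝ ∞ (chartForm Ω.form x₀) z := by
  have h := Ω.smooth x₀
  have ht : (extChartAt (𝓡 d) x₀).target = (chartAt (EuclideanSpace ℝ (Fin d)) x₀).target := by
    simp [mfld_simps]
  rw [ht] at h
  exact h.contDiffAt ((chartAt (EuclideanSpace ℝ (Fin d)) x₀).open_target.mem_nhds hz)

/-- In a chart the Hamiltonian vector is the inverse of v ↦ Ω(v, ·) applied to dG. The form depends
smoothly on the point, and inversion is smooth at invertible operators. -/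
theorem isSmoothField_hamVec {U : Set P} {G : P → ℝ} (hU : IsOpen U) (hG : SmoothOn d U G) :
    IsSmoothField U (Ω.hamVec G) := by
  intro W f hW hWU hf
  refine smoothOn_of_locally fun x₀ hx₀ => ?_
  set e := chartAt (EuclideanSpace ℝ (Fin d)) x₀ with he
  have hem : e ∈ IsManifold.maximalAtlas (𝓡 d) ∞ P := chart_mem x₀
  refine ⟨e.source, e.open_source, mem_chart_source _ x₀, ?_⟩
  let A : EuclideanSpace ℝ (Fin d) → _ := fun z => flat _ (chartForm Ω.form x₀ z)
  let h : EuclideanSpace ℝ (Fin d) → EuclideanSpace ℝ (Fin d) := fun z =>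
    (A z).inverse (fderiv ℝ (fun z => G (e.symm z)) z)
  let T := e.target ∩ e.symm ⁻¹' W
  have hT : IsOpen T := e.symm.isOpen_inter_preimage hW
  have hinv : ∀ z ∈ e.target, ∃ L : EuclideanSpace ℝ (Fin d) ≃L[ℝ]
      (EuclideanSpace ℝ (Fin d) →L[ℝ] ℝ), (L : _ →L[ℝ] _) = A z := by
    intro z hz
    have hinj : Function.Injective (A z).toLinearMap := by
      rw [← LinearMap.ker_eq_bot, LinearMap.ker_eq_bot']
      intro v hv
      have hx := e.map_target hz
      obtain ⟨u, hu⟩ : ∃ u, chartDeriv e (e.symm z) u = v := ⟨_, chartDeriv_symm hem hz v⟩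
      have : u = 0 := by
        refine Ω.eq_zero_of_bil _ u fun w => ?_
        rw [← Ω.chartForm_chartDeriv x₀ hx, ← he, hu, e.right_inv hz, ← flat_apply]
        exact congrArg (fun L : EuclideanSpace ℝ (Fin d) →L[ℝ] ℝ => L _) hv
      rw [← hu, this, map_zero]
    have hfr : Module.finrank ℝ (EuclideanSpace ℝ (Fin d)) =
        Module.finrank ℝ (EuclideanSpace ℝ (Fin d) →L[ℝ] ℝ) := by
      rw [← (LinearMap.toContinuousLinearMap (𝕜 := ℝ) (E := EuclideanSpace ℝ (Fin d))
        (F' := ℝ)).finrank_eq]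
      exact (Subspace.dual_finrank_eq (K := ℝ)).symm
    exact ⟨(LinearEquiv.ofInjectiveOfFinrankEq _ hinj hfr).toContinuousLinearEquiv, by
      ext v : 1; rfl⟩
  have hh : ContDiffOn ℝ ∞ h T := by
    intro z hz
    obtain ⟨L, hL⟩ := hinv z hz.1
    have h1 : ContDiffAt ℝ ∞ A z :=
      contDiff_flat.contDiffAt.comp z (Ω.chartForm_smoothAt x₀ hz.1)
    have h2 : ContDiffAt ℝ ∞ (fun z => (A z).inverse) z :=
      ContDiffAt.comp (g := ContinuousLinearMap.inverse) z
        (by rw [← hL]; exact contDiffAt_map_inverse L) h1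
    have h3 : ContDiffAt ℝ ∞ (fderiv ℝ (fun z => G (e.symm z))) z :=
      (contDiffAt_comp_symm hem hU hG hz.1 (hWU hz.2)).fderiv_right (by simp)
    exact (h2.clm_apply h3).contDiffWithinAt
  have hf' : ContDiffOn ℝ ∞ (fun z => fderiv ℝ (fun z => f (e.symm z)) z (h z)) T := by
    refine ContDiffOn.clm_apply (fun z hz => ?_) hh
    exact ((contDiffAt_comp_symm hem hW hf hz.1 hz.2).fderiv_right (m := ∞)
      (by simp)).contDiffWithinAt
  refine ((smoothOn_comp_chart hem hf').mono ?_).congr ?_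
  · rintro y ⟨hy1, hy2⟩
    exact ⟨hy2, e.map_source hy2, by simpa [e.left_inv hy2] using hy1⟩
  · rintro y ⟨hyW, hy⟩
    rw [differential_eq_fderiv hem hW hf hy hyW]
    congr 1
    obtain ⟨L, hL⟩ := hinv (e y) (e.map_source hy)
    simp only [h]
    rw [← hL, ContinuousLinearMap.inverse_equiv]
    rw [ContinuousLinearEquiv.coe_coe, ContinuousLinearEquiv.eq_symm_apply]
    ext w
    obtain ⟨u, hu⟩ : ∃ u, chartDeriv e y u = w := (chartEquiv hem hy).surjective w
    have : L (chartDeriv e y (Ω.hamVec G y)) w = A (e y) (chartDeriv e y (Ω.hamVec G y)) w := by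
      rw [← hL]; rfl
    rw [this, ← hu, ← differential_eq_fderiv hem hU hG hy (hWU hyW)]
    simp only [A]
    rw [flat_apply, Ω.chartForm_chartDeriv x₀ hy, bil_hamVec]

theorem smoothOn_bracket {U : Set P} {F G : P → ℝ} (hU : IsOpen U) (hF : SmoothOn d U F)
    (hG : SmoothOn d U G) : SmoothOn d U (Ω.bracket F G) :=
  ((Ω.isSmoothField_hamVec hU hG).of_isOpen hU hF).congr fun y _ => Ω.bracket_eq F G y

end SymplecticForm

end

section

variable {d : ℕ} {P : Type*} [TopologicalSpace P] [ChartedSpace (EuclideanSpace ℝ (Fin d)) P]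

namespace SymplecticForm

variable (Ω : SymplecticForm d P)

/-! ### Linear algebra of second class constraints -/

section Linear

variable {m : ℕ} (χ : Fin m → P → ℝ) (x : P)

/-- The common kernel of the differentials of the constraints. -/
def constraintKer {m : ℕ} (χ : Fin m → P → ℝ) (x : P) : Submodule ℝ (TangentSpace (𝓡 d) x) :=
  ⨅ i, LinearMap.ker (differential d (χ i) x).toLinearMap

variable {χ x} in
theorem mem_constraintKer {v : TangentSpace (𝓡 d) x} :
    v ∈ constraintKer χ x ↔ ∀ i, differential d (χ i) x v = 0 := by
  simp [constraintKer]

theorem constraintMatrix_apply (i j : Fin m) :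
    Ω.constraintMatrix χ x i j = differential d (χ i) x (Ω.hamVec (χ j) x) :=
  Ω.bracket_eq _ _ _

/-- The projection onto the span of the Hamiltonian vectors of the constraints, along the common
kernel of their differentials. -/
def constraintProj : TangentSpace (𝓡 d) x →ₗ[ℝ] TangentSpace (𝓡 d) x :=
  ∑ i, ∑ j, (Ω.constraintMatrix χ x)⁻¹ i j •
    (differential d (χ j) x).toLinearMap.smulRight (Ω.hamVec (χ i) x)

theorem constraintProj_apply (v : TangentSpace (𝓡 d) x) :
    Ω.constraintProj χ x v = ∑ i, ∑ j,
      ((Ω.constraintMatrix χ x)⁻¹ i j * differential d (χ j) x v) • Ω.hamVec (χ i) x := by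
  simp [constraintProj, smul_smul]

theorem constraintProj_of_mem_ker {v : TangentSpace (𝓡 d) x} (hv : v ∈ constraintKer χ x) :
    Ω.constraintProj χ x v = 0 := by
  simp [constraintProj_apply, mem_constraintKer.1 hv]

theorem constraintKer_eq_orth :
    constraintKer χ x = Ω.orth (Submodule.span ℝ (range fun i => Ω.hamVec (χ i) x)) := by
  ext v
  rw [mem_orth_span, mem_constraintKer]
  refine forall_congr' fun i => ?_
  rw [bil_swap, bil_hamVec, neg_eq_zero]

/-- The Hamiltonian vector of `F` for the Dirac bracket. -/
def diracVec (F : P → ℝ) : TangentSpace (𝓡 d) x :=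
  Ω.hamVec F x - Ω.constraintProj χ x (Ω.hamVec F x)

/-- Bracketing with `F` is differentiation along a vector. Locality, linearity and the Leibniz rule
of the Dirac bracket thereby reduce to those of differentials. -/
theorem differential_diracVec (F G : P → ℝ) :
    differential d G x (Ω.diracVec χ x F) = Ω.diracBracket χ G F x := by
  rw [diracVec, map_sub, constraintProj_apply, diracBracket, bracket_eq]
  congr 1
  simp only [map_sum, map_smul, smul_eq_mul]
  refine Finset.sum_congr rfl fun i _ => Finset.sum_congr rfl fun j _ => ?_
  rw [bracket_eq, bracket_eq]
  ring

variable {χ x}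

theorem differential_constraintProj (h : (Ω.constraintMatrix χ x).det ≠ 0) (k : Fin m)
    (v : TangentSpace (𝓡 d) x) :
    differential d (χ k) x (Ω.constraintProj χ x v) = differential d (χ k) x v := by
  have h1 : ∀ j, ∑ i, Ω.constraintMatrix χ x k i * (Ω.constraintMatrix χ x)⁻¹ i j =
      (1 : Matrix (Fin m) (Fin m) ℝ) k j := fun j => by
    rw [← Matrix.mul_nonsing_inv _ (isUnit_iff_ne_zero.2 h), Matrix.mul_apply]
  rw [constraintProj_apply]
  simp only [map_sum, map_smul, smul_eq_mul, ← constraintMatrix_apply]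
  rw [Finset.sum_comm]
  have : ∀ j, ∑ i, (Ω.constraintMatrix χ x)⁻¹ i j * differential d (χ j) x v *
      Ω.constraintMatrix χ x k i =
      (1 : Matrix (Fin m) (Fin m) ℝ) k j * differential d (χ j) x v := by
    intro j
    rw [← h1, Finset.sum_mul]
    exact Finset.sum_congr rfl fun i _ => by ring
  simp [this, Matrix.one_apply]

theorem sub_constraintProj_mem (h : (Ω.constraintMatrix χ x).det ≠ 0) (v : TangentSpace (𝓡 d) x) :
    v - Ω.constraintProj χ x v ∈ constraintKer χ x := by
  rw [mem_constraintKer]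
  intro k
  rw [map_sub, Ω.differential_constraintProj h, sub_self]

theorem linearIndependent_hamVec (h : (Ω.constraintMatrix χ x).det ≠ 0) :
    LinearIndependent ℝ (fun i => Ω.hamVec (χ i) x) := by
  rw [Fintype.linearIndependent_iff]
  intro g hg
  have : (Ω.constraintMatrix χ x).mulVec g = 0 := by
    funext k
    have := congrArg (differential d (χ k) x) hg
    simp only [map_sum, map_smul, smul_eq_mul, map_zero, ← constraintMatrix_apply] at this
    rw [Matrix.mulVec, dotProduct, Pi.zero_apply, ← this]
    exact Finset.sum_congr rfl fun i _ => mul_comm _ _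
  have h0 := Matrix.eq_zero_of_mulVec_eq_zero h this
  exact fun i => congrFun h0 i

theorem finrank_constraintKer (h : (Ω.constraintMatrix χ x).det ≠ 0) :
    m + Module.finrank ℝ (constraintKer (d := d) χ x) = d := by
  have h1 := finrank_span_eq_card (Ω.linearIndependent_hamVec h)
  have h2 := Ω.finrank_orth (Submodule.span ℝ (range fun i => Ω.hamVec (χ i) x))
  rw [h1, ← constraintKer_eq_orth, Fintype.card_fin] at h2
  exact h2

/-- A vector of the radical is orthogonal to every v - Qv, which lies in the common kernel, and to
every Qv, a combination of the X_{χ_i}, because the dχ_i annihilate it. Hence it is orthogonal to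
everything. -/
theorem ker_constraintKer (h : (Ω.constraintMatrix χ x).det ≠ 0) :
    Ω.ker (constraintKer χ x) = ⊥ := by
  rw [eq_bot_iff]
  rintro z ⟨hz, hz'⟩
  refine (Submodule.mem_bot ℝ).2 (Ω.eq_zero_of_bil x z fun v => ?_)
  have h1 := hz' _ (Ω.sub_constraintProj_mem h v)
  rw [← bil_apply, map_sub, sub_eq_zero] at h1
  rw [h1, constraintProj_apply]
  simp only [map_sum, map_smul, smul_eq_mul]
  refine Finset.sum_eq_zero fun i _ => Finset.sum_eq_zero fun j _ => ?_
  rw [bil_swap, bil_hamVec, mem_constraintKer.1 hz, neg_zero, mul_zero]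

theorem diracVec_mem (h : (Ω.constraintMatrix χ x).det ≠ 0) (F : P → ℝ) :
    Ω.diracVec χ x F ∈ constraintKer χ x :=
  Ω.sub_constraintProj_mem h _

/-- The correction Q X_F is a combination of the X_{χ_i}, and Ω(X_{χ_i}, w) = dχ_i(w) = 0. -/
theorem bil_diracVec (F : P → ℝ) {w : TangentSpace (𝓡 d) x} (hw : w ∈ constraintKer χ x) :
    Ω.bil x (Ω.diracVec χ x F) w = differential d F x w := by
  rw [diracVec, map_sub, LinearMap.sub_apply, bil_hamVec, constraintProj_apply]
  simp only [map_sum, map_smul, smul_eq_mul, LinearMap.sum_apply, LinearMap.smul_apply,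
    bil_hamVec, mem_constraintKer.1 hw]
  simp

theorem eq_diracVec (h : (Ω.constraintMatrix χ x).det ≠ 0) {F : P → ℝ}
    {u : TangentSpace (𝓡 d) x} (hu : u ∈ constraintKer χ x)
    (hF : ∀ w ∈ constraintKer χ x, Ω.bil x u w = differential d F x w) :
    u = Ω.diracVec χ x F := by
  rw [← sub_eq_zero, ← Submodule.mem_bot ℝ, ← Ω.ker_constraintKer h]
  refine ⟨sub_mem hu (Ω.diracVec_mem h F), fun w hw => ?_⟩
  rw [← bil_apply, map_sub, LinearMap.sub_apply, hF w hw, Ω.bil_diracVec F hw, sub_self]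

/-- Expresses the Dirac bracket through Ω on vectors of the common kernel. Both the Jacobi identity
and the description of the leafwise form start from here. -/
theorem bil_diracVec_diracVec (h : (Ω.constraintMatrix χ x).det ≠ 0) (F G : P → ℝ) :
    Ω.bil x (Ω.diracVec χ x F) (Ω.diracVec χ x G) = Ω.diracBracket χ F G x := by
  rw [Ω.bil_diracVec F (Ω.diracVec_mem h G), differential_diracVec]

theorem diracBracket_constraint (h : (Ω.constraintMatrix χ x).det ≠ 0) (F : P → ℝ)
    (i : Fin m) : Ω.diracBracket χ (χ i) F x = 0 := by
  rw [← differential_diracVec]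
  exact mem_constraintKer.1 (Ω.diracVec_mem h F) i

theorem diracBracket_antisymm (h : (Ω.constraintMatrix χ x).det ≠ 0) (F G : P → ℝ) :
    Ω.diracBracket χ F G x = - Ω.diracBracket χ G F x := by
  rw [← Ω.bil_diracVec_diracVec h, bil_swap, Ω.bil_diracVec_diracVec h]

end Linear

/-! ### The Dirac bracket -/

variable [IsManifold (𝓡 d) ∞ P] {Ω} {m : ℕ} {χ : Fin m → P → ℝ} {U : Set P}

theorem isSmoothField_constraintProj (hU : IsOpen U) (hχ : ∀ i, SmoothOn d U (χ i))
    (h : ∀ y ∈ U, (Ω.constraintMatrix χ y).det ≠ 0) {X : ∀ x : P, TangentSpace (𝓡 d) x}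
    (hX : IsSmoothField U X) : IsSmoothField U (fun y => Ω.constraintProj χ y (X y)) := by
  have hC : ∀ i j, SmoothOn d U (fun y => (Ω.constraintMatrix χ y)⁻¹ i j) := fun i j =>
    SmoothOn.matrix_inv (fun i j => Ω.smoothOn_bracket hU (hχ i) (hχ j)) h i j
  simp only [constraintProj_apply]
  exact IsSmoothField.sum fun i _ => IsSmoothField.sum fun j _ =>
    IsSmoothField.smul ((hC i j).mul (hX.of_isOpen hU (hχ j)))
      (Ω.isSmoothField_hamVec hU (hχ i))

/-- Since `X` vanishes at `x`, the derivatives of the coefficients of the projection do not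
contribute. -/
theorem hasLinearPart_constraintProj (hU : IsOpen U) (hχ : ∀ i, SmoothOn d U (χ i))
    (h : ∀ y ∈ U, (Ω.constraintMatrix χ y).det ≠ 0) {X : ∀ x : P, TangentSpace (𝓡 d) x}
    {x : P} (hx : x ∈ U) {L : TangentSpace (𝓡 d) x →ₗ[ℝ] TangentSpace (𝓡 d) x}
    (hX : HasLinearPart X x L) :
    HasLinearPart (fun y => Ω.constraintProj χ y (X y)) x (Ω.constraintProj χ x ∘ₗ L) := by
  have hC : ∀ i j, SmoothOn d U (fun y => (Ω.constraintMatrix χ y)⁻¹ i j) := fun i j =>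
    SmoothOn.matrix_inv (fun i j => Ω.smoothOn_bracket hU (hχ i) (hχ j)) h i j
  simp only [constraintProj_apply]
  have key : ∀ i j : Fin m, HasLinearPart (fun y => ((Ω.constraintMatrix χ y)⁻¹ i j *
      differential d (χ j) y (X y)) • Ω.hamVec (χ i) y) x
      (((Ω.constraintMatrix χ x)⁻¹ i j • (differential d (χ j) x).toLinearMap.smulRight
        (Ω.hamVec (χ i) x)) ∘ₗ L) := by
    intro i j
    obtain ⟨h1, h2⟩ := hX.2 U (χ j) hU hx (hχ j)
    have hc := (hC i j).mdifferentiableAt hU hx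
    have h3 := HasLinearPart.smul_of_eq_zero hU hx (hc.mul h1) (by simp [hX.1])
      (Ω.isSmoothField_hamVec hU (hχ i))
    have h4 : ((Ω.constraintMatrix χ x)⁻¹ i j • (differential d (χ j) x).toLinearMap.smulRight
        (Ω.hamVec (χ i) x)) ∘ₗ L = (differential d ((fun y => (Ω.constraintMatrix χ y)⁻¹ i j) *
          fun y => differential d (χ j) y (X y)) x).toLinearMap.smulRight (Ω.hamVec (χ i) x) := by
      ext v : 1
      change (Ω.constraintMatrix χ x)⁻¹ i j • differential d (χ j) x (L v) • Ω.hamVec (χ i) x =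
        differential d _ x v • _
      rw [smul_smul]
      congr 1
      have := differential_mul hc h1 v
      rw [h2, hX.1, map_zero, zero_mul, add_zero] at this
      exact this.symm
    rw [h4]
    exact h3
  convert HasLinearPart.sum fun i _ => HasLinearPart.sum fun j _ => key i j using 1
  rw [constraintProj]
  ext v : 1
  simp

theorem isSmoothField_diracVec (hU : IsOpen U) (hχ : ∀ i, SmoothOn d U (χ i))
    (h : ∀ y ∈ U, (Ω.constraintMatrix χ y).det ≠ 0) {F : P → ℝ} (hF : SmoothOn d U F) :
    IsSmoothField U (fun y => Ω.diracVec χ y F) :=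
  (Ω.isSmoothField_hamVec hU hF).sub
    (isSmoothField_constraintProj hU hχ h (Ω.isSmoothField_hamVec hU hF))

theorem smoothOn_diracBracket (hU : IsOpen U) (hχ : ∀ i, SmoothOn d U (χ i))
    (h : ∀ y ∈ U, (Ω.constraintMatrix χ y).det ≠ 0) {F G : P → ℝ} (hF : SmoothOn d U F)
    (hG : SmoothOn d U G) : SmoothOn d U (Ω.diracBracket χ F G) :=
  ((isSmoothField_diracVec hU hχ h hG).of_isOpen hU hF).congr fun y _ =>
    (Ω.differential_diracVec χ y G F).symm

end SymplecticForm

/-- The invariant formula for the exterior derivative on three vector fields, with the sums and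
signs of `extDeriv_apply_vectorField` written out. -/
theorem extDeriv_two_form {E : Type*} [NormedAddCommGroup E] [NormedSpace ℝ E]
    {η : E → E [⋀^Fin 2]→L[ℝ] ℝ} {A B C : E → E} {z : E} (hη : DifferentiableAt ℝ η z)
    (hA : DifferentiableAt ℝ A z) (hB : DifferentiableAt ℝ B z) (hC : DifferentiableAt ℝ C z) :
    extDeriv η z ![A z, B z, C z] =
      fderiv ℝ (fun y => η y ![B y, C y]) z (A z) - fderiv ℝ (fun y => η y ![A y, C y]) z (B z) +
        fderiv ℝ (fun y => η y ![A y, B y]) z (C z) -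
      (η z ![VectorField.lieBracket ℝ A B z, C z] - η z ![VectorField.lieBracket ℝ A C z, B z] +
        η z ![VectorField.lieBracket ℝ B C z, A z]) := by
  have h := extDeriv_apply_vectorField (V := ![A, B, C]) hη
    (fun i => by fin_cases i <;> simpa)
  have e1 : (fun i => (![A, B, C] : Fin 3 → E → E) i z) = ![A z, B z, C z] := by
    funext i; fin_cases i <;> rfl
  have r0 : ∀ y, (0 : Fin 3).removeNth (fun i => (![A, B, C] : Fin 3 → E → E) i y) =
      ![B y, C y] := by
    intro y; funext i; fin_cases i <;> rfl
  have r1 : ∀ y, (1 : Fin 3).removeNth (fun i => (![A, B, C] : Fin 3 → E → E) i y) =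
      ![A y, C y] := by
    intro y; funext i; fin_cases i <;> rfl
  have r2 : ∀ y, (2 : Fin 3).removeNth (fun i => (![A, B, C] : Fin 3 → E → E) i y) =
      ![A y, B y] := by
    intro y; funext i; fin_cases i <;> rfl
  have s0 : (Finset.Ici (0 : Fin 2)) = {0, 1} := by decide
  have s1 : (Finset.Ici (1 : Fin 2)) = {1} := by decide
  have q : ∀ a b : E, (0 : Fin 2).removeNth ![a, b] = ![b] := by
    intro a b; funext i; fin_cases i; rfl
  have q' : ∀ a b : E, (1 : Fin 2).removeNth ![a, b] = ![a] := by
    intro a b; funext i; fin_cases i; rfl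
  have t0 : ∀ a b c : E, (0 : Fin 3).removeNth ![a, b, c] = ![b, c] := by
    intro a b c; funext i; fin_cases i <;> rfl
  have t1 : ∀ a b c : E, (1 : Fin 3).removeNth ![a, b, c] = ![a, c] := by
    intro a b c; funext i; fin_cases i <;> rfl
  have c1 : (1 : Fin 2).castSucc = 1 := rfl
  have c2 : (1 : Fin 2).succ = 2 := rfl
  have c3 : (2 : Fin 3).val = 2 := rfl
  have v2' : ∀ a b c : E → E, ![a, b, c] 2 = c := fun _ _ _ => rfl
  rw [e1] at h
  rw [h, Fin.sum_univ_three, Fin.sum_univ_two, s0, s1, Finset.sum_pair (by decide),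
    Finset.sum_singleton]
  simp only [r0, r1, r2, t0, t1, q, q', Fin.castSucc_zero, Fin.succ_zero_eq_one, c1, c2, c3,
    Matrix.cons_val_zero, Matrix.cons_val_one, v2', Fin.val_zero, Fin.val_one]
  norm_num
  ring

end

section

variable {d : ℕ} {P : Type*} [TopologicalSpace P] [ChartedSpace (EuclideanSpace ℝ (Fin d)) P]

namespace SymplecticForm

variable [IsManifold (𝓡 d) ∞ P] {Ω : SymplecticForm d P} {m : ℕ} {χ : Fin m → P → ℝ} {U : Set P}

/-! ### The Jacobi identity -/

/-- Closedness of Ω is evaluated in a chart on the Dirac fields Y_F, Y_G, Y_H. Since Ω(Y_F, Y_G) =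
{F, G}_χ and [Y_F, Y_G] is again in the common kernel of the dχ_i, every term of the invariant
formula is an iterated Dirac bracket. -/
theorem diracBracket_jacobi (hU : IsOpen U) (hχ : ∀ i, SmoothOn d U (χ i))
    (h : ∀ y ∈ U, (Ω.constraintMatrix χ y).det ≠ 0) {F G H : P → ℝ} (hF : SmoothOn d U F)
    (hG : SmoothOn d U G) (hH : SmoothOn d U H) {x : P} (hx : x ∈ U) :
    Ω.diracBracket χ (Ω.diracBracket χ F G) H x + Ω.diracBracket χ (Ω.diracBracket χ H F) G x +
      Ω.diracBracket χ (Ω.diracBracket χ G H) F x = 0 := by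
  set e := chartAt (EuclideanSpace ℝ (Fin d)) x with he
  have hem : e ∈ IsManifold.maximalAtlas (𝓡 d) ∞ P := chart_mem x
  have hxe : x ∈ e.source := mem_chart_source _ x
  have hz := e.map_source hxe
  have hzx := e.left_inv hxe
  let T := e.target ∩ e.symm ⁻¹' U
  have hT : IsOpen T := e.symm.isOpen_inter_preimage hU
  have hzT : e x ∈ T := ⟨hz, by rwa [mem_preimage, hzx]⟩
  let η := chartForm Ω.form x
  let Y : (P → ℝ) → EuclideanSpace ℝ (Fin d) → EuclideanSpace ℝ (Fin d) := fun F z =>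
    chartDeriv e (e.symm z) (Ω.diracVec χ (e.symm z) F)
  have hη : DifferentiableAt ℝ η (e x) := (Ω.chartForm_smoothAt x hz).differentiableAt (by simp)
  have hY : ∀ F, SmoothOn d U F → DifferentiableAt ℝ (Y F) (e x) := fun F hF =>
    ((isSmoothField_diracVec hU hχ h hF).contDiffAt_chart hem hU hz hzT.2).differentiableAt
      (by simp)
  have k1 : ∀ F G, ∀ z ∈ T, η z ![Y F z, Y G z] = Ω.diracBracket χ F G (e.symm z) := by
    intro F G z hz
    have := Ω.chartForm_chartDeriv x (e.map_target hz.1) (Ω.diracVec χ (e.symm z) F)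
      (Ω.diracVec χ (e.symm z) G)
    rw [← he, e.right_inv hz.1] at this
    exact this.trans (Ω.bil_diracVec_diracVec (h _ hz.2) F G)
  have k2 : ∀ F G, SmoothOn d U G → ∀ z ∈ T, fderiv ℝ (fun z => G (e.symm z)) z (Y F z) =
      Ω.diracBracket χ G F (e.symm z) := by
    intro F G hG z hz
    have := differential_eq_fderiv hem hU hG (e.map_target hz.1) hz.2
      (Ω.diracVec χ (e.symm z) F)
    rw [e.right_inv hz.1, differential_diracVec] at this
    exact this.symm
  have k3 : ∀ F G H, SmoothOn d U F → SmoothOn d U G →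
      fderiv ℝ (fun z => η z ![Y F z, Y G z]) (e x) (Y H (e x)) =
        Ω.diracBracket χ (Ω.diracBracket χ F G) H x := by
    intro F G H hF hG
    rw [(Filter.eventuallyEq_of_mem (hT.mem_nhds hzT) (k1 F G)).fderiv_eq,
      k2 H _ (smoothOn_diracBracket hU hχ h hF hG) _ hzT, hzx]
  have k4 : ∀ F G H, SmoothOn d U F → SmoothOn d U G → SmoothOn d U H →
      fderiv ℝ (fun z => H (e.symm z)) (e x) (VectorField.lieBracket ℝ (Y F) (Y G) (e x)) =
        Ω.diracBracket χ (Ω.diracBracket χ H G) F x -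
          Ω.diracBracket χ (Ω.diracBracket χ H F) G x := by
    intro F G H hF hG hH
    rw [VectorField.fderiv_apply_lieBracket (contDiffAt_comp_symm hem hU hH hz hzT.2)
      (by rw [minSmoothness_of_isRCLikeNormedField]
          exact WithTop.coe_le_coe.2 (le_top (a := (2 : ℕ∞))))
      (hY G hG) (hY F hF),
      (Filter.eventuallyEq_of_mem (hT.mem_nhds hzT) (k2 G H hH)).fderiv_eq,
      (Filter.eventuallyEq_of_mem (hT.mem_nhds hzT) (k2 F H hH)).fderiv_eq,
      k2 F _ (smoothOn_diracBracket hU hχ h hH hG) _ hzT,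
      k2 G _ (smoothOn_diracBracket hU hχ h hH hF) _ hzT, hzx]
  have k5 : ∀ F G H, SmoothOn d U F → SmoothOn d U G → SmoothOn d U H →
      η (e x) ![VectorField.lieBracket ℝ (Y F) (Y G) (e x), Y H (e x)] =
        Ω.diracBracket χ (Ω.diracBracket χ H F) G x -
          Ω.diracBracket χ (Ω.diracBracket χ H G) F x := by
    intro F G H hF hG hH
    obtain ⟨β, hβ⟩ := (chartEquiv hem hxe).surjective (VectorField.lieBracket ℝ (Y F) (Y G) (e x))
    rw [chartEquiv_apply] at hβ
    -- The brackets {χ_i, ·}_χ vanish identically on `U`, not only on the zero set, so they can be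
    -- differentiated: the Lie bracket of two Dirac fields annihilates each χ_i.
    have hβK : β ∈ constraintKer χ x := by
      rw [mem_constraintKer]
      intro i
      rw [differential_eq_fderiv hem hU (hχ i) hxe hx, hβ, k4 F G _ hF hG (hχ i)]
      have h0 : ∀ F G, Ω.diracBracket χ (Ω.diracBracket χ (χ i) F) G x = 0 := fun F G => by
        rw [← differential_diracVec, differential_congr_on hU hx
          (fun y hy => Ω.diracBracket_constraint (h y hy) F i), differential_const]
      rw [h0, h0, sub_zero]
    have h1 := Ω.chartForm_chartDeriv x hxe β (Ω.diracVec χ x H)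
    rw [← he, hβ] at h1
    have h2 : Y H (e x) = chartDeriv e x (Ω.diracVec χ x H) := by
      simp only [Y]
      rw [hzx]
    rw [h2]
    refine h1.trans ?_
    rw [bil_swap, Ω.bil_diracVec H hβK, differential_eq_fderiv hem hU hH hxe hx, hβ,
      k4 F G H hF hG hH, neg_sub]
  have k6 : ∀ F G H, SmoothOn d U F → SmoothOn d U G → Ω.diracBracket χ (Ω.diracBracket χ G F) H x =
      - Ω.diracBracket χ (Ω.diracBracket χ F G) H x := by
    intro F G H hF hG
    rw [← differential_diracVec, ← differential_diracVec, differential_congr_on hU hx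
      (G := fun y => (-1) * Ω.diracBracket χ F G y)
      (fun y hy => by rw [Ω.diracBracket_antisymm (h y hy)]; ring)]
    rw [differential_const_mul ((smoothOn_diracBracket hU hχ h hF hG).mdifferentiableAt hU hx)]
    ring
  have hc : extDeriv η (e x) = 0 := Ω.closed x (e x) (by simpa [mfld_simps] using hz)
  -- With J the cyclic sum, the three derivative terms add up to J and the three Lie bracket terms
  -- to 2J; hence 0 = J - 2J.
  have key := extDeriv_two_form hη (hY F hF) (hY G hG) (hY H hH)
  rw [hc, k3 G H F hG hH, k3 F H G hF hH, k3 F G H hF hG, k5 F G H hF hG hH, k5 F H G hF hH hG,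
    k5 G H F hG hH hF] at key
  change (0 : ℝ) = _ at key
  have a1 := k6 G H F hG hH
  have a2 := k6 F G H hF hG
  have a3 := k6 F H G hF hH
  linarith

theorem isPoissonBracketOn_diracBracket (hU : IsOpen U) (hχ : ∀ i, SmoothOn d U (χ i))
    (h : ∀ y ∈ U, (Ω.constraintMatrix χ y).det ≠ 0) :
    IsPoissonBracketOn d U (Ω.diracBracket χ) where
  smooth F G hF hG := smoothOn_diracBracket hU hχ h hF hG
  congr F F' G _ _ _ hFF' x hx := by
    rw [← differential_diracVec, ← differential_diracVec, differential_congr_on hU hx hFF']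
  add_left F F' G hF hF' _ x hx := by
    rw [Pi.add_apply]
    simp only [← differential_diracVec]
    exact differential_add (hF.mdifferentiableAt hU hx) (hF'.mdifferentiableAt hU hx) _
  smul_left c F G hF _ x hx := by
    rw [Pi.smul_apply]
    simp only [← differential_diracVec]
    exact differential_const_mul (hF.mdifferentiableAt hU hx) c _
  antisymm F G _ _ x hx := Ω.diracBracket_antisymm (h x hx) F G
  leibniz F G H hF hG _ x hx := by
    simp only [Pi.add_apply, Pi.mul_apply]
    simp only [← differential_diracVec]
    exact differential_mul (hF.mdifferentiableAt hU hx) (hG.mdifferentiableAt hU hx) _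
  jacobi F G H hF hG hH x hx := diracBracket_jacobi hU hχ h hF hG hH hx

end SymplecticForm

end

section

variable {d : ℕ} {P : Type*} [TopologicalSpace P] [ChartedSpace (EuclideanSpace ℝ (Fin d)) P]

/-! ### Slice charts -/

section Slice

variable [IsManifold (𝓡 d) ∞ P] {N : Set P} {x : P}
  {e : OpenPartialHomeomorph P (EuclideanSpace ℝ (Fin d))}
  {W : Submodule ℝ (EuclideanSpace ℝ (Fin d))}

/-- Tangent vectors lie in `W` because the linear functionals ⟨b, e⟩ with b ∈ Wᗮ vanish on `N`.
Conversely, a vector of `W` is the velocity of a straight line that stays in the slice, along which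
every function vanishing on `N` is zero. -/
theorem mem_tangentAt_iff_of_slice (he : e ∈ IsManifold.maximalAtlas (𝓡 d) ∞ P)
    (hxe : x ∈ e.source) (hxN : x ∈ N) (hW : ∀ y ∈ e.source, y ∈ N ↔ e y ∈ W)
    {v : TangentSpace (𝓡 d) x} : v ∈ tangentAt N x ↔ chartDeriv e x v ∈ W := by
  constructor
  · intro hv
    rw [← W.orthogonal_orthogonal, Submodule.mem_orthogonal]
    intro b hb
    have h1 := hv e.source (fun y => innerSL ℝ b (e y)) e.open_source hxe
      (smoothOn_chart he (innerSL ℝ b)) (fun y hy => by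
        rw [innerSL_apply_apply, real_inner_comm]
        exact (Submodule.mem_orthogonal _ _).1 hb _ ((hW y hy.2).1 hy.1))
    rwa [differential_chart he hxe, innerSL_apply_apply] at h1
  · intro hv U f hU hxU hf h0
    rw [differential_eq_fderiv he hU hf hxe hxU]
    have hz := e.map_source hxe
    have hd : HasLineDerivAt ℝ (fun z => f (e.symm z))
        (fderiv ℝ (fun z => f (e.symm z)) (e x) (chartDeriv e x v)) (e x) (chartDeriv e x v) :=
      ((contDiffAt_comp_symm he hU hf hz
        (by rwa [e.left_inv hxe])).differentiableAt (by simp)).hasFDerivAt.hasLineDerivAt _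
    refine hd.unique ?_
    have hT : IsOpen (e.target ∩ e.symm ⁻¹' U) := e.symm.isOpen_inter_preimage hU
    have hcont : ContinuousAt (fun t : ℝ => e x + t • chartDeriv e x v) 0 := by fun_prop
    have hev : ∀ᶠ t : ℝ in nhds 0, e x + t • chartDeriv e x v ∈ e.target ∩ e.symm ⁻¹' U :=
      hcont.eventually_mem (by
        rw [zero_smul, add_zero]
        exact hT.mem_nhds ⟨hz, by rwa [mem_preimage, e.left_inv hxe]⟩)
    have h1 : (fun t : ℝ => f (e.symm (e x + t • chartDeriv e x v))) =ᶠ[nhds 0] fun _ => 0 := by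
      filter_upwards [hev] with t ht
      refine h0 _ ⟨(hW _ (e.map_target ht.1)).2 ?_, ht.2⟩
      rw [e.right_inv ht.1]
      exact W.add_mem ((hW x hxe).1 hxN) (W.smul_mem t hv)
    exact (hasDerivAt_const (0 : ℝ) (0 : ℝ)).congr_of_eventuallyEq h1

theorem finrank_tangentAt {q : ℕ} (hN : IsSubmanifold d N q) (hx : x ∈ N) :
    Module.finrank ℝ (tangentAt (d := d) N x) = q := by
  obtain ⟨e, he, hxe, W, hWq, hW⟩ := hN x hx
  have h1 : tangentAt (d := d) N x = W.map (chartEquiv he hxe).symm.toLinearMap := by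
    ext v
    rw [mem_tangentAt_iff_of_slice he hxe hx hW, Submodule.mem_map]
    constructor
    · intro hv
      exact ⟨_, hv, (chartEquiv he hxe).symm_apply_apply v⟩
    · rintro ⟨w, hw, rfl⟩
      have := (chartEquiv he hxe).apply_symm_apply w
      rw [chartEquiv_apply] at this
      exact this.symm ▸ hw
  rw [h1, LinearEquiv.finrank_map_eq, hWq]

theorem tangentAt_le_constraintKer {m : ℕ} {χ : Fin m → P → ℝ} {U : Set P} (hU : IsOpen U)
    (hχ : ∀ i, SmoothOn d U (χ i)) (h0 : ∀ y ∈ N ∩ U, ∀ i, χ i y = 0) (hx : x ∈ U) :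
    tangentAt (d := d) N x ≤ SymplecticForm.constraintKer χ x := fun _ hv =>
  SymplecticForm.mem_constraintKer.2 fun i => hv U (χ i) hU hx (hχ i) fun y hy => h0 y hy i

/-- The common zero set of functions with independent differentials has slice charts. -/
theorem exists_sliceChart {m : ℕ} {χ : Fin m → P → ℝ} {U : Set P} (hU : IsOpen U)
    (hχ : ∀ i, SmoothOn d U (χ i)) (hx : x ∈ U)
    (hsurj : ∀ a : Fin m → ℝ, ∃ v, ∀ i, differential d (χ i) x v = a i) :
    ∃ e ∈ IsManifold.maximalAtlas (𝓡 d) ∞ P, x ∈ e.source ∧ e.source ⊆ U ∧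
      ∃ W : Submodule ℝ (EuclideanSpace ℝ (Fin d)), m + Module.finrank ℝ W = d ∧
        ∀ y ∈ e.source, (∀ i, χ i y = 0) ↔ e y ∈ W := by
  set c := chartAt (EuclideanSpace ℝ (Fin d)) x with hc
  have hcm : c ∈ IsManifold.maximalAtlas (𝓡 d) ∞ P := SymplecticForm.chart_mem x
  have hxc : x ∈ c.source := mem_chart_source _ x
  have hz := c.map_source hxc
  let T := c.target ∩ c.symm ⁻¹' U
  have hT : IsOpen T := c.symm.isOpen_inter_preimage hU
  have hzT : c x ∈ T := ⟨hz, by rwa [mem_preimage, c.left_inv hxc]⟩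
  let g : EuclideanSpace ℝ (Fin d) → Fin m → ℝ := fun z i => χ i (c.symm z)
  have hg : ∀ z ∈ T, ContDiffAt ℝ ∞ g z := fun z hz =>
    contDiffAt_pi.2 fun i => contDiffAt_comp_symm hcm hU (hχ i) hz.1 hz.2
  let A := fderiv ℝ g (c x)
  have hA : Function.Surjective A.toLinearMap := by
    intro a
    obtain ⟨v, hv⟩ := hsurj a
    refine ⟨chartDeriv c x v, ?_⟩
    funext i
    rw [← hv i, differential_eq_fderiv hcm hU (hχ i) hxc hx]
    change fderiv ℝ g (c x) (chartDeriv c x v) i = _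
    rw [fderiv_pi fun i => (contDiffAt_pi.1 (hg _ hzT) i).differentiableAt (by simp)]
    rfl
  obtain ⟨R, hR⟩ := A.toLinearMap.exists_rightInverse_of_surjective (LinearMap.range_eq_top.2 hA)
  have hR' : ∀ a, A (R a) = a := fun a => LinearMap.congr_fun hR a
  -- The correction by a right inverse `R` of `A` gives A ∘ Φ = g, so that Φ carries {g = 0} into
  -- ker A; its derivative at the base point is the identity because `g` and `A` have the same
  -- derivative there.
  let Φ : EuclideanSpace ℝ (Fin d) → EuclideanSpace ℝ (Fin d) := fun z =>
    z + R.toContinuousLinearMap (g z - A z)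
  have hΦ : ∀ z ∈ T, ContDiffAt ℝ ∞ Φ z := fun z hz =>
    contDiffAt_id.add (R.toContinuousLinearMap.contDiff.contDiffAt.comp z
      ((hg z hz).sub A.contDiff.contDiffAt))
  have hAΦ : ∀ z, A (Φ z) = g z := fun z => by
    simp only [Φ, map_add]
    change A z + A (R _) = _
    rw [hR']
    abel
  have hΦ' : HasFDerivAt Φ
      ((ContinuousLinearEquiv.refl ℝ (EuclideanSpace ℝ (Fin d)) : _ →L[ℝ] _)) (c x) := by
    have h1 : HasFDerivAt g A (c x) := ((hg _ hzT).differentiableAt (by simp)).hasFDerivAt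
    have h2 := (hasFDerivAt_id (𝕜 := ℝ) (c x)).add
      (R.toContinuousLinearMap.hasFDerivAt.comp (c x) (h1.sub A.hasFDerivAt))
    refine h2.congr_fderiv ?_
    ext v : 1
    simp
  let h := (hΦ _ hzT).toOpenPartialHomeomorph Φ hΦ' (by simp)
  -- The inverse function theorem gives smoothness of the inverse at one point. Restricting to
  -- points where the derivative is invertible gives it on the whole target.
  let T' := {z ∈ T | ∃ L : EuclideanSpace ℝ (Fin d) ≃L[ℝ] EuclideanSpace ℝ (Fin d),
    (L : _ →L[ℝ] _) = fderiv ℝ Φ z}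
  have hT' : IsOpen T' := by
    have h1 : ContDiffOn ℝ ∞ Φ T := fun z hz => (hΦ z hz).contDiffWithinAt
    exact (h1.continuousOn_fderiv_of_isOpen hT (by simp)).isOpen_inter_preimage hT
      ContinuousLinearEquiv.isOpen
  have hzT' : c x ∈ T' := ⟨hzT, _, hΦ'.fderiv.symm⟩
  let k := h.restrOpen T' hT'
  have hk : ∀ z, k z = Φ z := fun z => rfl
  have hks : ∀ z ∈ k.source, z ∈ T' := fun z hz => hz.2
  have hxk : c x ∈ k.source :=
    ⟨(hΦ _ hzT).mem_toOpenPartialHomeomorph_source hΦ' (by simp), hzT'⟩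
  have hksymm : ∀ w ∈ k.target, ContDiffAt ℝ ∞ k.symm w := by
    intro w hw
    have hw' := hks _ (k.map_target hw)
    obtain ⟨L, hL⟩ := hw'.2
    refine k.contDiffAt_symm (f₀' := L) hw ?_ (hΦ _ hw'.1)
    rw [hL]
    exact ((hΦ _ hw'.1).differentiableAt (by simp)).hasFDerivAt
  refine ⟨c.trans k, ?_, ?_, ?_, LinearMap.ker A.toLinearMap, ?_, ?_⟩
  · refine OpenPartialHomeomorph.mem_maximalAtlas_of_contMDiffOn _ ?_ ?_
    · have h1 : ContMDiffOn (𝓡 d) (𝓡 d) ∞ k k.source := contMDiffOn_iff_contDiffOn.2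
        fun z hz => (hΦ z (hks z hz).1).contDiffWithinAt
      rw [OpenPartialHomeomorph.coe_trans, OpenPartialHomeomorph.trans_source]
      exact h1.comp ((contMDiffOn_of_mem_maximalAtlas hcm).mono inter_subset_left)
        fun y hy => hy.2
    · have h1 : ContMDiffOn (𝓡 d) (𝓡 d) ∞ k.symm k.target := contMDiffOn_iff_contDiffOn.2
        fun z hz => (hksymm z hz).contDiffWithinAt
      rw [OpenPartialHomeomorph.coe_trans_symm, OpenPartialHomeomorph.trans_target]
      exact (contMDiffOn_symm_of_mem_maximalAtlas hcm).comp (h1.mono inter_subset_left)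
        fun y hy => hy.2
  · rw [OpenPartialHomeomorph.trans_source]
    exact ⟨hxc, hxk⟩
  · rw [OpenPartialHomeomorph.trans_source]
    rintro y ⟨hy, hy'⟩
    have := (hks _ hy').1.2
    rwa [mem_preimage, c.left_inv hy] at this
  · have := LinearMap.finrank_range_add_finrank_ker A.toLinearMap
    rwa [LinearMap.range_eq_top.2 hA, finrank_top, Module.finrank_fin_fun,
      finrank_euclideanSpace_fin] at this
  · rw [OpenPartialHomeomorph.trans_source]
    rintro y ⟨hy, _⟩
    rw [OpenPartialHomeomorph.coe_trans, Function.comp_apply, hk, LinearMap.mem_ker]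
    change _ ↔ A (Φ (c y)) = 0
    rw [hAΦ, funext_iff]
    simp only [g, c.left_inv hy, Pi.zero_apply]

end Slice

/-! ### Zero sets of second class functions and their tangent spaces -/

namespace SymplecticForm

variable [IsManifold (𝓡 d) ∞ P] {Ω : SymplecticForm d P} {m : ℕ} {χ : Fin m → P → ℝ}
  {N U : Set P} {x : P}

theorem differential_surjective (h : (Ω.constraintMatrix χ x).det ≠ 0) (a : Fin m → ℝ) :
    ∃ v, ∀ i, differential d (χ i) x v = a i := by
  refine ⟨∑ j, ((Ω.constraintMatrix χ x)⁻¹.mulVec a) j • Ω.hamVec (χ j) x, fun i => ?_⟩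
  have h1 : (Ω.constraintMatrix χ x).mulVec ((Ω.constraintMatrix χ x)⁻¹.mulVec a) i = a i := by
    rw [Matrix.mulVec_mulVec, Matrix.mul_nonsing_inv _ (isUnit_iff_ne_zero.2 h), Matrix.one_mulVec]
  rw [← h1]
  simp only [map_sum, map_smul, smul_eq_mul, ← constraintMatrix_apply]
  rw [Matrix.mulVec, dotProduct]
  exact Finset.sum_congr rfl fun j _ => mul_comm _ _

theorem IsSecondClassEquations.eq_zero (h : Ω.IsSecondClassEquations N U χ) :
    ∀ y ∈ N ∩ U, ∀ i, χ i y = 0 := fun y hy => by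
  rw [h.eq_zero_locus] at hy
  exact hy.2

theorem IsSecondClassEquations.mem_iff (h : Ω.IsSecondClassEquations N U χ) {y : P} (hy : y ∈ U) :
    y ∈ N ↔ ∀ i, χ i y = 0 := by
  have := Set.ext_iff.1 h.eq_zero_locus y
  simpa [hy] using this

/-- One inclusion holds because the χ_i vanish on `N`; the dimensions `q` and `d - m` agree. -/
theorem IsSecondClassEquations.tangentAt_eq (h : Ω.IsSecondClassEquations N U χ) {q : ℕ}
    (hN : IsSubmanifold d N q) (hmq : m + q = d) (hx : x ∈ N ∩ U) :
    tangentAt (d := d) N x = constraintKer χ x := by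
  refine Submodule.eq_of_le_of_finrank_eq
    (tangentAt_le_constraintKer (d := d) h.isOpen h.smooth h.eq_zero hx.2) ?_
  have := Ω.finrank_constraintKer (h.det_ne_zero x hx.2)
  rw [finrank_tangentAt (d := d) hN hx.1]
  omega

/-- A set covered by open sets with second class equations is a submanifold. -/
theorem isSubmanifold_of_secondClassEquations {q : ℕ} (hmq : m + q = d)
    (h : ∀ x ∈ N, ∃ (U : Set P) (χ : Fin m → P → ℝ), x ∈ U ∧ Ω.IsSecondClassEquations N U χ) :
    IsSubmanifold d N q := by
  intro x hx
  obtain ⟨U, χ, hxU, hχ⟩ := h x hx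
  obtain ⟨e, he, hxe, heU, W, hW, heW⟩ := exists_sliceChart hχ.isOpen hχ.smooth hxU
    (differential_surjective (hχ.det_ne_zero x hxU))
  exact ⟨e, he, hxe, W, by omega, fun y hy => by rw [hχ.mem_iff (heU hy), heW y hy]⟩

end SymplecticForm

end

section

variable {d : ℕ} {P : Type*} [TopologicalSpace P] [ChartedSpace (EuclideanSpace ℝ (Fin d)) P]

namespace SymplecticForm

variable {Ω : SymplecticForm d P}

/-! ### Symplectic subspaces -/

section Linear

variable {x : P} {n : ℕ} {f : Fin n → TangentSpace (𝓡 d) x}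
  {A K L : Submodule ℝ (TangentSpace (𝓡 d) x)}

/-- A null vector of the Gram matrix is the coefficient vector of an element of the radical. -/
theorem det_gram_ne_zero (hf : LinearIndependent ℝ f)
    (h : Submodule.span ℝ (range f) ⊓ Ω.orth (Submodule.span ℝ (range f)) = ⊥) :
    (Matrix.of fun i j => Ω.bil x (f i) (f j)).det ≠ 0 := by
  intro hdet
  obtain ⟨a, ha, h0⟩ := Matrix.exists_mulVec_eq_zero_iff.2 hdet
  refine ha ?_
  have h1 : ∑ j, a j • f j ∈ Submodule.span ℝ (range f) :=
    Submodule.sum_mem _ fun j _ => Submodule.smul_mem _ _ (Submodule.subset_span ⟨j, rfl⟩)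
  have h2 : ∑ j, a j • f j ∈ Ω.orth (Submodule.span ℝ (range f)) := by
    rw [mem_orth_span]
    intro i
    rw [bil_swap, neg_eq_zero, map_sum]
    refine Eq.trans ?_ (congrFun h0 i)
    rw [Matrix.mulVec, dotProduct]
    exact Finset.sum_congr rfl fun j _ => by rw [map_smul, smul_eq_mul, mul_comm]; rfl
  have h3 : ∑ j, a j • f j ∈ (⊥ : Submodule ℝ (TangentSpace (𝓡 d) x)) := h ▸ ⟨h1, h2⟩
  funext j
  exact Fintype.linearIndependent_iff.1 hf a ((Submodule.mem_bot ℝ).1 h3) j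

/-- The Gram matrix of a basis is skew-symmetric; in odd size its determinant would vanish. -/
theorem even_finrank (h : A ⊓ Ω.orth A = ⊥) : Even (Module.finrank ℝ A) := by
  let b := Module.finBasis ℝ A
  let f : Fin (Module.finrank ℝ A) → TangentSpace (𝓡 d) x := fun i => b i
  have hf : LinearIndependent ℝ f :=
    b.linearIndependent.map' A.subtype (Submodule.ker_subtype A)
  have hs : Submodule.span ℝ (range f) = A := by
    have : range f = A.subtype '' range b := by
      rw [← range_comp]; rfl
    rw [this, ← Submodule.map_span, b.span_eq, Submodule.map_top, Submodule.range_subtype]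
  have h1 := det_gram_ne_zero (Ω := Ω) hf (by rw [hs, h])
  by_contra hodd
  rw [Nat.not_even_iff_odd] at hodd
  refine h1 ?_
  set M : Matrix (Fin (Module.finrank ℝ A)) (Fin (Module.finrank ℝ A)) ℝ :=
    Matrix.of fun i j => Ω.bil x (f i) (f j) with hM
  have hT : M.transpose = -M := by
    ext i j
    simp only [hM, Matrix.transpose_apply, Matrix.of_apply, Matrix.neg_apply]
    exact Ω.bil_swap x _ _
  have := M.det_transpose
  rw [hT, Matrix.det_neg, Fintype.card_fin, hodd.neg_one_pow] at this
  linarith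

/-- A complement in `T^Ω` of the kernel of a subspace `T` is symplectic. -/
theorem inf_orth_eq_bot_of_complement {T : Submodule ℝ (TangentSpace (𝓡 d) x)}
    (hdisj : A ⊓ Ω.ker T = ⊥) (hsup : A ⊔ Ω.ker T = Ω.orth T) : A ⊓ Ω.orth A = ⊥ := by
  rw [eq_bot_iff]
  rintro v ⟨hvA, hv⟩
  have hAT : A ≤ Ω.orth T := hsup ▸ le_sup_left
  have hvT : v ∈ Ω.orth (Ω.orth T) := by
    intro w hw
    rw [← hsup] at hw
    obtain ⟨a, ha, c, hc, rfl⟩ := Submodule.mem_sup.1 hw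
    rw [form_add_right, hv a ha, hAT hvA c hc.1, add_zero]
  rw [orth_orth] at hvT
  rw [← hdisj]
  exact ⟨hvA, hvT, hAT hvA⟩

theorem finrank_complement {T : Submodule ℝ (TangentSpace (𝓡 d) x)}
    (hdisj : A ⊓ Ω.ker T = ⊥) (hsup : A ⊔ Ω.ker T = Ω.orth T) :
    Module.finrank ℝ T + Module.finrank ℝ (Ω.ker T) + Module.finrank ℝ A = d := by
  have h1 := Submodule.finrank_sup_add_finrank_inf_eq A (Ω.ker T)
  have h2 := Ω.finrank_orth T
  rw [hdisj, hsup, finrank_bot] at h1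
  omega

variable {m : ℕ} {χ : Fin m → P → ℝ}

theorem constraintProj_mem_orth (v : TangentSpace (𝓡 d) x) :
    Ω.constraintProj χ x v ∈ Ω.orth (constraintKer χ x) := by
  rw [constraintKer_eq_orth, orth_orth, constraintProj_apply]
  exact Submodule.sum_mem _ fun i _ => Submodule.sum_mem _ fun j _ =>
    Submodule.smul_mem _ _ (Submodule.subset_span ⟨i, rfl⟩)

theorem constraintProj_eq_self (h : (Ω.constraintMatrix χ x).det ≠ 0)
    {v : TangentSpace (𝓡 d) x} (hv : v ∈ Ω.orth (constraintKer χ x)) :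
    Ω.constraintProj χ x v = v := by
  have : v - Ω.constraintProj χ x v ∈ Ω.ker (constraintKer χ x) :=
    ⟨Ω.sub_constraintProj_mem h v, Submodule.sub_mem _ hv (constraintProj_mem_orth v)⟩
  rw [Ω.ker_constraintKer h, Submodule.mem_bot, sub_eq_zero] at this
  exact this.symm

/-- The range of the projection is the Ω-orthogonal of its kernel, so the kernel determines it. This
makes different local constraint systems compatible along `S`. -/
theorem constraintProj_congr {m' : ℕ} {χ' : Fin m' → P → ℝ}
    (h : (Ω.constraintMatrix χ x).det ≠ 0) (h' : (Ω.constraintMatrix χ' x).det ≠ 0)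
    (hK : constraintKer (d := d) χ x = constraintKer χ' x) (v : TangentSpace (𝓡 d) x) :
    Ω.constraintProj χ x v = Ω.constraintProj χ' x v := by
  have h1 : Ω.constraintProj χ x v - Ω.constraintProj χ' x v ∈ Ω.ker (constraintKer χ x) := by
    refine ⟨?_, Submodule.sub_mem _ (constraintProj_mem_orth v)
      (hK ▸ constraintProj_mem_orth v)⟩
    have := Submodule.sub_mem _ (hK ▸ Ω.sub_constraintProj_mem h' v :
      v - Ω.constraintProj χ' x v ∈ constraintKer χ x) (Ω.sub_constraintProj_mem h v)
    simpa using this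
  rwa [Ω.ker_constraintKer h, Submodule.mem_bot, sub_eq_zero] at h1

end Linear

/-! ### Local second class functions adapted to a symplectic subbundle -/

variable [IsManifold (𝓡 d) ∞ P] {e : OpenPartialHomeomorph P (EuclideanSpace ℝ (Fin d))}

/-- The coordinate functions of a chart. -/
def coords (e : OpenPartialHomeomorph P (EuclideanSpace ℝ (Fin d))) (i : Fin d) (y : P) : ℝ :=
  (EuclideanSpace.proj i : EuclideanSpace ℝ (Fin d) →L[ℝ] ℝ) (e y)

theorem smoothOn_coords (he : e ∈ IsManifold.maximalAtlas (𝓡 d) ∞ P) (i : Fin d) :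
    SmoothOn d e.source (coords e i) := smoothOn_chart he _

theorem differential_coords (he : e ∈ IsManifold.maximalAtlas (𝓡 d) ∞ P) {x : P}
    (hx : x ∈ e.source) (i : Fin d) (v : TangentSpace (𝓡 d) x) :
    differential d (coords e i) x v = chartDeriv e x v i :=
  differential_chart he hx _ v

/-- A null vector `a` gives a combination of the Hamiltonian vectors of the coordinates that all
coordinate differentials annihilate, hence zero; pairing it with the coordinate vectors gives a = 0.
-/
theorem det_constraintMatrix_coords (he : e ∈ IsManifold.maximalAtlas (𝓡 d) ∞ P) {x : P}
    (hx : x ∈ e.source) : (Ω.constraintMatrix (coords e) x).det ≠ 0 := by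
  intro hdet
  obtain ⟨a, ha, h0⟩ := Matrix.exists_mulVec_eq_zero_iff.2 hdet
  refine ha ?_
  have h1 : ∑ j, a j • Ω.hamVec (coords e j) x = 0 := by
    apply chartDeriv_injective he hx
    rw [map_zero]
    ext i
    rw [← differential_coords he hx, map_sum, PiLp.zero_apply]
    rw [← Pi.zero_apply (M := fun _ => ℝ) i, ← congrFun h0 i, Matrix.mulVec, dotProduct]
    exact Finset.sum_congr rfl fun j _ => by
      rw [map_smul, smul_eq_mul, mul_comm, ← constraintMatrix_apply]
  funext i
  obtain ⟨w, hw⟩ := (chartEquiv he hx).surjective (EuclideanSpace.single i 1)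
  rw [chartEquiv_apply] at hw
  have h2 := congrArg (fun u => Ω.bil x u w) h1
  simpa [bil_hamVec, differential_coords he hx, hw] using h2

/-- The coefficients of the expansion of a vector in the Hamiltonian vectors of the coordinates. -/
def hamCoeff (Ω : SymplecticForm d P) (e : OpenPartialHomeomorph P (EuclideanSpace ℝ (Fin d)))
    (x : P) (v : TangentSpace (𝓡 d) x) (i : Fin d) : ℝ :=
  ∑ j, (Ω.constraintMatrix (coords e) x)⁻¹ i j * differential d (coords e j) x v

/-- The coordinates form a second class system with zero common kernel, so its `constraintProj` is
the identity and expands `v` in Hamiltonian vectors. -/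
theorem bil_eq_sum_hamCoeff (he : e ∈ IsManifold.maximalAtlas (𝓡 d) ∞ P) {x : P}
    (hx : x ∈ e.source) (v w : TangentSpace (𝓡 d) x) :
    Ω.bil x v w = ∑ i, Ω.hamCoeff e x v i * chartDeriv e x w i := by
  have h := Ω.sub_constraintProj_mem (det_constraintMatrix_coords he hx) v
  have h0 : v - Ω.constraintProj (coords e) x v = 0 := by
    apply chartDeriv_injective he hx
    rw [map_zero]
    ext i
    rw [← differential_coords he hx]
    exact mem_constraintKer.1 h i
  rw [sub_eq_zero] at h0
  conv_lhs => rw [h0]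
  rw [constraintProj_apply]
  simp only [map_sum, LinearMap.sum_apply, map_smul, LinearMap.smul_apply, smul_eq_mul, bil_hamVec,
    differential_coords he hx, hamCoeff, Finset.sum_mul]

theorem smoothOn_hamCoeff (he : e ∈ IsManifold.maximalAtlas (𝓡 d) ∞ P) {U : Set P} (hU : IsOpen U)
    (hUe : U ⊆ e.source) {X : ∀ x : P, TangentSpace (𝓡 d) x} (hX : IsSmoothField U X) (i : Fin d) :
    SmoothOn d U (fun y => Ω.hamCoeff e y (X y) i) :=
  SmoothOn.sum fun j _ => (SmoothOn.matrix_inv (fun i j => Ω.smoothOn_bracket hU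
    ((smoothOn_coords he i).mono hUe) ((smoothOn_coords he j).mono hUe))
    (fun _ hy => det_constraintMatrix_coords he (hUe hy)) i j).mul
    (hX.of_isOpen hU ((smoothOn_coords he j).mono hUe))

/-- Near each point of `S` there are functions that vanish on `S` and whose Hamiltonian vectors
form along `S` the given frame of sections of `(TS)^Ω`. -/
theorem exists_functions_of_frame {S : Set P} {k n : ℕ} (hS : IsSubmanifold d S k) {x : P}
    (hx : x ∈ S) {U : Set P} (hU : IsOpen U) (hxU : x ∈ U)
    {X : Fin n → ∀ x : P, TangentSpace (𝓡 d) x} (hX : ∀ i, IsSmoothField U (X i))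
    (hXS : ∀ y ∈ S ∩ U, ∀ i, X i y ∈ Ω.orth (tangentAt S y)) :
    ∃ U' ⊆ U, IsOpen U' ∧ x ∈ U' ∧ ∃ χ : Fin n → P → ℝ, (∀ i, SmoothOn d U' (χ i)) ∧
      (∀ y ∈ S ∩ U', ∀ i, χ i y = 0) ∧ ∀ y ∈ S ∩ U', ∀ i, Ω.hamVec (χ i) y = X i y := by
  obtain ⟨e, he, hxe, W, -, hW⟩ := hS x hx
  have hU' : IsOpen (U ∩ e.source) := hU.inter e.open_source
  let pr : EuclideanSpace ℝ (Fin d) →L[ℝ] EuclideanSpace ℝ (Fin d) := Wᗮ.starProjection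
  have hg : ∀ i a, SmoothOn d (U ∩ e.source) (fun y => Ω.hamCoeff e y (X i y) a) := fun i a =>
    smoothOn_hamCoeff he hU' inter_subset_right ((hX i).mono inter_subset_left) a
  let φ : Fin d → EuclideanSpace ℝ (Fin d) →L[ℝ] ℝ := fun a => (EuclideanSpace.proj a).comp pr
  have hφ : ∀ a, SmoothOn d (U ∩ e.source) (fun y => φ a (e y)) := fun a =>
    (smoothOn_chart he (φ a)).mono inter_subset_right
  have hpr : ∀ y ∈ S ∩ (U ∩ e.source), pr (e y) = 0 := fun y hy => by
    have := (hW y hy.2.2).1 hy.1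
    rwa [Submodule.starProjection_apply_eq_zero_iff, Submodule.orthogonal_orthogonal]
  refine ⟨U ∩ e.source, inter_subset_left, hU', ⟨hxU, hxe⟩,
    fun i y => ∑ a, Ω.hamCoeff e y (X i y) a * φ a (e y), fun i => ?_, fun y hy i => ?_,
    fun y hy i => ?_⟩
  · exact SmoothOn.sum fun a _ => (hg i a).mul (hφ a)
  · exact Finset.sum_eq_zero fun a _ => by simp [φ, hpr y hy]
  · refine (Ω.hamVec_unique fun v => ?_).symm
    -- The difference between Ω(X_i, v) and the differential just built is Ω(X_i, u) for the
    -- `W`-part `u` of `v`. It vanishes since `u` is tangent to `S` and X_i ∈ (TS)^Ω.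
    obtain ⟨u, hu⟩ := (chartEquiv he hy.2.2).surjective (chartDeriv e y v - pr (chartDeriv e y v))
    rw [chartEquiv_apply] at hu
    have huS : u ∈ tangentAt S y := by
      rw [mem_tangentAt_iff_of_slice he hy.2.2 hy.1 hW, hu]
      have := Submodule.sub_starProjection_mem_orthogonal (K := Wᗮ) (chartDeriv e y v)
      rwa [Submodule.orthogonal_orthogonal] at this
    have h0 : Ω.bil y (X i y) u = 0 := hXS y ⟨hy.1, hy.2.1⟩ i u huS
    rw [bil_eq_sum_hamCoeff he hy.2.2, hu] at h0
    rw [bil_eq_sum_hamCoeff he hy.2.2, differential_sum fun a _ =>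
      ((hg i a).mul (hφ a)).mdifferentiableAt hU' hy.2]
    have h1 : ∀ a, differential d (fun y => Ω.hamCoeff e y (X i y) a * φ a (e y)) y v =
        Ω.hamCoeff e y (X i y) a * pr (chartDeriv e y v) a := fun a => by
      rw [differential_mul ((hg i a).mdifferentiableAt hU' hy.2)
        ((hφ a).mdifferentiableAt hU' hy.2), differential_chart he hy.2.2]
      simp [φ, hpr y hy]
    simp only [h1]
    simp only [PiLp.sub_apply, mul_sub, Finset.sum_sub_distrib] at h0
    linarith

/-- Second class functions near a point of `S`, adapted to a symplectic subbundle `V` of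
`(TS)^Ω`. -/
theorem exists_functions_of_subbundle {S : Set P} {k n : ℕ} (hS : IsSubmanifold d S k)
    {V : ∀ x : P, Submodule ℝ (TangentSpace (𝓡 d) x)} (hV : IsSubbundleAlong S V)
    (hVS : ∀ x ∈ S, V x ≤ Ω.orth (tangentAt S x)) (hVn : ∀ x ∈ S, Module.finrank ℝ (V x) = n)
    (hVΩ : ∀ x ∈ S, V x ⊓ Ω.orth (V x) = ⊥) {x : P} (hx : x ∈ S) :
    ∃ U, IsOpen U ∧ x ∈ U ∧ ∃ χ : Fin n → P → ℝ, (∀ i, SmoothOn d U (χ i)) ∧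
      (∀ y ∈ U, (Ω.constraintMatrix χ y).det ≠ 0) ∧ (∀ y ∈ S ∩ U, ∀ i, χ i y = 0) ∧
      ∀ y ∈ S ∩ U, constraintKer χ y = Ω.orth (V y) := by
  obtain ⟨U, hU, hxU, m, X, hX, hXV⟩ := hV x hx
  have hmn : m = n := by
    have := finrank_span_eq_card (hXV x ⟨hx, hxU⟩).1
    rwa [← (hXV x ⟨hx, hxU⟩).2, hVn x hx, Fintype.card_fin, eq_comm] at this
  subst hmn
  obtain ⟨U', hU'U, hU', hxU', χ, hχ, hχ0, hχX⟩ := exists_functions_of_frame (Ω := Ω) hS hx hU hxU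
    (fun i => IsSmoothField.of_contMDiffOn (hX i)) fun y hy i => hVS y hy.1 (by
      rw [(hXV y hy).2]; exact Submodule.subset_span ⟨i, rfl⟩)
  have hspan : ∀ y ∈ S ∩ U', Submodule.span ℝ (range fun i => Ω.hamVec (χ i) y) = V y :=
    fun y hy => by
      rw [(hXV y ⟨hy.1, hU'U hy.2⟩).2]
      simp only [hχX y hy]
  have hdet : SmoothOn d U' (fun y => (Ω.constraintMatrix χ y).det) :=
    SmoothOn.det fun i j => Ω.smoothOn_bracket hU' (hχ i) (hχ j)
  -- At `x` the bracket matrix is the Gram matrix of a frame of the symplectic space `V x`;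
  -- invertibility persists nearby.
  refine ⟨{y ∈ U' | (Ω.constraintMatrix χ y).det ≠ 0}, hdet.isOpen_ne_zero hU', ⟨hxU', ?_⟩, χ,
    fun i => (hχ i).mono (sep_subset _ _), fun y hy => hy.2,
    fun y hy => hχ0 y ⟨hy.1, hy.2.1⟩, fun y hy => ?_⟩
  · refine det_gram_ne_zero (Ω := Ω) (f := fun i => Ω.hamVec (χ i) x) ?_ ?_
    · simp only [hχX x ⟨hx, hxU'⟩]
      exact (hXV x ⟨hx, hxU⟩).1
    · rw [hspan x ⟨hx, hxU'⟩]
      exact hVΩ x hx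
  · rw [constraintKer_eq_orth, hspan y ⟨hy.1, hy.2.1⟩]

end SymplecticForm

end

section

variable {d : ℕ} {P : Type*} [TopologicalSpace P] [ChartedSpace (EuclideanSpace ℝ (Fin d)) P]

/-! ### Cutoffs of vector fields, and Euler fields of constraint systems -/

theorem HasLinearPart.congr {X Y : ∀ x : P, TangentSpace (𝓡 d) x} {x : P}
    {L : TangentSpace (𝓡 d) x →ₗ[ℝ] TangentSpace (𝓡 d) x} (hX : HasLinearPart X x L) {U : Set P}
    (hU : IsOpen U) (hx : x ∈ U) (h : ∀ y ∈ U, Y y = X y) : HasLinearPart Y x L := by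
  refine ⟨by rw [h x hx, hX.1], fun U' f hU' hx' hf => ?_⟩
  obtain ⟨h1, h2⟩ := hX.2 U' f hU' hx' hf
  have h3 : (fun y => differential d f y (Y y)) =ᶠ[nhds x] fun y => differential d f y (X y) :=
    Filter.eventuallyEq_of_mem (hU.mem_nhds hx) fun y hy => congrArg (differential d f y) (h y hy)
  exact ⟨h1.congr_of_eventuallyEq h3, fun v => by rw [differential_congr h3, h2]⟩

/-- Cutting off a vector field that is smooth on a neighborhood of the support of `b`. -/
theorem IsSmoothField.cutoff {b : P → ℝ} {U G : Set P} (hb : SmoothOn d univ b) (hU : IsOpen U)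
    (hG : IsOpen G) (hbU : tsupport b ⊆ U) {X : ∀ x : P, TangentSpace (𝓡 d) x}
    (hX : IsSmoothField (U ∩ G) X) : IsSmoothField G (fun y => b y • X y) := by
  refine IsSmoothField.of_locally fun x hx => ?_
  by_cases hxb : x ∈ tsupport b
  · exact ⟨U ∩ G, hU.inter hG, ⟨hbU hxb, hx⟩, IsSmoothField.smul (hb.mono (subset_univ _)) hX⟩
  · refine ⟨(tsupport b)ᶜ, (isClosed_tsupport b).isOpen_compl, hxb,
      IsSmoothField.zero.congr fun y hy => ?_⟩
    rw [image_eq_zero_of_notMem_tsupport hy, zero_smul]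

/-- Off the support of `b` the product vanishes near `x`, in agreement with b x = 0; so `L` needs a
meaning only for `x` in `U`. -/
theorem HasLinearPart.cutoff {b : P → ℝ} {U : Set P} (hb : SmoothOn d univ b)
    (hbU : tsupport b ⊆ U) {X : ∀ x : P, TangentSpace (𝓡 d) x} {x : P}
    {L : TangentSpace (𝓡 d) x →ₗ[ℝ] TangentSpace (𝓡 d) x} (hX : x ∈ U → HasLinearPart X x L) :
    HasLinearPart (fun y => b y • X y) x (b x • L) := by
  by_cases hxb : x ∈ tsupport b
  · exact HasLinearPart.smul isOpen_univ (mem_univ x) hb (hX (hbU hxb))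
  · rw [image_eq_zero_of_notMem_tsupport hxb, zero_smul]
    refine HasLinearPart.zero.congr (isClosed_tsupport b).isOpen_compl hxb fun y hy => ?_
    rw [image_eq_zero_of_notMem_tsupport hy, zero_smul]

namespace SymplecticForm

variable {Ω : SymplecticForm d P} {n : ℕ}

/-- A vector field that vanishes where the constraints do, with linear part there the projection
onto the span of their Hamiltonian vectors. -/
def eulerField (Ω : SymplecticForm d P) (χ : Fin n → P → ℝ) (y : P) : TangentSpace (𝓡 d) y :=
  ∑ i, ∑ j, ((Ω.constraintMatrix χ y)⁻¹ i j * χ j y) • Ω.hamVec (χ i) y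

section Euler

variable [IsManifold (𝓡 d) ∞ P] {χ : Fin n → P → ℝ} {U : Set P}

theorem isSmoothField_eulerField (hU : IsOpen U) (hχ : ∀ i, SmoothOn d U (χ i))
    (h : ∀ y ∈ U, (Ω.constraintMatrix χ y).det ≠ 0) : IsSmoothField U (Ω.eulerField χ) :=
  IsSmoothField.sum fun i _ => IsSmoothField.sum fun j _ => IsSmoothField.smul
    ((SmoothOn.matrix_inv (fun i j => Ω.smoothOn_bracket hU (hχ i) (hχ j)) h i j).mul (hχ j))
    (Ω.isSmoothField_hamVec hU (hχ i))

/-- At a common zero of the constraints, the coefficient c^{ij} χ_j has differential c^{ij} dχ_j. -/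
theorem hasLinearPart_eulerField (hU : IsOpen U) (hχ : ∀ i, SmoothOn d U (χ i))
    (h : ∀ y ∈ U, (Ω.constraintMatrix χ y).det ≠ 0) {x : P} (hx : x ∈ U) (h0 : ∀ i, χ i x = 0) :
    HasLinearPart (Ω.eulerField χ) x (Ω.constraintProj χ x) := by
  refine HasLinearPart.sum fun i _ => HasLinearPart.sum fun j _ => ?_
  have hc := (SmoothOn.matrix_inv (fun i j => Ω.smoothOn_bracket hU (hχ i) (hχ j)) h
    i j).mdifferentiableAt hU hx
  have hj := (hχ j).mdifferentiableAt hU hx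
  have h1 := HasLinearPart.smul_of_eq_zero hU hx (hc.mul hj) (by simp [h0])
    (Ω.isSmoothField_hamVec hU (hχ i))
  have h2 : (Ω.constraintMatrix χ x)⁻¹ i j •
      (differential d (χ j) x).toLinearMap.smulRight (Ω.hamVec (χ i) x) =
      (differential d ((fun y => (Ω.constraintMatrix χ y)⁻¹ i j) * χ j)
        x).toLinearMap.smulRight (Ω.hamVec (χ i) x) := by
    ext v : 1
    change (Ω.constraintMatrix χ x)⁻¹ i j • differential d (χ j) x v • Ω.hamVec (χ i) x =
      differential d _ x v • _
    rw [smul_smul]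
    congr 1
    have := differential_mul hc hj v
    rw [h0, zero_mul, add_zero] at this
    exact this.symm
  rw [h2]
  exact h1

end Euler

/-! ### Gluing local second class functions -/

/-- Second class functions with common kernel `K` along `S`, defined on the members of an open
cover of `S`, with cutoff functions. -/
structure AdaptedCover (Ω : SymplecticForm d P) (S : Set P)
    (K : ∀ x : P, Submodule ℝ (TangentSpace (𝓡 d) x)) (n : ℕ) where
  U : ℕ → Set P
  O : ℕ → Set P
  χ : ℕ → Fin n → P → ℝ
  b : ℕ → P → ℝ
  isOpen_U : ∀ m, IsOpen (U m)
  isOpen_O : ∀ m, IsOpen (O m)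
  smooth_χ : ∀ m i, SmoothOn d (U m) (χ m i)
  det_ne_zero : ∀ m, ∀ y ∈ U m, (Ω.constraintMatrix (χ m) y).det ≠ 0
  χ_eq_zero : ∀ m, ∀ y ∈ S ∩ U m, ∀ i, χ m i y = 0
  ker_eq : ∀ m, ∀ y ∈ S ∩ U m, constraintKer (χ m) y = K y
  smooth_b : ∀ m, SmoothOn d univ (b m)
  tsupport_b : ∀ m, tsupport (b m) ⊆ U m
  b_eq_one : ∀ m, ∀ y ∈ O m, b m y = 1
  cover : S ⊆ ⋃ m, O m

/-- Bump functions equal to 1 near each point provide the cutoffs, and second countability leaves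
countably many. Local finiteness is not needed, since only finitely many indices enter each equation
of the glued set. -/
theorem exists_adaptedCover [T2Space P] [SecondCountableTopology P] [IsManifold (𝓡 d) ∞ P]
    {S : Set P} (hS : S.Nonempty) {K : ∀ x : P, Submodule ℝ (TangentSpace (𝓡 d) x)}
    (h : ∀ x ∈ S, ∃ U, IsOpen U ∧ x ∈ U ∧ ∃ χ : Fin n → P → ℝ, (∀ i, SmoothOn d U (χ i)) ∧
      (∀ y ∈ U, (Ω.constraintMatrix χ y).det ≠ 0) ∧ (∀ y ∈ S ∩ U, ∀ i, χ i y = 0) ∧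
      ∀ y ∈ S ∩ U, constraintKer χ y = K y) : Nonempty (AdaptedCover Ω S K n) := by
  choose! U hU hxU χ hχ hdet h0 hK using h
  have hb : ∀ x ∈ S, ∃ f : SmoothBumpFunction (𝓡 d) x, tsupport f ⊆ U x := fun x hx => by
    obtain ⟨f, -, hf⟩ := (SmoothBumpFunction.nhds_basis_tsupport (I := 𝓡 d) x).mem_iff.1
      ((hU x hx).mem_nhds (hxU x hx))
    exact ⟨f, hf⟩
  have hb' : ∀ x ∈ S, ∃ (b : P → ℝ) (O : Set P), SmoothOn d univ b ∧ tsupport b ⊆ U x ∧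
      IsOpen O ∧ x ∈ O ∧ ∀ y ∈ O, b y = 1 := fun x hx => by
    obtain ⟨f, hf⟩ := hb x hx
    obtain ⟨O, hO, hO', hxO⟩ := eventually_nhds_iff.1 f.eventuallyEq_one
    exact ⟨f, O, f.contMDiff.contMDiffOn, hf, hO', hxO, hO⟩
  choose! b O hbs hbU hO hxO hbO using hb'
  obtain ⟨t, htS, htc, hcov⟩ := TopologicalSpace.countable_cover_nhdsWithin (f := O) (s := S)
    fun x hx => mem_nhdsWithin_of_mem_nhds ((hO x hx).mem_nhds (hxO x hx))
  have htn : t.Nonempty := by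
    obtain ⟨x, hx⟩ := hS
    obtain ⟨y, hy, -⟩ := mem_iUnion₂.1 (hcov hx)
    exact ⟨y, hy⟩
  obtain ⟨p, rfl⟩ := htc.exists_eq_range htn
  have hp : ∀ m, p m ∈ S := fun m => htS ⟨m, rfl⟩
  exact ⟨{
    U := fun m => U (p m)
    O := fun m => O (p m)
    χ := fun m => χ (p m)
    b := fun m => b (p m)
    isOpen_U := fun m => hU _ (hp m)
    isOpen_O := fun m => hO _ (hp m)
    smooth_χ := fun m => hχ _ (hp m)
    det_ne_zero := fun m => hdet _ (hp m)
    χ_eq_zero := fun m => h0 _ (hp m)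
    ker_eq := fun m => hK _ (hp m)
    smooth_b := fun m => hbs _ (hp m)
    tsupport_b := fun m => hbU _ (hp m)
    b_eq_one := fun m => hbO _ (hp m)
    cover := by simpa using hcov }⟩

namespace AdaptedCover

variable {S : Set P} {K : ∀ x : P, Submodule ℝ (TangentSpace (𝓡 d) x)} (c : AdaptedCover Ω S K n)

/-- Composition of the cut off projections onto the spans of the Hamiltonian vectors. -/
def proj : ℕ → ∀ y : P, TangentSpace (𝓡 d) y →ₗ[ℝ] TangentSpace (𝓡 d) y
  | 0, _ => LinearMap.id
  | m + 1, y => (LinearMap.id - c.b m y • (LinearMap.id - Ω.constraintProj (c.χ m) y)) ∘ₗ proj m y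

/-- The Euler fields of the local constraints, glued together. -/
def euler (m : ℕ) (y : P) : TangentSpace (𝓡 d) y :=
  ∑ r ∈ Finset.range m,
    c.b r y • ((∏ j ∈ Finset.range r, (1 - c.b j y)) • Ω.eulerField (c.χ r) y)

/-- Local defining functions of the glued submanifold. -/
def fn (m : ℕ) (i : Fin n) (y : P) : ℝ :=
  differential d (c.χ m i) y (c.proj m y (c.euler (m + 1) y))

/-- The matrix that tests whether the differentials of the constraints, composed with the
projections, are independent. -/
def testMatrix (m : ℕ) (y : P) : Matrix (Fin n) (Fin n) ℝ :=
  Matrix.of fun i j => differential d (c.χ m i) y (c.proj m y (Ω.hamVec (c.χ m j) y))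

/-- The open set on which `fn m` are good second class functions. -/
def good (m : ℕ) : Set P :=
  {y ∈ c.O m | (c.testMatrix m y).det ≠ 0 ∧ (Ω.constraintMatrix (c.fn m) y).det ≠ 0}

/-- The glued submanifold. -/
def glued : Set P := {y | ∃ m, y ∈ c.good m ∧ ∀ i, c.fn m i y = 0}

variable {c}

theorem mem_U_of_b_ne_zero {m : ℕ} {y : P} (h : c.b m y ≠ 0) : y ∈ c.U m :=
  c.tsupport_b m (subset_tsupport _ h)

theorem O_subset_U (m : ℕ) : c.O m ⊆ c.U m := fun y hy =>
  mem_U_of_b_ne_zero (by rw [c.b_eq_one m y hy]; exact one_ne_zero)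

theorem proj_succ_apply (m : ℕ) (y : P) (v : TangentSpace (𝓡 d) y) :
    c.proj (m + 1) y v = c.proj m y v -
      c.b m y • (c.proj m y v - Ω.constraintProj (c.χ m) y (c.proj m y v)) := rfl

theorem constraintProj_eq {m m' : ℕ} {x : P} (hx : x ∈ S) (hm : x ∈ c.U m) (hm' : x ∈ c.U m')
    (v : TangentSpace (𝓡 d) x) :
    Ω.constraintProj (c.χ m) x v = Ω.constraintProj (c.χ m') x v :=
  constraintProj_congr (c.det_ne_zero m x hm) (c.det_ne_zero m' x hm')
    (by rw [c.ker_eq m x ⟨hx, hm⟩, c.ker_eq m' x ⟨hx, hm'⟩]) v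

/-- Along `S` the projections fix the span of the Hamiltonian vectors of the constraints. -/
theorem proj_constraintProj {m m' : ℕ} {x : P} (hx : x ∈ S) (hm : x ∈ c.U m)
    (v : TangentSpace (𝓡 d) x) :
    c.proj m' x (Ω.constraintProj (c.χ m) x v) = Ω.constraintProj (c.χ m) x v := by
  induction m' with
  | zero => rfl
  | succ r ih =>
    rw [proj_succ_apply, ih]
    by_cases hb : c.b r x = 0
    · rw [hb, zero_smul, sub_zero]
    · rw [constraintProj_eq hx (mem_U_of_b_ne_zero hb) hm,
        constraintProj_eq_self (c.det_ne_zero m x hm) (constraintProj_mem_orth v), sub_self,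
        smul_zero, sub_zero]

theorem proj_eq_zero_of_le {m m' : ℕ} (h : m ≤ m') {y : P} {v : TangentSpace (𝓡 d) y}
    (hv : c.proj m y v = 0) : c.proj m' y v = 0 := by
  induction m', h using Nat.le_induction with
  | base => exact hv
  | succ r _ ih => simp [proj_succ_apply, ih]

/-- On `O m` every later weight contains the factor 1 - b_m = 0. -/
theorem euler_eq_of_le {m m' : ℕ} (h : m ≤ m') {y : P} (hy : y ∈ c.O m) :
    c.euler (m' + 1) y = c.euler (m + 1) y := by
  induction m', h using Nat.le_induction with
  | base => rfl
  | succ r hr ih =>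
    rw [← ih, euler, Finset.sum_range_succ, Finset.prod_eq_zero (i := m)
      (Finset.mem_range.2 (by omega)) (by rw [c.b_eq_one m y hy, sub_self]), zero_smul, smul_zero,
      add_zero]
    rfl

section

variable (m : ℕ) (y : P)

/-- The differentials of the constraints, composed with the projections. -/
def test : TangentSpace (𝓡 d) y →ₗ[ℝ] (Fin n → ℝ) :=
  LinearMap.pi fun i => (differential d (c.χ m i) y).toLinearMap ∘ₗ c.proj m y

variable {m y}

theorem test_apply (v : TangentSpace (𝓡 d) y) (i : Fin n) :
    c.test m y v i = differential d (c.χ m i) y (c.proj m y v) := rfl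

theorem finrank_ker_test (hy : y ∈ c.good m) :
    n + Module.finrank ℝ (LinearMap.ker (c.test m y)) = d := by
  have hsurj : Function.Surjective (c.test m y) := by
    intro a
    refine ⟨∑ j, ((c.testMatrix m y)⁻¹.mulVec a) j • Ω.hamVec (c.χ m j) y, ?_⟩
    have h1 : (c.testMatrix m y).mulVec ((c.testMatrix m y)⁻¹.mulVec a) = a := by
      rw [Matrix.mulVec_mulVec, Matrix.mul_nonsing_inv _ (isUnit_iff_ne_zero.2 hy.2.1),
        Matrix.one_mulVec]
    funext i
    conv_rhs => rw [← h1]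
    simp only [test_apply, map_sum, map_smul, smul_eq_mul]
    rw [Matrix.mulVec, dotProduct]
    exact Finset.sum_congr rfl fun j _ => mul_comm _ _
  have := LinearMap.finrank_range_add_finrank_ker (c.test m y)
  rwa [LinearMap.range_eq_top.2 hsurj, finrank_top, Module.finrank_fin_fun,
    finrank_tangentSpace] at this

/-- The heart of the gluing. Full rank on the good sets gives both kernels dimension `d - n`, so a
single inclusion suffices. -/
theorem ker_test_eq {m' : ℕ} (h : m ≤ m') (hy : y ∈ c.good m) (hy' : y ∈ c.good m') :
    LinearMap.ker (c.test m y) = LinearMap.ker (c.test m' y) := by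
  obtain rfl | hlt := h.eq_or_lt
  · rfl
  refine Submodule.eq_of_le_of_finrank_eq (fun v hv => ?_) ?_
  · have h1 : c.proj m y v ∈ constraintKer (c.χ m) y :=
      mem_constraintKer.2 fun i => congrFun (LinearMap.mem_ker.1 hv) i
    -- Since b_m = 1 on `O m`, the factor with index `m` is the projection itself and kills the
    -- common kernel of the dχ_m; all later composites inherit the zero.
    have h2 : c.proj (m + 1) y v = 0 := by
      rw [proj_succ_apply, c.b_eq_one m y hy.1, one_smul,
        Ω.constraintProj_of_mem_ker _ _ h1, sub_zero, sub_self]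
    rw [LinearMap.mem_ker]
    funext i
    rw [test_apply, proj_eq_zero_of_le hlt h2, map_zero]
    rfl
  · have h1 := finrank_ker_test hy
    have h2 := finrank_ker_test hy'
    omega

theorem fn_eq_zero_iff :
    (∀ i, c.fn m i y = 0) ↔ c.euler (m + 1) y ∈ LinearMap.ker (c.test m y) := by
  rw [LinearMap.mem_ker, funext_iff]
  rfl

/-- On overlaps of good sets the equations agree: membership of the same vector in the same kernel.
-/
theorem mem_glued_iff (hy : y ∈ c.good m) : y ∈ c.glued ↔ ∀ i, c.fn m i y = 0 := by
  refine ⟨?_, fun h => ⟨m, hy, h⟩⟩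
  rintro ⟨m', hy', h⟩
  rw [fn_eq_zero_iff] at h ⊢
  obtain hle | hle := le_total m m'
  · rwa [ker_test_eq hle hy hy', ← euler_eq_of_le hle hy.1]
  · rwa [← ker_test_eq hle hy' hy, euler_eq_of_le hle hy'.1]

end

variable [IsManifold (𝓡 d) ∞ P]

theorem isSmoothField_proj {G : Set P} (hG : IsOpen G) {X : ∀ x : P, TangentSpace (𝓡 d) x}
    (hX : IsSmoothField G X) (m : ℕ) : IsSmoothField G (fun y => c.proj m y (X y)) := by
  induction m with
  | zero => exact hX
  | succ r ih =>
    simp only [proj_succ_apply]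
    refine ih.sub (IsSmoothField.cutoff (c.smooth_b r) (c.isOpen_U r) hG (c.tsupport_b r) ?_)
    exact (ih.mono inter_subset_right).sub (isSmoothField_constraintProj
      ((c.isOpen_U r).inter hG) (fun i => (c.smooth_χ r i).mono inter_subset_left)
      (fun y hy => c.det_ne_zero r y hy.1) (ih.mono inter_subset_right))

theorem smoothOn_prod (r : ℕ) :
    SmoothOn d univ (fun y => ∏ j ∈ Finset.range r, (1 - c.b j y)) :=
  SmoothOn.prod fun j _ => (smoothOn_const 1).sub (c.smooth_b j)

theorem isSmoothField_euler (m : ℕ) : IsSmoothField univ (c.euler m) :=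
  IsSmoothField.sum fun r _ => IsSmoothField.cutoff (c.smooth_b r) (c.isOpen_U r) isOpen_univ
    (c.tsupport_b r) (IsSmoothField.smul ((smoothOn_prod r).mono (subset_univ _))
      ((isSmoothField_eulerField (c.isOpen_U r) (c.smooth_χ r) (c.det_ne_zero r)).mono
        inter_subset_left))

/-- The weights b_r ∏_{j<r} (1 - b_j) telescope to 1 - ∏ (1 - b_j), and at a point of `S` all the
projections that occur are equal. -/
theorem hasLinearPart_euler {m : ℕ} {x : P} (hx : x ∈ S) (hxU : x ∈ c.U m) (m' : ℕ) :
    HasLinearPart (c.euler m') x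
      ((1 - ∏ j ∈ Finset.range m', (1 - c.b j x)) • Ω.constraintProj (c.χ m) x) := by
  have h0 : ∀ q : ℕ, ∑ r ∈ Finset.range q, c.b r x * ∏ j ∈ Finset.range r, (1 - c.b j x) =
      1 - ∏ j ∈ Finset.range q, (1 - c.b j x) := fun q => by
    induction q with
    | zero => simp
    | succ r ih =>
      rw [Finset.sum_range_succ, ih, Finset.prod_range_succ]
      ring
  have h1 := HasLinearPart.sum (s := Finset.range m') fun r _ =>
    HasLinearPart.cutoff (x := x) (L := (∏ j ∈ Finset.range r, (1 - c.b j x)) •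
      Ω.constraintProj (c.χ m) x) (X := fun y => (∏ j ∈ Finset.range r, (1 - c.b j y)) •
      Ω.eulerField (c.χ r) y) (c.smooth_b r) (c.tsupport_b r) (fun hxr => by
      refine HasLinearPart.smul isOpen_univ (mem_univ x) (smoothOn_prod r) ?_
      rw [show Ω.constraintProj (c.χ m) x = Ω.constraintProj (c.χ r) x from
        LinearMap.ext fun v => constraintProj_eq hx hxU hxr v]
      exact hasLinearPart_eulerField (c.isOpen_U r) (c.smooth_χ r) (c.det_ne_zero r) hxr
        (c.χ_eq_zero r x ⟨hx, hxr⟩))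
  rw [← h0, Finset.sum_smul]
  simp only [mul_smul]
  exact h1

/-- At a point of `S` each factor changes the linear part by a multiple of Q - Q_r Q, which is zero
because Q_r = Q is idempotent. -/
theorem hasLinearPart_proj {m : ℕ} {x : P} (hx : x ∈ S) (hxU : x ∈ c.U m)
    {X : ∀ x : P, TangentSpace (𝓡 d) x} (hX : HasLinearPart X x (Ω.constraintProj (c.χ m) x))
    (m' : ℕ) :
    HasLinearPart (fun y => c.proj m' y (X y)) x (Ω.constraintProj (c.χ m) x) := by
  induction m' with
  | zero => exact hX
  | succ r ih =>
    simp only [proj_succ_apply]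
    have h1 := ih.sub (HasLinearPart.cutoff (L := 0)
      (X := fun y => c.proj r y (X y) - Ω.constraintProj (c.χ r) y (c.proj r y (X y)))
      (c.smooth_b r) (c.tsupport_b r) fun hxr => ?_)
    · rwa [smul_zero, sub_zero] at h1
    · have h2 := ih.sub (hasLinearPart_constraintProj (c.isOpen_U r) (c.smooth_χ r)
        (c.det_ne_zero r) hxr ih)
      convert h2 using 1
      ext v : 1
      rw [LinearMap.sub_apply, LinearMap.comp_apply, constraintProj_eq hx hxr hxU,
        constraintProj_eq_self (c.det_ne_zero m x hxU) (constraintProj_mem_orth v), sub_self]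
      rfl

theorem smoothOn_fn (m : ℕ) (i : Fin n) : SmoothOn d (c.U m) (c.fn m i) :=
  (isSmoothField_proj (c.isOpen_U m) ((isSmoothField_euler (m + 1)).mono (subset_univ _))
    m).of_isOpen (c.isOpen_U m) (c.smooth_χ m i)

theorem hasLinearPart_proj_euler {m : ℕ} {x : P} (hx : x ∈ S) (hxO : x ∈ c.O m) :
    HasLinearPart (fun y => c.proj m y (c.euler (m + 1) y)) x (Ω.constraintProj (c.χ m) x) := by
  refine hasLinearPart_proj hx (O_subset_U m hxO) ?_ m
  have := hasLinearPart_euler hx (O_subset_U m hxO) (m + 1)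
  rwa [Finset.prod_eq_zero (Finset.mem_range.2 (Nat.lt_succ_self m))
    (by rw [c.b_eq_one m x hxO, sub_self]), sub_zero, one_smul] at this

theorem fn_eq_zero {m : ℕ} {x : P} (hx : x ∈ S) (hxO : x ∈ c.O m) (i : Fin n) :
    c.fn m i x = 0 := by
  rw [fn, show c.proj m x (c.euler (m + 1) x) = 0 from
    (hasLinearPart_proj_euler hx hxO).1, map_zero]

/-- On S ∩ O m the glued field has linear part Q, and dχ ∘ Q = dχ. So gluing changes the constraints
only beyond first order along `S`. -/
theorem differential_fn {m : ℕ} {x : P} (hx : x ∈ S) (hxO : x ∈ c.O m) (i : Fin n)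
    (v : TangentSpace (𝓡 d) x) :
    differential d (c.fn m i) x v = differential d (c.χ m i) x v := by
  have := ((hasLinearPart_proj_euler hx hxO).2 (c.U m) (c.χ m i) (c.isOpen_U m)
    (O_subset_U m hxO) (c.smooth_χ m i)).2 v
  rw [Ω.differential_constraintProj (c.det_ne_zero m x (O_subset_U m hxO))] at this
  exact this

theorem isOpen_good (m : ℕ) : IsOpen (c.good m) := by
  have hO := c.isOpen_O m
  have hOU := O_subset_U (c := c) m
  have h1 : SmoothOn d (c.O m) (fun y => (c.testMatrix m y).det) := SmoothOn.det fun i j =>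
    (isSmoothField_proj hO (Ω.isSmoothField_hamVec hO ((c.smooth_χ m j).mono hOU)) m).of_isOpen hO
      ((c.smooth_χ m i).mono hOU)
  have h2 : SmoothOn d (c.O m) (fun y => (Ω.constraintMatrix (c.fn m) y).det) :=
    SmoothOn.det fun i j => Ω.smoothOn_bracket hO ((smoothOn_fn m i).mono hOU)
      ((smoothOn_fn m j).mono hOU)
  have := (h1.isOpen_ne_zero hO).inter (h2.isOpen_ne_zero hO)
  convert this using 1
  ext y
  simp only [good, mem_ofPred_eq, mem_inter_iff]
  tauto

theorem good_subset_U (m : ℕ) : c.good m ⊆ c.U m := fun _ hy => O_subset_U m hy.1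

/-- At points of `S` both test determinants equal that of the original brackets: the composites fix
the Hamiltonian vectors, and the differentials are unchanged. -/
theorem mem_good {m : ℕ} {x : P} (hx : x ∈ S) (hxO : x ∈ c.O m) : x ∈ c.good m := by
  have hxU := O_subset_U m hxO
  have hdet := c.det_ne_zero m x hxU
  refine ⟨hxO, ?_, ?_⟩
  · have : c.testMatrix m x = Ω.constraintMatrix (c.χ m) x := by
      ext i j
      have h1 : Ω.hamVec (c.χ m j) x ∈ Ω.orth (constraintKer (c.χ m) x) := by
        rw [constraintKer_eq_orth, orth_orth]
        exact Submodule.subset_span ⟨j, rfl⟩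
      have h2 := proj_constraintProj (m' := m) hx hxU (Ω.hamVec (c.χ m j) x)
      rw [constraintProj_eq_self hdet h1] at h2
      rw [testMatrix, Matrix.of_apply, h2, constraintMatrix_apply]
    rwa [this]
  · have : Ω.constraintMatrix (c.fn m) x = Ω.constraintMatrix (c.χ m) x := by
      ext i j
      rw [constraintMatrix_apply, constraintMatrix_apply, differential_fn hx hxO]
      congr 1
      exact Ω.hamVec_unique fun w => by rw [bil_hamVec, differential_fn hx hxO]
    rwa [this]

theorem isSecondClassEquations_fn (m : ℕ) :
    Ω.IsSecondClassEquations c.glued (c.good m) (c.fn m) where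
  isOpen := isOpen_good m
  smooth i := (smoothOn_fn m i).mono (good_subset_U m)
  eq_zero_locus := by
    ext y
    refine ⟨fun hy => ⟨hy.2, (mem_glued_iff hy.2).1 hy.1⟩,
      fun hy => ⟨(mem_glued_iff hy.1).2 hy.2, hy.1⟩⟩
  det_ne_zero y hy := hy.2.2

/-- The glued set is a symplectic submanifold containing `S`, with tangent spaces `K` along `S`. -/
theorem isSecondClassSubmanifold_glued {V : ∀ x : P, Submodule ℝ (TangentSpace (𝓡 d) x)} {q : ℕ}
    (hq : n + q = d) (hK : ∀ x ∈ S, K x = Ω.orth (V x)) :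
    Ω.IsSecondClassSubmanifold S V q c.glued := by
  have hsub : IsSubmanifold d c.glued q := isSubmanifold_of_secondClassEquations (Ω := Ω) hq
    fun x hx => by
      obtain ⟨m, hm, -⟩ := hx
      exact ⟨c.good m, c.fn m, hm, isSecondClassEquations_fn m⟩
  have hS : ∀ x ∈ S, ∃ m, x ∈ c.O m := fun x hx => mem_iUnion.1 (c.cover hx)
  have hSN : S ⊆ c.glued := fun x hx => by
    obtain ⟨m, hm⟩ := hS x hx
    exact ⟨m, mem_good hx hm, fn_eq_zero hx hm⟩
  refine ⟨hsub, fun x hx => ?_, hSN, fun x hx => ?_⟩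
  · obtain ⟨m, hm, h0⟩ := hx
    rw [(isSecondClassEquations_fn m).tangentAt_eq hsub hq ⟨⟨m, hm, h0⟩, hm⟩]
    exact Ω.ker_constraintKer hm.2.2
  · obtain ⟨m, hm⟩ := hS x hx
    have hg := mem_good hx hm
    rw [(isSecondClassEquations_fn m).tangentAt_eq hsub hq ⟨hSN hx, hg⟩, ← hK x hx,
      ← c.ker_eq m x ⟨hx, O_subset_U m hm⟩]
    ext v
    simp only [mem_constraintKer, differential_fn hx hm]

end AdaptedCover

end SymplecticForm

end

section

variable {d : ℕ} {P : Type*} [TopologicalSpace P] [ChartedSpace (EuclideanSpace ℝ (Fin d)) P]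

namespace SymplecticForm

variable {Ω : SymplecticForm d P} {n : ℕ} {N U : Set P} {χ : Fin n → P → ℝ}

variable [IsManifold (𝓡 d) ∞ P]

theorem IsSecondClassEquations.mono (h : Ω.IsSecondClassEquations N U χ) {U' : Set P}
    (hU' : IsOpen U') (hU'U : U' ⊆ U) : Ω.IsSecondClassEquations N U' χ where
  isOpen := hU'
  smooth i := (h.smooth i).mono hU'U
  eq_zero_locus := by
    ext y
    constructor
    · exact fun hy => ⟨hy.2, h.eq_zero y ⟨hy.1, hU'U hy.2⟩⟩
    · exact fun hy => ⟨(h.mem_iff (hU'U hy.1)).2 hy.2, hy.1⟩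
  det_ne_zero y hy := h.det_ne_zero y (hU'U hy)

/-! ### Local equations of symplectic submanifolds -/

/-- Linear functionals cutting out a subspace. -/
theorem exists_orthonormal_equations {q m : ℕ} (W : Submodule ℝ (EuclideanSpace ℝ (Fin d)))
    (hW : Module.finrank ℝ W = q) (hmq : m + q = d) :
    ∃ b : Fin m → EuclideanSpace ℝ (Fin d), Orthonormal ℝ b ∧
      ∀ z, z ∈ W ↔ ∀ i, innerSL ℝ (b i) z = 0 := by
  have h1 : Module.finrank ℝ Wᗮ = m := by
    have := W.finrank_add_finrank_orthogonal
    rw [finrank_euclideanSpace_fin] at this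
    omega
  let b := (stdOrthonormalBasis ℝ Wᗮ).reindex (finCongr h1)
  refine ⟨fun i => b i, ?_, fun z => ⟨fun hz i => ?_, fun h => ?_⟩⟩
  · exact b.orthonormal.comp_linearIsometry Wᗮ.subtypeₗᵢ
  · rw [innerSL_apply_apply, real_inner_comm]
    exact (Submodule.mem_orthogonal _ _).1 (b i).2 z hz
  · rw [← W.orthogonal_orthogonal, Submodule.mem_orthogonal]
    intro u hu
    have h2 : (⟨u, hu⟩ : Wᗮ) ∈ Submodule.span ℝ (range b) := by
      rw [← b.coe_toBasis, b.toBasis.span_eq]; trivial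
    have h3 : Submodule.span ℝ (range b) ≤
        LinearMap.ker ((innerSL ℝ z).toLinearMap ∘ₗ Wᗮ.subtype) := by
      rw [Submodule.span_le]
      rintro _ ⟨i, rfl⟩
      have := h i
      rw [innerSL_apply_apply, real_inner_comm] at this
      exact this
    have h4 := h3 h2
    rw [real_inner_comm]
    exact h4

/-- The matrix of brackets of independent functions defining a symplectic submanifold is
invertible. -/
theorem det_constraintMatrix_ne_zero {x : P} (hker : Ω.ker (constraintKer χ x) = ⊥)
    (hind : ∀ a : Fin n → ℝ, (∀ v, ∑ i, a i * differential d (χ i) x v = 0) → a = 0) :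
    (Ω.constraintMatrix χ x).det ≠ 0 := by
  refine det_gram_ne_zero (Ω := Ω) (f := fun i => Ω.hamVec (χ i) x) ?_ ?_
  · rw [Fintype.linearIndependent_iff]
    intro a ha
    refine fun i => congrFun (hind a fun v => ?_) i
    have := congrArg (fun u => Ω.bil x u v) ha
    simpa [bil_hamVec] using this
  · rw [constraintKer_eq_orth (Ω := Ω)] at hker
    rw [← hker, ker, orth_orth, inf_comm]

/-- Symplectic submanifolds have local second class equations with connected zero set. -/
theorem exists_secondClassEquations {q m : ℕ} (hmq : m + q = d) (hN : IsSubmanifold d N q) {x : P}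
    (hx : x ∈ N) (hker : Ω.ker (tangentAt (d := d) N x) = ⊥) :
    ∃ (U : Set P) (χ : Fin m → P → ℝ), x ∈ U ∧ Ω.IsSecondClassEquations N U χ ∧
      IsConnected (N ∩ U) := by
  obtain ⟨e, he, hxe, W, hWq, hW⟩ := hN x hx
  obtain ⟨b, hb, hbW⟩ := exists_orthonormal_equations W hWq hmq
  let χ : Fin m → P → ℝ := fun i y => innerSL ℝ (b i) (e y)
  have hχ : ∀ i, SmoothOn d e.source (χ i) := fun i => smoothOn_chart he _
  have hdχ : ∀ i v, differential d (χ i) x v = innerSL ℝ (b i) (chartDeriv e x v) := fun i v =>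
    differential_chart he hxe _ v
  have hK : constraintKer (d := d) χ x = tangentAt N x := by
    ext v
    rw [mem_constraintKer, mem_tangentAt_iff_of_slice he hxe hx hW, hbW]
    simp only [hdχ]
  have hdet : (Ω.constraintMatrix χ x).det ≠ 0 := by
    refine det_constraintMatrix_ne_zero (by rw [hK, hker]) fun a ha => ?_
    funext j
    obtain ⟨v, hv⟩ := (chartEquiv he hxe).surjective (b j)
    rw [chartEquiv_apply] at hv
    have := ha v
    simp only [hdχ, hv, innerSL_apply_apply, orthonormal_iff_ite.1 hb] at this
    simpa using this
  have hsm : SmoothOn d e.source (fun y => (Ω.constraintMatrix χ y).det) :=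
    SmoothOn.det fun i j => Ω.smoothOn_bracket e.open_source (hχ i) (hχ j)
  have hU₁ := hsm.isOpen_ne_zero e.open_source
  have hT := e.symm.isOpen_inter_preimage hU₁
  obtain ⟨r, hr, hball⟩ := Metric.isOpen_iff.1 hT (e x)
    ⟨e.map_source hxe, by rw [mem_preimage, e.left_inv hxe]; exact ⟨hxe, hdet⟩⟩
  have hU : IsOpen (e.source ∩ e ⁻¹' Metric.ball (e x) r) :=
    e.isOpen_inter_preimage Metric.isOpen_ball
  have hxU : x ∈ e.source ∩ e ⁻¹' Metric.ball (e x) r := ⟨hxe, Metric.mem_ball_self hr⟩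
  refine ⟨e.source ∩ e ⁻¹' Metric.ball (e x) r, χ, hxU,
    ⟨hU, fun i => (hχ i).mono inter_subset_left, ?_, fun y hy => ?_⟩, ⟨x, hx, hxU⟩, ?_⟩
  · ext y
    constructor
    · exact fun hy => ⟨hy.2, (hbW _).1 ((hW y hy.2.1).1 hy.1)⟩
    · exact fun hy => ⟨(hW y hy.1.1).2 ((hbW _).2 hy.2), hy.1⟩
  · have := (hball hy.2).2
    rw [mem_preimage, e.left_inv hy.1] at this
    exact this.2
  -- In the chart the zero set is a ball intersected with a subspace, hence convex.
  · have himg : N ∩ (e.source ∩ e ⁻¹' Metric.ball (e x) r) =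
        e.symm '' (Metric.ball (e x) r ∩ W) := by
      ext y
      constructor
      · exact fun hy => ⟨e y, ⟨hy.2.2, (hW y hy.2.1).1 hy.1⟩, e.left_inv hy.2.1⟩
      · rintro ⟨z, ⟨hz, hzW⟩, rfl⟩
        have hzt := (hball hz).1
        refine ⟨(hW _ (e.map_target hzt)).2 (by rwa [e.right_inv hzt]), e.map_target hzt, ?_⟩
        rwa [mem_preimage, e.right_inv hzt]
    rw [himg]
    refine (((convex_ball (e x) r).inter W.convex).isPreconnected).image _ ?_
    exact e.continuousOn_symm.mono fun z hz => (hball hz.1).1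

/-! ### First class functions -/

/-- The modification of `F` by a combination of the constraints that makes its brackets with the
constraints vanish on their zero set. -/
def firstClass (Ω : SymplecticForm d P) (χ : Fin n → P → ℝ) (F : P → ℝ) (y : P) : ℝ :=
  F y - ∑ a, ∑ b, (Ω.bracket F (χ a) y * (Ω.constraintMatrix χ y)⁻¹ a b) * χ b y

theorem firstClass_eq {F : P → ℝ} {y : P} (h0 : ∀ i, χ i y = 0) : Ω.firstClass χ F y = F y := by
  simp [firstClass, h0]

theorem smoothOn_coeff (hU : IsOpen U) (hχ : ∀ i, SmoothOn d U (χ i))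
    (h : ∀ y ∈ U, (Ω.constraintMatrix χ y).det ≠ 0) {F : P → ℝ} (hF : SmoothOn d U F)
    (a b : Fin n) :
    SmoothOn d U (fun y => Ω.bracket F (χ a) y * (Ω.constraintMatrix χ y)⁻¹ a b) :=
  (Ω.smoothOn_bracket hU hF (hχ a)).mul (SmoothOn.matrix_inv
    (fun i j => Ω.smoothOn_bracket hU (hχ i) (hχ j)) h a b)

theorem smoothOn_firstClass (hU : IsOpen U) (hχ : ∀ i, SmoothOn d U (χ i))
    (h : ∀ y ∈ U, (Ω.constraintMatrix χ y).det ≠ 0) {F : P → ℝ} (hF : SmoothOn d U F) :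
    SmoothOn d U (Ω.firstClass χ F) :=
  hF.sub (SmoothOn.sum fun a _ => SmoothOn.sum fun b _ =>
    (smoothOn_coeff hU hχ h hF a b).mul (hχ b))

/-- On the zero set the derivatives of the coefficients drop out, and what is subtracted is Σ
dF(X_{χ_a}) c^{ab} dχ_b = dF ∘ Q. -/
theorem differential_firstClass (hU : IsOpen U) (hχ : ∀ i, SmoothOn d U (χ i))
    (h : ∀ y ∈ U, (Ω.constraintMatrix χ y).det ≠ 0) {F : P → ℝ} (hF : SmoothOn d U F) {y : P}
    (hy : y ∈ U) (h0 : ∀ i, χ i y = 0) (v : TangentSpace (𝓡 d) y) :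
    differential d (Ω.firstClass χ F) y v = differential d F y (v - Ω.constraintProj χ y v) := by
  have h1 : ∀ a b, MDifferentiableAt (𝓡 d) 𝓘(ℝ, ℝ)
      (fun y => (Ω.bracket F (χ a) y * (Ω.constraintMatrix χ y)⁻¹ a b) * χ b y) y := fun a b =>
    ((smoothOn_coeff hU hχ h hF a b).mul (hχ b)).mdifferentiableAt hU hy
  have h2 : ∀ a, MDifferentiableAt (𝓡 d) 𝓘(ℝ, ℝ)
      (fun y => ∑ b, (Ω.bracket F (χ a) y * (Ω.constraintMatrix χ y)⁻¹ a b) * χ b y) y := fun a =>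
    (SmoothOn.sum fun b _ => (smoothOn_coeff hU hχ h hF a b).mul (hχ b)).mdifferentiableAt hU hy
  have h3 : MDifferentiableAt (𝓡 d) 𝓘(ℝ, ℝ) (fun y => ∑ a, ∑ b,
      (Ω.bracket F (χ a) y * (Ω.constraintMatrix χ y)⁻¹ a b) * χ b y) y :=
    (SmoothOn.sum fun a _ => SmoothOn.sum fun b _ =>
      (smoothOn_coeff hU hχ h hF a b).mul (hχ b)).mdifferentiableAt hU hy
  have h4 := differential_sub (hF.mdifferentiableAt hU hy) h3 v
  rw [differential_sum fun a _ => h2 a] at h4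
  simp only [differential_sum fun b _ => h1 _ b] at h4
  refine h4.trans ?_
  rw [map_sub, constraintProj_apply]
  congr 1
  simp only [map_sum, map_smul, smul_eq_mul]
  refine Finset.sum_congr rfl fun a _ => Finset.sum_congr rfl fun b _ => ?_
  rw [differential_mul ((smoothOn_coeff hU hχ h hF a b).mdifferentiableAt hU hy)
    ((hχ b).mdifferentiableAt hU hy), h0, zero_mul, add_zero, bracket_eq]
  ring

/-- Linear independence of differentials is an open condition. -/
theorem exists_isOpen_linearIndependent {ι : Type*} [Finite ι] {f : ι → P → ℝ} {U : Set P}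
    (hU : IsOpen U) (hf : ∀ i, SmoothOn d U (f i)) {x : P} (hx : x ∈ U)
    (hind : LinearIndependent ℝ fun i => differential d (f i) x) :
    ∃ U' ⊆ U, IsOpen U' ∧ x ∈ U' ∧
      ∀ y ∈ U', LinearIndependent ℝ fun i => differential d (f i) y := by
  set e := chartAt (EuclideanSpace ℝ (Fin d)) x
  have he : e ∈ IsManifold.maximalAtlas (𝓡 d) ∞ P := chart_mem x
  have hxe : x ∈ e.source := mem_chart_source _ x
  -- Read in the chart, the differentials at all points lie in one fixed space, where linearly
  -- independent families form an open set.
  let g : P → ι → (EuclideanSpace ℝ (Fin d) →L[ℝ] ℝ) := fun y i =>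
    fderiv ℝ (fun z => f i (e.symm z)) (e y)
  have hg : ContinuousOn g (U ∩ e.source) := by
    rw [continuousOn_pi]
    intro i y hy
    have h1 : ContinuousAt (fderiv ℝ (fun z => f i (e.symm z))) (e y) :=
      ((contDiffAt_comp_symm he hU (hf i) (e.map_source hy.2)
        (by rw [e.left_inv hy.2]; exact hy.1)).fderiv_right (m := ∞) (by simp)).continuousAt
    exact (ContinuousAt.comp (f := e) h1 (e.continuousAt hy.2)).continuousWithinAt
  have hiff : ∀ y ∈ U ∩ e.source, (LinearIndependent ℝ fun i => differential d (f i) y) ↔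
      LinearIndependent ℝ (g y) := by
    intro y hy
    let Λ : (EuclideanSpace ℝ (Fin d) →L[ℝ] ℝ) →ₗ[ℝ] (TangentSpace (𝓡 d) y →L[ℝ] ℝ) :=
      { toFun := fun φ => φ.comp (chartDeriv e y)
        map_add' := fun _ _ => rfl
        map_smul' := fun _ _ => rfl }
    have hΛ : LinearMap.ker Λ = ⊥ := by
      rw [LinearMap.ker_eq_bot']
      intro φ hφ
      ext w
      obtain ⟨v, hv⟩ := (chartEquiv he hy.2).surjective w
      rw [chartEquiv_apply] at hv
      rw [← hv]
      exact congrArg (fun L : TangentSpace (𝓡 d) y →L[ℝ] ℝ => L v) hφ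
    have h1 : (fun i => differential d (f i) y) = Λ ∘ g y := by
      funext i
      ext v
      exact differential_eq_fderiv he hU (hf i) hy.2 hy.1 v
    rw [h1, LinearMap.linearIndependent_iff _ hΛ]
  have hopen : IsOpen ((U ∩ e.source) ∩ g ⁻¹' {a | LinearIndependent ℝ a}) :=
    hg.isOpen_inter_preimage (hU.inter e.open_source) isOpen_setOfPred_linearIndependent
  exact ⟨_, inter_subset_left.trans inter_subset_left, hopen,
    ⟨⟨hx, hxe⟩, (hiff x ⟨hx, hxe⟩).1 hind⟩, fun y hy => (hiff y hy.1).2 hy.2⟩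

/-- A system of constraints whose linearization, together with the linear equations `φ = 0`,
cuts out the tangent space of a slice `W`, cuts out together with them the slice itself. -/
theorem exists_ball_mem_of_eq_zero {E F : Type*} [NormedAddCommGroup E] [InnerProductSpace ℝ E]
    [FiniteDimensional ℝ E] [NormedAddCommGroup F] [NormedSpace ℝ F] {W : Submodule ℝ E} {g : E → F}
    {z₀ : E} {A : E →L[ℝ] F} (hz₀ : z₀ ∈ W) (hA : HasStrictFDerivAt g A z₀) {T : Set E}
    (hT : IsOpen T) (hzT : z₀ ∈ T) (hg : ∀ z ∈ T, z ∈ W → g z = 0) :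
    ∃ r > 0, Metric.ball z₀ r ⊆ T ∧ ∀ z ∈ Metric.ball z₀ r, g z = 0 →
      (∀ u ∈ Wᗮ ⊓ LinearMap.ker A.toLinearMap, inner ℝ u z = 0) → z ∈ W := by
  -- `A` is injective on this part of Wᗮ; the functionals in the statement control the remaining
  -- part Wᗮ ⊓ ker A.
  let Q : Submodule ℝ E := Wᗮ ⊓ (Wᗮ ⊓ LinearMap.ker A.toLinearMap)ᗮ
  have hQ : LinearMap.ker (A.toLinearMap ∘ₗ Q.subtype) = ⊥ := by
    rw [LinearMap.ker_eq_bot']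
    rintro ⟨ν, hν1, hν2⟩ hν
    have h1 := (Submodule.mem_orthogonal _ _).1 hν2 ν ⟨hν1, hν⟩
    exact Subtype.ext (inner_self_eq_zero.1 h1)
  obtain ⟨C, hC, hanti⟩ := LinearMap.exists_antilipschitzWith _ hQ
  -- For the normal part ν of `z`, where `g` vanishes at `z` and at its projection to `W`, this
  -- constant gives ‖ν‖ ≤ C‖Aν‖ ≤ ‖ν‖/2, so ν = 0.
  have hlo := hA.isLittleO.def (c := (2 * (C : ℝ))⁻¹) (by positivity)
  obtain ⟨r, hr, hball⟩ := Metric.eventually_nhds_iff_ball.1 (hlo.and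
    ((hT.prod hT).mem_nhds (show (z₀, z₀) ∈ T ×ˢ T from ⟨hzT, hzT⟩)))
  refine ⟨r, hr, fun z hz => ?_, fun z hz hgz hu => ?_⟩
  · exact (hball (z, z) (by rw [← ball_prod_same]; exact ⟨hz, hz⟩)).2.1
  · let w := W.starProjection z
    have hw : w ∈ W := W.starProjection_apply_mem z
    have hwb : w ∈ Metric.ball z₀ r := by
      have h1 : w - z₀ = W.starProjection (z - z₀) := by
        rw [map_sub, Submodule.starProjection_eq_self_iff.2 hz₀]
      rw [mem_ball_iff_norm] at hz ⊢
      rw [h1]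
      exact (W.norm_starProjection_apply_le _).trans_lt hz
    obtain ⟨h1, h2⟩ := hball (z, w) (by rw [← ball_prod_same]; exact ⟨hz, hwb⟩)
    simp only [hgz, hg w h2.2 hw, sub_self, zero_sub, norm_neg] at h1
    have hν1 : z - w ∈ Wᗮ := Submodule.sub_starProjection_mem_orthogonal z
    have hν2 : z - w ∈ (Wᗮ ⊓ LinearMap.ker A.toLinearMap)ᗮ := by
      rw [Submodule.mem_orthogonal]
      intro u hu'
      rw [inner_sub_right, hu u hu', real_inner_comm, Submodule.mem_orthogonal _ _ |>.1 hu'.1 w hw,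
        sub_zero]
    have h3 := ZeroHomClass.bound_of_antilipschitz _ hanti ⟨z - w, hν1, hν2⟩
    change ‖z - w‖ ≤ C * ‖A (z - w)‖ at h3
    have hC' : (0 : ℝ) < C := by exact_mod_cast hC
    have h4 : C * ‖A (z - w)‖ ≤ ‖z - w‖ / 2 := by
      calc C * ‖A (z - w)‖ ≤ C * ((2 * (C : ℝ))⁻¹ * ‖z - w‖) := by gcongr
        _ = ‖z - w‖ / 2 := by field_simp
    have h5 : ‖z - w‖ = 0 := by
      have := norm_nonneg (z - w)
      linarith
    rw [norm_eq_zero, sub_eq_zero] at h5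
    exact h5 ▸ hw

end SymplecticForm

end

section

variable {d : ℕ} {P : Type*} [TopologicalSpace P] [ChartedSpace (EuclideanSpace ℝ (Fin d)) P]
  [IsManifold (𝓡 d) ∞ P]

namespace SymplecticForm

variable {Ω : SymplecticForm d P} {n : ℕ} {N U S : Set P} {χ : Fin n → P → ℝ}

/-- Second class equations of `N` extend to regular equations of `S`, the further equations being
first class constraints. -/
theorem exists_firstClass_equations {k l : ℕ} (hn : n + (k + l) = d) (hS : IsSubmanifold d S k)
    {V : ∀ x : P, Submodule ℝ (TangentSpace (𝓡 d) x)}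
    (hVsup : ∀ x ∈ S, V x ⊔ Ω.ker (tangentAt S x) = Ω.orth (tangentAt S x))
    (hN : Ω.IsSecondClassSubmanifold S V (k + l) N) {x : P} (hx : x ∈ S) :
    ∃ (U : Set P) (χ : Fin n → P → ℝ) (ψ : Fin l → P → ℝ), x ∈ U ∧
      Ω.IsSecondClassEquations N U χ ∧ (∀ i, SmoothOn d U (ψ i)) ∧
      S ∩ U = {y ∈ U | (∀ i, χ i y = 0) ∧ ∀ j, ψ j y = 0} ∧
      (∀ y ∈ U, LinearIndependent ℝ
        (Sum.elim (fun i => differential d (χ i) y) (fun j => differential d (ψ j) y))) ∧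
      ∀ j, ∀ y ∈ S ∩ U, Ω.hamVec (ψ j) y ∈ tangentAt S y := by
  obtain ⟨U₀, χ, hxU₀, hχ, -⟩ := exists_secondClassEquations hn hN.isSubmanifold (hN.subset hx)
    (hN.symplectic x (hN.subset hx))
  obtain ⟨e, he, hxe, W, hWk, hW⟩ := hS x hx
  have hU₁ : IsOpen (U₀ ∩ e.source) := hχ.isOpen.inter e.open_source
  have hxU₁ : x ∈ U₀ ∩ e.source := ⟨hxU₀, hxe⟩
  have hχ₁ := hχ.mono hU₁ inter_subset_left
  have hdet := hχ.det_ne_zero x hxU₀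
  have hχS : ∀ y ∈ S ∩ U₀, ∀ i, χ i y = 0 := fun y hy => hχ.eq_zero y ⟨hN.subset hy.1, hy.2⟩
  let g : EuclideanSpace ℝ (Fin d) → Fin n → ℝ := fun z i => χ i (e.symm z)
  have hz := e.map_source hxe
  have hg : ContDiffAt ℝ ∞ g (e x) := contDiffAt_pi.2 fun i =>
    contDiffAt_comp_symm he hχ.isOpen (hχ.smooth i) hz (by rwa [e.left_inv hxe])
  let A := fderiv ℝ g (e x)
  have hA : ∀ v i, A (chartDeriv e x v) i = differential d (χ i) x v := by
    intro v i
    rw [differential_eq_fderiv he hχ.isOpen (hχ.smooth i) hxe hxU₀]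
    change fderiv ℝ g (e x) (chartDeriv e x v) i = _
    rw [fderiv_pi fun i => (contDiffAt_pi.1 hg i).differentiableAt (by simp)]
    rfl
  have hAK : ∀ v, A (chartDeriv e x v) = 0 ↔ v ∈ constraintKer χ x := fun v => by
    rw [mem_constraintKer, funext_iff]
    simp only [hA, Pi.zero_apply]
  have hAsurj : Function.Surjective A.toLinearMap := fun a => by
    obtain ⟨v, hv⟩ := differential_surjective hdet a
    exact ⟨chartDeriv e x v, funext fun i => (hA v i).trans (hv i)⟩
  have hWA : W ≤ LinearMap.ker A.toLinearMap := fun w hw => by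
    obtain ⟨v, rfl⟩ := (chartEquiv he hxe).surjective w
    exact (hAK v).2 (tangentAt_le_constraintKer hχ.isOpen hχ.smooth hχS hxU₀
      ((mem_tangentAt_iff_of_slice he hxe hx hW).2 hw))
  -- W ≤ ker A has dimension `k` and ker A has dimension d - n = k + l, so exactly `l` further
  -- linear equations are missing.
  have hMl : Module.finrank ℝ ↥(Wᗮ ⊓ LinearMap.ker A.toLinearMap) = l := by
    have h1 := Submodule.finrank_add_inf_finrank_orthogonal hWA
    have h2 := LinearMap.finrank_range_add_finrank_ker A.toLinearMap
    rw [LinearMap.range_eq_top.2 hAsurj, finrank_top, Module.finrank_fin_fun,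
      finrank_euclideanSpace_fin] at h2
    omega
  let b := (stdOrthonormalBasis ℝ ↥(Wᗮ ⊓ LinearMap.ker A.toLinearMap)).reindex (finCongr hMl)
  let lin : Fin l → P → ℝ := fun j y => innerSL ℝ (b j : EuclideanSpace ℝ (Fin d)) (e y)
  have hlin : ∀ j, SmoothOn d e.source (lin j) := fun j => smoothOn_chart he _
  have hlin₁ : ∀ j, SmoothOn d (U₀ ∩ e.source) (lin j) := fun j =>
    (hlin j).mono inter_subset_right
  have hlinS : ∀ y ∈ S ∩ e.source, ∀ j, lin j y = 0 := fun y hy j => by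
    simp only [lin]
    rw [innerSL_apply_apply, real_inner_comm]
    exact (Submodule.mem_orthogonal _ _).1 (b j).2.1 _ ((hW y hy.2).1 hy.1)
  let ψ : Fin l → P → ℝ := fun j => Ω.firstClass χ (lin j)
  have hψ : ∀ j, SmoothOn d (U₀ ∩ e.source) (ψ j) := fun j =>
    smoothOn_firstClass hU₁ hχ₁.smooth hχ₁.det_ne_zero (hlin₁ j)
  have hdψ : ∀ j, ∀ y ∈ U₀ ∩ e.source, (∀ i, χ i y = 0) → ∀ v,
      differential d (ψ j) y v = differential d (lin j) y (v - Ω.constraintProj χ y v) :=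
    fun j y hy h0 v =>
      differential_firstClass hU₁ hχ₁.smooth hχ₁.det_ne_zero (hlin₁ j) hy h0 v
  have hbβ : ∀ j, ∃ β, chartDeriv e x β = b j := fun j => (chartEquiv he hxe).surjective _
  choose β hβ using hbβ
  have hβK : ∀ j, β j ∈ constraintKer χ x := fun j => by
    rw [← hAK, hβ]
    exact (b j).2.2
  have hχx : ∀ i, χ i x = 0 := hχS x ⟨hx, hxU₀⟩
  have hdψβ : ∀ j j', differential d (ψ j) x (β j') = if j = j' then 1 else 0 := fun j j' => by
    rw [hdψ j x hxU₁ hχx, Ω.constraintProj_of_mem_ker _ _ (hβK j'), sub_zero,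
      differential_chart he hxe, hβ, innerSL_apply_apply]
    exact orthonormal_iff_ite.1 b.orthonormal j j'
  -- The system is triangular: the β_j lie in the common kernel of the dχ_i and are dual to the
  -- dψ_j, and the dχ_i are independent.
  have hind : LinearIndependent ℝ fun i => differential d (Sum.elim χ ψ i) x := by
    rw [Fintype.linearIndependent_iff]
    intro a ha
    have hev : ∀ v, ∑ i, a (Sum.inl i) * differential d (χ i) x v +
        ∑ j, a (Sum.inr j) * differential d (ψ j) x v = 0 := fun v => by
      have := congrArg (fun L : TangentSpace (𝓡 d) x →L[ℝ] ℝ => L v) ha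
      rw [Fintype.sum_sum_type] at this
      simpa using this
    have hr : ∀ j, a (Sum.inr j) = 0 := fun j => by
      have := hev (β j)
      simpa [mem_constraintKer.1 (hβK j), hdψβ] using this
    have hl : ∀ i, a (Sum.inl i) = 0 := fun i => by
      obtain ⟨v, hv⟩ := differential_surjective hdet (Pi.single i 1)
      have := hev v
      simpa [hr, hv, Pi.single_apply] using this
    rintro (i | j)
    · exact hl i
    · exact hr j
  obtain ⟨U₂, hU₂₁, hU₂, hxU₂, hindU₂⟩ := exists_isOpen_linearIndependent hU₁
    (f := Sum.elim χ ψ) (by rintro (i | j); exacts [hχ₁.smooth i, hψ j]) hxU₁ hind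
  have hT := e.symm.isOpen_inter_preimage hU₂
  obtain ⟨r, hr, hball, hrW⟩ := exists_ball_mem_of_eq_zero (W := W) (g := g) (z₀ := e x)
    ((hW x hxe).1 hx) (hg.hasStrictFDerivAt (by simp)) hT
    ⟨hz, by rwa [mem_preimage, e.left_inv hxe]⟩ fun z hz hzW => by
      funext i
      refine hχS _ ⟨(hW _ (e.map_target hz.1)).2 ?_, (hU₂₁ hz.2).1⟩ i
      rwa [e.right_inv hz.1]
  have hU : IsOpen (e.source ∩ e ⁻¹' Metric.ball (e x) r) :=
    e.isOpen_inter_preimage Metric.isOpen_ball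
  have hUU₂ : e.source ∩ e ⁻¹' Metric.ball (e x) r ⊆ U₂ := fun y hy => by
    have := (hball hy.2).2
    rwa [mem_preimage, e.left_inv hy.1] at this
  have hUU₁ := hUU₂.trans hU₂₁
  have hSψ : ∀ y ∈ S ∩ (U₀ ∩ e.source), ∀ j, ψ j y = 0 := fun y hy j => by
    simp only [ψ]
    rw [firstClass_eq (hχS y ⟨hy.1, hy.2.1⟩), hlinS y ⟨hy.1, hy.2.2⟩]
  refine ⟨e.source ∩ e ⁻¹' Metric.ball (e x) r, χ, ψ, ⟨hxe, Metric.mem_ball_self hr⟩,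
    hχ₁.mono hU hUU₁, fun j => (hψ j).mono hUU₁, ?_, fun y hy => ?_, fun j y hy => ?_⟩
  · ext y
    constructor
    · intro hy
      have hy₁ := hUU₁ hy.2
      exact ⟨hy.2, hχS y ⟨hy.1, hy₁.1⟩, hSψ y ⟨hy.1, hy₁⟩⟩
    · rintro ⟨hy, h0, h1⟩
      refine ⟨(hW y hy.1).2 (hrW (e y) hy.2 ?_ fun u hu => ?_), hy⟩
      · funext i
        simp only [g, e.left_inv hy.1, h0, Pi.zero_apply]
      · have h2 : (⟨u, hu⟩ : ↥(Wᗮ ⊓ LinearMap.ker A.toLinearMap)) ∈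
            Submodule.span ℝ (range b) := by
          rw [← b.coe_toBasis, b.toBasis.span_eq]; trivial
        have h3 : Submodule.span ℝ (range b) ≤ LinearMap.ker ((innerSL ℝ (e y)).toLinearMap ∘ₗ
            (Wᗮ ⊓ LinearMap.ker A.toLinearMap).subtype) := by
          rw [Submodule.span_le]
          rintro _ ⟨j, rfl⟩
          have := h1 j
          simp only [ψ] at this
          rw [firstClass_eq h0] at this
          simp only [lin] at this
          rw [innerSL_apply_apply, real_inner_comm] at this
          exact this
        have h4 := h3 h2
        rw [real_inner_comm]
        exact h4
  · have := hindU₂ y (hUU₂ hy)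
    convert this using 1
    funext i
    cases i <;> rfl
  · have hy₁ := hUU₁ hy.2
    have hχy := hχS y ⟨hy.1, hy₁.1⟩
    -- It suffices that dψ_j kills (TS)^Ω = V + ker ω. On V, which is the range of Q, this is dψ_j =
    -- d(lin_j) ∘ (1 - Q); on ker ω ⊆ TS it is the vanishing of ψ_j on `S`.
    rw [← Ω.orth_orth (tangentAt S y)]
    intro w hw
    rw [hamVec_spec]
    rw [← hVsup y hy.1] at hw
    obtain ⟨v, hv, u, hu, rfl⟩ := Submodule.mem_sup.1 hw
    have hvK : v ∈ Ω.orth (constraintKer χ y) := by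
      rw [← hχ₁.tangentAt_eq hN.isSubmanifold hn ⟨hN.subset hy.1, hy₁⟩,
        hN.tangent y hy.1, orth_orth]
      exact hv
    rw [map_add, hdψ j y hy₁ hχy v, constraintProj_eq_self (hχ₁.det_ne_zero y hy₁) hvK, sub_self,
      map_zero, zero_add]
    exact hu.1 _ _ hU₁ hy₁ (hψ j) fun y hy => hSψ y hy j

/-! ### Symplectic leaves of the Dirac bracket -/

/-- A piece of a Dirac-Hamiltonian curve starting on the zero set of the constraints stays in
it. -/
theorem mem_connectedComponentIn_of_step (hχ : Ω.IsSecondClassEquations N U χ) {x y : P}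
    (hx : x ∈ N ∩ U) (h : HamiltonianStep d U (Ω.diracBracket χ) x y) :
    y ∈ connectedComponentIn (N ∩ U) x := by
  obtain ⟨F, X, γ, hF, hX, hγU, hγ, rfl, rfl⟩ := h
  have hcont : ContinuousOn γ (Icc 0 1) := fun t ht => (hγ t ht).continuousWithinAt
  -- Each χ_i is a Casimir function of the Dirac bracket, so it is constant along the curve.
  have hder : ∀ i, ∀ t ∈ Icc (0 : ℝ) 1, HasDerivWithinAt (fun t => χ i (γ t)) 0 (Icc 0 1) t := by
    intro i t ht
    have h1 := ((hχ.smooth i).mdifferentiableAt hχ.isOpen (hγU t ht)).hasMFDerivAt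
    have h2 := h1.comp_hasMFDerivWithinAt t (hγ t ht)
    have h4 : differential d (χ i) (γ t) (X (γ t)) = 0 := by
      rw [hX (χ i) (hχ.smooth i) _ (hγU t ht),
        Ω.diracBracket_constraint (hχ.det_ne_zero _ (hγU t ht))]
    have h5 : HasFDerivWithinAt (χ i ∘ γ) (0 : ℝ →L[ℝ] ℝ) (Icc 0 1) t :=
      hasMFDerivWithinAt_iff_hasFDerivWithinAt.1 (h2.congr_mfderiv (by
        ext
        change differential d (χ i) (γ t) ((1 : ℝ) • X (γ t)) = 0
        rw [one_smul, h4]))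
    have h6 := h5.hasDerivWithinAt
    exact h6
  have hγN : ∀ t ∈ Icc (0 : ℝ) 1, γ t ∈ N ∩ U := by
    intro t ht
    refine ⟨(hχ.mem_iff (hγU t ht)).2 fun i => ?_, hγU t ht⟩
    have h1 := constant_of_derivWithin_zero
      (fun t ht => (hder i t ht).differentiableWithinAt)
      (fun t ht => (hder i t (Ico_subset_Icc_self ht)).derivWithin
        (uniqueDiffOn_Icc zero_lt_one t (Ico_subset_Icc_self ht))) t ht
    exact h1.trans (hχ.eq_zero _ hx i)
  have himg : IsPreconnected (γ '' Icc 0 1) := isPreconnected_Icc.image _ hcont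
  exact himg.subset_connectedComponentIn ⟨0, by simp, rfl⟩
    (by rintro _ ⟨t, ht, rfl⟩; exact hγN t ht) ⟨1, by simp, rfl⟩

/-- Near each of its points, any two points of the submanifold are joined by an integral curve
of a Hamiltonian vector field of the Dirac bracket. -/
theorem exists_hamiltonianStep [T2Space P] {q : ℕ} (hχ : Ω.IsSecondClassEquations N U χ)
    (hN : IsSubmanifold d N q) {x : P} (hx : x ∈ N ∩ U) :
    ∃ O : Set P, IsOpen O ∧ x ∈ O ∧ ∀ y ∈ N ∩ O, ∀ z ∈ N ∩ O,
      HamiltonianStep d U (Ω.diracBracket χ) y z := by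
  obtain ⟨e, he, hxe, W, -, hW⟩ := hN x hx.1
  obtain ⟨R, hR, hball⟩ := Metric.isOpen_iff.1 (e.symm.isOpen_inter_preimage hχ.isOpen) (e x)
    ⟨e.map_source hxe, by rw [mem_preimage, e.left_inv hxe]; exact hx.2⟩
  refine ⟨e.source ∩ e ⁻¹' Metric.ball (e x) (R / 8), e.isOpen_inter_preimage Metric.isOpen_ball,
    ⟨hxe, Metric.mem_ball_self (by positivity)⟩, fun y hy z hz => ?_⟩
  set u : EuclideanSpace ℝ (Fin d) := e z - e y with hu
  have hyW : e y ∈ W := (hW y hy.2.1).1 hy.1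
  have huW : u ∈ W := W.sub_mem ((hW z hz.2.1).1 hz.1) hyW
  let c : ℝ → EuclideanSpace ℝ (Fin d) := fun t => e y + t • u
  have hc : ∀ t ∈ Icc (0 : ℝ) 1, c t ∈ Metric.ball (e x) (R / 8) := fun t ht =>
    (convex_ball (e x) (R / 8)).add_smul_sub_mem hy.2.2 hz.2.2 ht
  have hcball : ∀ t ∈ Icc (0 : ℝ) 1, c t ∈ Metric.ball (e x) R := fun t ht =>
    Metric.ball_subset_ball (by linarith) (hc t ht)
  have hcN : ∀ t ∈ Icc (0 : ℝ) 1, e.symm (c t) ∈ N := fun t ht => by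
    have h1 := (hball (hcball t ht)).1
    rw [hW _ (e.map_target h1), e.right_inv h1]
    exact W.add_mem hyW (W.smul_mem t huW)
  -- Orthogonal projection onto the line through the two points; for u = 0 the division by zero
  -- makes it the constant `e y`.
  let p : EuclideanSpace ℝ (Fin d) → EuclideanSpace ℝ (Fin d) := fun w =>
    e y + (inner ℝ u (w - e y) / ‖u‖ ^ 2) • u
  have hp : ContDiff ℝ ∞ p := by
    have h : ContDiff ℝ ∞ fun w : EuclideanSpace ℝ (Fin d) => inner ℝ u (w - e y) / ‖u‖ ^ 2 :=
      (contDiff_const.inner ℝ (contDiff_id.sub contDiff_const)).div_const _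
    exact contDiff_const.add (h.smul contDiff_const)
  have hpc : ∀ t, p (c t) = c t := fun t => by
    simp only [p, c, add_sub_cancel_left, inner_smul_right, real_inner_self_eq_norm_sq]
    by_cases h0 : u = 0
    · simp [h0]
    · rw [mul_div_cancel_right₀ _ (by simpa using h0)]
  have hpball : ∀ w ∈ Metric.ball (e x) (R / 2), p w ∈ Metric.ball (e x) R := fun w hw => by
    have hy' := hy.2.2
    rw [mem_preimage] at hy'
    rw [mem_ball_iff_norm] at hw hy' ⊢
    have h1 : ‖(inner ℝ u (w - e y) / ‖u‖ ^ 2) • u‖ ≤ ‖w - e y‖ := by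
      by_cases h0 : u = 0
      · simp [h0]
      have hu0 : 0 < ‖u‖ := norm_pos_iff.2 h0
      rw [norm_smul, norm_div, norm_pow, norm_norm, div_mul_eq_mul_div, div_le_iff₀ (by positivity)]
      calc ‖inner ℝ u (w - e y)‖ * ‖u‖ ≤ (‖u‖ * ‖w - e y‖) * ‖u‖ := by
            gcongr; exact norm_inner_le_norm _ _
        _ = ‖w - e y‖ * ‖u‖ ^ 2 := by ring
    have h2 : ‖w - e y‖ ≤ ‖w - e x‖ + ‖e y - e x‖ := by
      rw [show w - e y = (w - e x) - (e y - e x) by abel]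
      exact norm_sub_le _ _
    have h3 : ‖p w - e x‖ ≤ ‖e y - e x‖ + ‖w - e y‖ := by
      rw [show p w - e x = (e y - e x) + (inner ℝ u (w - e y) / ‖u‖ ^ 2) • u by
        simp only [p]; abel]
      exact (norm_add_le _ _).trans (by gcongr)
    linarith
  -- The components of the covector Ω(v, ·), where `v` is the vector with constant chart coordinates
  -- `u`. A Hamiltonian is sought with this differential along the segment.
  let qf : Fin d → P → ℝ := fun a y => ∑ j, (Ω.constraintMatrix (coords e) y)⁻¹ a j * u j
  have hqf : ∀ a, SmoothOn d e.source (qf a) := fun a => SmoothOn.sum fun j _ =>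
    (SmoothOn.matrix_inv (fun i j => Ω.smoothOn_bracket e.open_source (smoothOn_coords he i)
      (smoothOn_coords he j)) (fun y hy => det_constraintMatrix_coords he hy) a j).mul
      (smoothOn_const _)
  have hqfΩ : ∀ y ∈ e.source, ∀ v w : TangentSpace (𝓡 d) y, chartDeriv e y v = u →
      Ω.bil y v w = ∑ a, qf a y * chartDeriv e y w a := fun y hy v w hv => by
    rw [bil_eq_sum_hamCoeff he hy]
    simp only [hamCoeff, qf, differential_coords he hy, hv]
  have hqfu : ∀ y ∈ e.source, ∑ a, qf a y * u a = 0 := fun y hy => by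
    obtain ⟨v, hv⟩ := (chartEquiv he hy).surjective u
    rw [chartEquiv_apply] at hv
    have h1 := hqfΩ y hy v v hv
    rw [hv, Ω.bil_isAlt y v] at h1
    exact h1.symm
  let Q : Fin d → EuclideanSpace ℝ (Fin d) → ℝ := fun a w => qf a (e.symm (p w))
  have hQ : ∀ a, ContDiffOn ℝ ∞ (Q a) (Metric.ball (e x) (R / 2)) := fun a w hw => by
    have h1 := (hball (hpball w hw)).1
    exact (ContDiffAt.comp w (contDiffAt_comp_symm he e.open_source (hqf a) h1 (e.map_target h1))
      hp.contDiffAt).contDiffWithinAt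
  -- On the segment w - e y = t u, so the terms with dQ_a add up to t d(Σ Q_a u_a). This is zero,
  -- since Σ Q_a u_a = 0 expresses Ω(v, v) = 0; only Σ Q_a dw_a remains.
  let F₀ : EuclideanSpace ℝ (Fin d) → ℝ := fun w => ∑ a, Q a w * (w a - e y a)
  have hcoord : ∀ a, ContDiff ℝ ∞ (fun w : EuclideanSpace ℝ (Fin d) => w a - e y a) := fun a =>
    (EuclideanSpace.proj a : EuclideanSpace ℝ (Fin d) →L[ℝ] ℝ).contDiff.sub contDiff_const
  have hF₀ : ContDiffOn ℝ ∞ F₀ (Metric.ball (e x) (R / 2)) :=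
    ContDiffOn.sum fun a _ => (hQ a).mul (hcoord a).contDiffOn
  have hdF₀ : ∀ t ∈ Icc (0 : ℝ) 1, ∀ w,
      fderiv ℝ F₀ (c t) w = ∑ a, qf a (e.symm (c t)) * w a := by
    intro t ht w
    have hct : c t ∈ Metric.ball (e x) (R / 2) :=
      Metric.ball_subset_ball (by linarith) (hc t ht)
    have hnhds := Metric.isOpen_ball.mem_nhds hct
    have hQd : ∀ a, DifferentiableAt ℝ (Q a) (c t) := fun a =>
      ((hQ a).contDiffAt hnhds).differentiableAt (by simp)
    have h0 : ∑ a, fderiv ℝ (Q a) (c t) w * u a = 0 := by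
      have h1 : (fun w => ∑ a, Q a w * u a) =ᶠ[nhds (c t)] fun _ => 0 :=
        Filter.eventuallyEq_of_mem hnhds fun w hw =>
          hqfu _ (e.map_target (hball (hpball w hw)).1)
      have h2 : HasFDerivAt (fun w => ∑ a, Q a w * u a) (∑ a, u a • fderiv ℝ (Q a) (c t)) (c t) :=
        HasFDerivAt.fun_sum fun a _ => (hQd a).hasFDerivAt.mul_const (u a)
      have h3 := congrArg (fun L : EuclideanSpace ℝ (Fin d) →L[ℝ] ℝ => L w)
        (h2.unique ((hasFDerivAt_const (0 : ℝ) (c t)).congr_of_eventuallyEq h1))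
      simpa [mul_comm] using h3
    have h4 : HasFDerivAt F₀ (∑ a, (Q a (c t) • (EuclideanSpace.proj a :
        EuclideanSpace ℝ (Fin d) →L[ℝ] ℝ) + (c t a - e y a) • fderiv ℝ (Q a) (c t))) (c t) :=
      HasFDerivAt.fun_sum fun a _ => (hQd a).hasFDerivAt.mul
        ((EuclideanSpace.proj a : EuclideanSpace ℝ (Fin d) →L[ℝ] ℝ).hasFDerivAt.sub_const _)
    rw [h4.fderiv]
    have h5 : ∀ a, c t a - e y a = t * u a := fun a => by simp [c]
    have h6 : ∑ a, t * u a * fderiv ℝ (Q a) (c t) w = 0 := by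
      rw [← mul_zero t, ← h0, Finset.mul_sum]
      exact Finset.sum_congr rfl fun a _ => by ring
    simp only [sum_apply, add_apply, smul_apply,
      smul_eq_mul, h5, Finset.sum_add_distrib, h6, add_zero, Q, hpc]
    rfl
  -- The cutoff is 1 on the ball containing the segment and zero outside the ball of radius R/4,
  -- within the ball of radius R/2 on which F₀ is smooth.
  let f : ContDiffBump (e x) := ⟨R / 8, R / 4, by positivity, by linarith⟩
  classical
  let F : P → ℝ := fun y => if y ∈ e.source then f (e y) * F₀ (e y) else 0
  have hF₁ : SmoothOn d (e.source ∩ e ⁻¹' Metric.ball (e x) (R / 2)) F :=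
    (smoothOn_comp_chart he (f.contDiff.contDiffOn.mul hF₀)).congr fun w hw => if_pos hw.1
  have hF : SmoothOn d univ F := by
    refine smoothOn_of_locally fun w _ => ?_
    have hsub : Metric.closedBall (e x) (R / 4) ⊆ Metric.ball (e x) (R / 2) :=
      Metric.closedBall_subset_ball (by linarith)
    have hsub' : Metric.ball (e x) (R / 2) ⊆ e.target := fun w hw =>
      (hball (Metric.ball_subset_ball (by linarith) hw)).1
    by_cases hw : w ∈ e.symm '' Metric.closedBall (e x) (R / 4)
    · obtain ⟨v, hv, rfl⟩ := hw
      have hvt := hsub' (hsub hv)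
      exact ⟨_, e.isOpen_inter_preimage Metric.isOpen_ball,
        ⟨e.map_target hvt, by rw [mem_preimage, e.right_inv hvt]; exact hsub hv⟩,
        hF₁.mono inter_subset_right⟩
    -- In a Hausdorff space the compact image is closed, so the extension by zero is smooth.
    · have hcl : IsClosed (e.symm '' Metric.closedBall (e x) (R / 4)) :=
        ((isCompact_closedBall _ _).image_of_continuousOn
          (e.continuousOn_symm.mono (hsub.trans hsub'))).isClosed
      refine ⟨_, hcl.isOpen_compl, hw, (smoothOn_const 0).congr fun v hv => ?_⟩
      by_cases hve : v ∈ e.source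
      · have h1 : e v ∉ Metric.closedBall (e x) (R / 4) := fun h =>
          hv.2 ⟨e v, h, e.left_inv hve⟩
        have h2 : f (e v) = 0 := f.zero_of_le_dist (by
          rw [Metric.mem_closedBall, not_le] at h1
          exact h1.le)
        simp [F, h2]
      · exact if_neg hve
  have hdF : ∀ t (ht : t ∈ Icc (0 : ℝ) 1) (w : TangentSpace (𝓡 d) (e.symm (c t))),
      differential d F (e.symm (c t)) w = fderiv ℝ F₀ (c t) (chartDeriv e (e.symm (c t)) w) := by
    intro t ht w
    have hct := (hball (hcball t ht)).1
    have hopen : IsOpen (e.source ∩ e ⁻¹' Metric.ball (e x) (R / 8)) :=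
      e.isOpen_inter_preimage Metric.isOpen_ball
    rw [differential_congr_on hopen ⟨e.map_target hct, by
      rw [mem_preimage, e.right_inv hct]; exact hc t ht⟩ (G := fun y => F₀ (e y)) fun v hv => ?_,
      differential_comp_chart he (e.map_target hct), e.right_inv hct]
    · rw [e.right_inv hct]
      exact (hF₀.contDiffAt (Metric.isOpen_ball.mem_nhds
        (Metric.ball_subset_ball (by linarith) (hc t ht)))).differentiableAt (by simp)
    · simp only [F, if_pos hv.1]
      rw [f.one_of_mem_closedBall (Metric.ball_subset_closedBall hv.2), one_mul]
  refine ⟨F, fun y => Ω.diracVec χ y F, fun t => e.symm (c t), hF.mono (subset_univ _),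
    fun G _ y _ => Ω.differential_diracVec χ y F G, fun t ht => (hball (hcball t ht)).2,
    fun t ht => ?_, ?_, ?_⟩
  · have hct := (hball (hcball t ht)).1
    have hctU := (hball (hcball t ht)).2
    set v : TangentSpace (𝓡 d) (e.symm (c t)) := mfderiv (𝓡 d) (𝓡 d) e.symm (c t) u with hv
    have hvu : chartDeriv e (e.symm (c t)) v = u := chartDeriv_symm he hct u
    have hham : v = Ω.hamVec F (e.symm (c t)) := Ω.hamVec_unique fun w => by
      rw [hqfΩ _ (e.map_target hct) v w hvu, hdF t ht, hdF₀ t ht]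
    have hvK : v ∈ constraintKer χ (e.symm (c t)) :=
      tangentAt_le_constraintKer hχ.isOpen hχ.smooth hχ.eq_zero hctU
        ((mem_tangentAt_iff_of_slice he (e.map_target hct) (hcN t ht) hW).2 (by rwa [hvu]))
    -- The Hamiltonian vector is already tangent to `N` along the segment, so the Dirac projection
    -- leaves it unchanged.
    have hdirac : Ω.diracVec χ (e.symm (c t)) F = v := by
      rw [diracVec, ← hham, Ω.constraintProj_of_mem_ker _ _ hvK, sub_zero]
    have h1 : HasDerivAt c u t := by
      have := ((hasDerivAt_id t).smul_const u).const_add (e y)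
      rwa [one_smul] at this
    have h2 := (mdifferentiableAt_chart_symm he hct).hasMFDerivAt.comp t
      h1.hasFDerivAt.hasMFDerivAt
    have h3 : HasMFDerivAt 𝓘(ℝ, ℝ) (𝓡 d) (fun t => e.symm (c t)) t
        (ContinuousLinearMap.smulRight (1 : ℝ →L[ℝ] ℝ) (Ω.diracVec χ (e.symm (c t)) F)) :=
      h2.congr_mfderiv (by
        ext1
        change mfderiv (𝓡 d) (𝓡 d) e.symm (c t) ((1 : ℝ) • u) =
          (1 : ℝ) • Ω.diracVec χ (e.symm (c t)) F
        rw [one_smul, one_smul, hdirac])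
    exact h3.hasMFDerivWithinAt
  · simp only [c, zero_smul, add_zero, e.left_inv hy.2.1]
  · simp only [c, one_smul, hu, add_sub_cancel, e.left_inv hz.2.1]

/-- The symplectic leaves of the Dirac bracket in the zero set of the constraints are its connected
components. -/
theorem symplecticLeaf_diracBracket [T2Space P] {q : ℕ} (hχ : Ω.IsSecondClassEquations N U χ)
    (hN : IsSubmanifold d N q) {x : P} (hx : x ∈ N ∩ U) :
    symplecticLeaf d U (Ω.diracBracket χ) x = connectedComponentIn (N ∩ U) x := by
  apply Subset.antisymm
  · intro y hy
    change Relation.ReflTransGen _ x y at hy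
    induction hy with
    | refl => exact mem_connectedComponentIn hx
    | tail _ hstep ih =>
      rw [connectedComponentIn_eq ih]
      exact mem_connectedComponentIn_of_step hχ (connectedComponentIn_subset _ _ ih) hstep
  · intro y hy
    -- On a preconnected set a transitive relation that holds in both directions between each point
    -- and its neighbours holds between any two points.
    refine (isPreconnected_connectedComponentIn (x := x) (F := N ∩ U)).induction₂'
      (Relation.ReflTransGen (HamiltonianStep d U (Ω.diracBracket χ))) (fun z hz => ?_)
      (fun _ _ _ _ _ _ h h' => h.trans h') (mem_connectedComponentIn hx) hy
    have hzN := connectedComponentIn_subset _ _ hz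
    obtain ⟨O, hO, hzO, hstep⟩ := exists_hamiltonianStep hχ hN hzN
    have h1 : ∀ᶠ w in nhdsWithin z (connectedComponentIn (N ∩ U) x), w ∈ O :=
      mem_nhdsWithin_of_mem_nhds (hO.mem_nhds hzO)
    filter_upwards [h1, self_mem_nhdsWithin] with w hwO hw
    have hwN := connectedComponentIn_subset _ _ hw
    exact ⟨.single (hstep z ⟨hzN.1, hzO⟩ w ⟨hwN.1, hwO⟩),
      .single (hstep w ⟨hwN.1, hwO⟩ z ⟨hzN.1, hzO⟩)⟩

/-- The leafwise symplectic form of the Dirac bracket is the pullback of `Ω`. -/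
theorem diracBracket_eq_form {q : ℕ} (hχ : Ω.IsSecondClassEquations N U χ)
    (hN : IsSubmanifold d N q) (hnq : n + q = d) {F G : P → ℝ} {x : P} (hx : x ∈ N ∩ U)
    {u v : TangentSpace (𝓡 d) x} (hu : Ω.IsRestrictedHamVec N F x u)
    (hv : Ω.IsRestrictedHamVec N G x v) : Ω.diracBracket χ F G x = Ω.form x ![u, v] := by
  have hdet := hχ.det_ne_zero x hx.2
  have hT := hχ.tangentAt_eq hN hnq hx
  have h1 : u = Ω.diracVec χ x F := Ω.eq_diracVec hdet (hT ▸ hu.1) (by rw [← hT]; exact hu.2)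
  have h2 : v = Ω.diracVec χ x G := Ω.eq_diracVec hdet (hT ▸ hv.1) (by rw [← hT]; exact hv.2)
  rw [h1, h2]
  exact (Ω.bil_diracVec_diracVec hdet F G).symm

end SymplecticForm

end

end SecondClass

end

/-! ### The theorem -/

theorem theorem3p13 {d : ℕ} {P : Type*} [TopologicalSpace P] [T2Space P]
    [SecondCountableTopology P] [ChartedSpace (EuclideanSpace ℝ (Fin d)) P]
    [IsManifold (𝓡 d) ∞ P] (Ω : SymplecticForm d P)
    (S : Set P) (hS : S.Nonempty) (k l : ℕ) (hSk : IsSubmanifold d S k)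
    (hker : ∀ x ∈ S, Module.finrank ℝ (Ω.ker (tangentAt (d := d) S x)) = l)
    (V : ∀ x : P, Submodule ℝ (TangentSpace (𝓡 d) x)) (hV : IsSubbundleAlong S V)
    (hVdisj : ∀ x ∈ S, V x ⊓ Ω.ker (tangentAt S x) = ⊥)
    (hVsup : ∀ x ∈ S, V x ⊔ Ω.ker (tangentAt S x) = Ω.orth (tangentAt S x)) :
    ∃ s : ℕ, k + l + 2 * s = d ∧
      (∃ N : Set P, Ω.IsSecondClassSubmanifold S V (k + l) N) ∧
      ∀ N : Set P, Ω.IsSecondClassSubmanifold S V (k + l) N →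
        -- local second class equations for `N`, with connected zero set
        (∀ x ∈ N, ∃ (U : Set P) (χ : Fin (2 * s) → P → ℝ), x ∈ U ∧
          Ω.IsSecondClassEquations N U χ ∧ IsConnected (N ∩ U)) ∧
        -- near points of `S` they are part of regular equations of `S`, the others first class
        (∀ x ∈ S, ∃ (U : Set P) (χ : Fin (2 * s) → P → ℝ) (ψ : Fin l → P → ℝ), x ∈ U ∧
          Ω.IsSecondClassEquations N U χ ∧ (∀ i, SmoothOn d U (ψ i)) ∧
          S ∩ U = {y ∈ U | (∀ i, χ i y = 0) ∧ ∀ j, ψ j y = 0} ∧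
          (∀ y ∈ U, LinearIndependent ℝ
            (Sum.elim (fun i => differential d (χ i) y) (fun j => differential d (ψ j) y))) ∧
          ∀ j, ∀ y ∈ S ∩ U, Ω.hamVec (ψ j) y ∈ tangentAt S y) ∧
        -- the Dirac bracket and its leaves in `N`
        ∀ (U : Set P) (χ : Fin (2 * s) → P → ℝ), Ω.IsSecondClassEquations N U χ →
          IsPoissonBracketOn d U (Ω.diracBracket χ) ∧
          (∀ x ∈ N ∩ U, symplecticLeaf d U (Ω.diracBracket χ) x =
            connectedComponentIn (N ∩ U) x) ∧
          ∀ F G : P → ℝ, SmoothOn d U F → SmoothOn d U G → ∀ x ∈ N ∩ U,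
            ∀ u v : TangentSpace (𝓡 d) x,
              Ω.IsRestrictedHamVec N F x u → Ω.IsRestrictedHamVec N G x v →
                Ω.diracBracket χ F G x = Ω.form x ![u, v] := by
  have hVn : ∀ x ∈ S, k + l + Module.finrank ℝ (V x) = d := fun x hx => by
    have := SymplecticForm.finrank_complement (hVdisj x hx) (hVsup x hx)
    rwa [finrank_tangentAt hSk hx, hker x hx] at this
  have hVΩ : ∀ x ∈ S, V x ⊓ Ω.orth (V x) = ⊥ := fun x hx =>
    SymplecticForm.inf_orth_eq_bot_of_complement (hVdisj x hx) (hVsup x hx)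
  obtain ⟨x₀, hx₀⟩ := hS
  obtain ⟨s, hs⟩ := (even_iff_exists_two_mul.1 (SymplecticForm.even_finrank (hVΩ x₀ hx₀)))
  have hd : k + l + 2 * s = d := hs ▸ hVn x₀ hx₀
  have hd' : 2 * s + (k + l) = d := by omega
  refine ⟨s, hd, ?_, fun N hN => ⟨fun x hx => ?_, fun x hx => ?_, fun U χ hχ => ⟨?_, ?_, ?_⟩⟩⟩
  -- The prescribed common kernel along `S` is K = V^Ω, found by unification from the local
  -- functions.
  · obtain ⟨c⟩ := SymplecticForm.exists_adaptedCover (n := 2 * s) ⟨x₀, hx₀⟩ fun x hx =>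
      SymplecticForm.exists_functions_of_subbundle hSk hV
        (fun y hy => (le_sup_left : V y ≤ _).trans (hVsup y hy).le)
        (fun y hy => by have := hVn y hy; omega) hVΩ hx
    exact ⟨_, c.isSecondClassSubmanifold_glued hd' fun _ _ => rfl⟩
  · exact SymplecticForm.exists_secondClassEquations hd' hN.isSubmanifold hx (hN.symplectic x hx)
  · exact SymplecticForm.exists_firstClass_equations hd' hSk hVsup hN hx
  · exact SymplecticForm.isPoissonBracketOn_diracBracket hχ.isOpen hχ.smooth hχ.det_ne_zero
  · exact fun x hx => SymplecticForm.symplecticLeaf_diracBracket hχ hN.isSubmanifold hx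
  · exact fun F G _ _ x hx u v hu hv =>
      SymplecticForm.diracBracket_eq_form hχ hN.isSubmanifold hd' hx hu hv
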